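/- Let $\mathfrak g$ be an $N$-dimensional real Lie algebra with basis $\hat z_1,\dots,\hat z_N$ and structure constants $f_{AB}{}^C$, let $\lambda$ be a formal parameter, and consider the rescaled relations $[\hat z_A,\hat z_B]=\lambda f_{AB}{}^C\hat z_C$ (repeated indices are summed). Put $c_A=f_{AB}{}^B$. Let $Z_A=\psi_A{}^B(\zeta)\,\partial/\partial\zeta^B$ be the left-invariant vector fields of the corresponding group in coordinates $\zeta^1,\dots,\zeta^N$ vanishing at the identity, the $\psi_A{}^B$ being formal power series in $\lambda$ with polynomial coefficients in $\zeta$. That is, $[Z_A,Z_B]=\lambda f_{AB}{}^C Z_C$, $\psi_A{}^B(0)=\delta_A{}^B$ and $\psi_A{}^B|_{\lambda=0}=\delta_A{}^B$. Let $\mathcal F=C^\infty(\mathbb R^N)[[\lambda]]$ be the algebra of functions of commuting variables $z_1,\dots,z_N$, with the topology of coefficientwise convergence in $\lambda$, each coefficient in the $C^\infty$ topology (locally uniform convergence of all derivatives). An expression in $\zeta,z$ with $z_A\zeta^B=\delta_A{}^B+\zeta^B z_A$ acts on $\mathcal F$ from the right, $z_A$ by multiplication by $z_A$ and $\zeta^A$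 by $\partial/\partial z_A$. The map $\omega$ brings all $\zeta$'s to the left and sets $\zeta=0$; equivalently, it applies the operator to $1$. Let $\hat{\mathcal F}$ be the completed algebra of functions $\hat f(\hat z)$, realized by $\hat z_A\mapsto Z_A=\psi_A{}^B(\zeta)z_B$ as the closure, for pointwise convergence on $\mathcal F$ and in the algebra of continuous $\mathbb R[[\lambda]]$-linear operators acting on $\mathcal F$ from the right, of the $\mathbb R[[\lambda]]$-algebra generated by the $Z_A$. Put $$\Omega(\hat f)=\omega(\hat f(Z))\in\mathcal F,\qquad \int\!\!\hat f=\int_{\mathbb R^N}\Omega(\hat f)\,d^Nz\in\mathbb R[[\lambda]],$$ the last integral being taken coefficientwise in $\lambda$ when all coefficients are Lebesgue integrable. Then there is exactly one continuous $\mathbb R[[\lambda]]$-algebra endomorphism $\hat g(\hat z)\mapsto\hat g(\hat z+\lambda c)$ of $\hat{\mathcal F}$ with $\hat z_A\mapsto\hat z_A+\lambda c_A$. Moreover, let $\hat f,\hat g\in\hat{\mathcal F}$ be such that, with $f=\Omega(\hat f)=\sum_m\lambda^mf_m$ and $g=\Omega(\hat g)=\sum_n\lambda^ng_n$, all functions $p\,(\partial^\alpha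 f_m)(\partial^\beta g_n)$, for $p$ a polynomial on $\mathbb R^N$, $\alpha,\beta$ multi-indices and $m,n\ge 0$, are Lebesgue integrable on $\mathbb R^N$ (for example, $f$ arbitrary and every $g_n$ compactly supported, or all $f_m,g_n$ Schwartz functions). Then all $\lambda$-coefficients of $\Omega\big(\hat f(\hat z)\hat g(\hat z)\big)$ and of $\Omega\big(\hat g(\hat z+\lambda c)\hat f(\hat z)\big)$ are integrable, and $$\int\!\!\hat f(\hat z)\,\hat g(\hat z)=\int\!\!\hat g(\hat z+\lambda c)\,\hat f(\hat z).$$ -/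

import Mathlib

open scoped ContDiff PowerSeries PowerSeries.WithPiTopology

noncomputable section

/-- The `ℝ`-algebra of smooth real functions of `z ∈ ℝ^N`, as a subalgebra of all functions. -/
def smoothSubalgebra (N : ℕ) : Subalgebra ℝ ((Fin N → ℝ) → ℝ) where
  carrier := {f | ContDiff ℝ ∞ f}
  mul_mem' hf hg := by
    rw [Set.mem_ofPred_eq] at *; exact hf.mul hg
  add_mem' hf hg := by
    rw [Set.mem_ofPred_eq] at *; exact hf.add hg
  algebraMap_mem' r := by
    rw [Set.mem_ofPred_eq]; exact (contDiff_const : ContDiff ℝ ∞ fun _ : Fin N → ℝ => r)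

/-- The algebra `C^∞(ℝ^N)`. -/
def SmoothFn (N : ℕ) : Type := smoothSubalgebra N

namespace SmoothFn

variable {N : ℕ}

instance : CommRing (SmoothFn N) := inferInstanceAs (CommRing (smoothSubalgebra N))

instance : Algebra ℝ (SmoothFn N) := inferInstanceAs (Algebra ℝ (smoothSubalgebra N))

instance : CoeFun (SmoothFn N) (fun _ => (Fin N → ℝ) → ℝ) := ⟨fun f => f.1⟩

theorem contDiff (f : SmoothFn N) : ContDiff ℝ ∞ f := f.2

@[ext]
theorem ext {f g : SmoothFn N} (h : ∀ z, f z = g z) : f = g := Subtype.ext (funext h)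

@[simp] theorem add_apply (f g : SmoothFn N) (z : Fin N → ℝ) : (f + g) z = f z + g z := rfl

@[simp] theorem mul_apply (f g : SmoothFn N) (z : Fin N → ℝ) : (f * g) z = f z * g z := rfl

@[simp] theorem smul_apply (r : ℝ) (f : SmoothFn N) (z : Fin N → ℝ) : (r • f) z = r * f z := rfl

/-- The coordinate function `z_A`. -/
def coord (A : Fin N) : SmoothFn N := ⟨fun z => z A, (contDiff_apply ℝ ℝ A : ContDiff ℝ ∞ _)⟩

/-- The partial derivative `∂/∂z_A`. -/
def partialDeriv (A : Fin N) : Module.End ℝ (SmoothFn N) where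
  toFun f := ⟨fun z => fderiv ℝ f z (Pi.single A 1),
    (f.contDiff.fderiv_right (m := ∞) (by simp)).clm_apply contDiff_const⟩
  map_add' f g := by
    ext z
    have hf := (f.contDiff.differentiable (by simp)) z
    have hg := (g.contDiff.differentiable (by simp)) z
    change fderiv ℝ ((f : (Fin N → ℝ) → ℝ) + (g : (Fin N → ℝ) → ℝ)) z _ = fderiv ℝ f z _ + fderiv ℝ g z _
    rw [fderiv_add hf hg]; rfl
  map_smul' r f := by
    ext z
    have hf := (f.contDiff.differentiable (by simp)) z
    change fderiv ℝ (r • (f : (Fin N → ℝ) → ℝ)) z _ = r * fderiv ℝ f z _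
    rw [fderiv_const_smul hf]; rfl

theorem partialDeriv_mul (A : Fin N) (f g : SmoothFn N) :
    partialDeriv A (f * g) = partialDeriv A f * g + f * partialDeriv A g := by
  ext z
  have hf := (f.contDiff.differentiable (by simp)) z
  have hg := (g.contDiff.differentiable (by simp)) z
  change fderiv ℝ ((f : (Fin N → ℝ) → ℝ) * (g : (Fin N → ℝ) → ℝ)) z _ =
    fderiv ℝ f z _ * g z + f z * fderiv ℝ g z _
  rw [fderiv_mul hf hg]
  simp; ring

/-- The iterated partial derivative `∂_{A₁} ⋯ ∂_{A_k}` for a word `w = [A₁, …, A_k]`. -/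
def partials (w : List (Fin N)) : Module.End ℝ (SmoothFn N) := (w.map partialDeriv).prod

/-- `∂_w f` as a continuous function. -/
def partialsC (w : List (Fin N)) (f : SmoothFn N) : C((Fin N → ℝ), ℝ) :=
  ⟨partials w f, (partials w f).contDiff.continuous⟩

/-- The usual Fréchet topology of `C^∞(ℝ^N)`: uniform convergence on compact sets of all iterated
partial derivatives. -/
instance : TopologicalSpace (SmoothFn N) :=
  TopologicalSpace.induced (fun f (w : List (Fin N)) => partialsC w f) inferInstance

theorem continuous_iff {X : Type*} [TopologicalSpace X] {F : X → SmoothFn N} :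
    Continuous F ↔ ∀ w, Continuous fun x => partialsC w (F x) := by
  rw [continuous_induced_rng, continuous_pi_iff]; rfl

theorem continuous_partialsC (w : List (Fin N)) :
    Continuous (partialsC w : SmoothFn N → _) :=
  continuous_iff.1 continuous_id w

theorem continuous_partials (v : List (Fin N)) : Continuous (partials (N := N) v) := by
  rw [continuous_iff]
  intro w
  have : (fun f : SmoothFn N => partialsC w (partials v f)) = partialsC (w ++ v) := by
    funext f; ext z; simp [partialsC, partials]
  rw [this]
  exact continuous_partialsC _

theorem continuous_partialDeriv (A : Fin N) : Continuous (partialDeriv (N := N) A) := by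
  simpa [partials] using continuous_partials [A]

instance : IsTopologicalRing (SmoothFn N) where
  continuous_add := by
    rw [continuous_iff]
    intro w
    have : (fun p : SmoothFn N × SmoothFn N => partialsC w (p.1 + p.2)) =
        fun p => partialsC w p.1 + partialsC w p.2 := by
      funext p; ext z; simp [partialsC]
    rw [this]
    exact ((continuous_partialsC w).comp continuous_fst).add
      ((continuous_partialsC w).comp continuous_snd)
  continuous_neg := by
    rw [continuous_iff]
    intro w
    have : (fun p : SmoothFn N => partialsC w (-p)) = fun p => -partialsC w p := by
      funext p; ext z; simp only [partialsC, map_neg]; rfl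
    rw [this]
    exact (continuous_partialsC w).neg
  continuous_mul := by
    rw [continuous_iff]
    intro w
    suffices H : ∀ a b : SmoothFn N × SmoothFn N → SmoothFn N, Continuous a → Continuous b →
        Continuous fun p => partialsC w (a p * b p) from H _ _ continuous_fst continuous_snd
    induction w using List.reverseRecOn with
    | nil =>
      intro a b ha hb
      have : (fun p => partialsC [] (a p * b p)) =
          fun p => partialsC [] (a p) * partialsC [] (b p) := by
        funext p; ext z; simp [partialsC, partials]
      rw [this]
      exact ((continuous_partialsC _).comp ha).mul ((continuous_partialsC _).comp hb)
    | append_singleton w A ih =>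
      intro a b ha hb
      have : (fun p => partialsC (w ++ [A]) (a p * b p)) =
          fun p => partialsC w (partialDeriv A (a p) * b p) +
            partialsC w (a p * partialDeriv A (b p)) := by
        funext p; ext z; simp [partialsC, partials, partialDeriv_mul]
      rw [this]
      exact (ih _ _ ((continuous_partialDeriv A).comp ha) hb).add
        (ih _ _ ha ((continuous_partialDeriv A).comp hb))

/-- `∂^α = ∏_A (∂/∂z_A)^{α_A}` for a multi-index `α`. -/
def multiPartial (α : Fin N →₀ ℕ) : Module.End ℝ (SmoothFn N) :=
  partials ((List.finRange N).flatMap fun A => List.replicate (α A) A)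

@[simp] theorem multiPartial_zero : multiPartial (0 : Fin N →₀ ℕ) = 1 := by
  have h : ((List.finRange N).flatMap fun _ => ([] : List (Fin N))) = [] := by
    simp [List.flatMap_eq_nil_iff]
  simp [multiPartial, partials, h]

/-- The differential operator `f ↦ ∑_α a_α(z) ∂^α f` attached to `∑_α ζ^α a_α(z)`. -/
def symbolOp (p : MvPolynomial (Fin N) (SmoothFn N)) : Module.End ℝ (SmoothFn N) :=
  ∑ α ∈ p.support, LinearMap.mulLeft ℝ (p.coeff α) * multiPartial α

theorem continuous_symbolOp (p : MvPolynomial (Fin N) (SmoothFn N)) :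
    Continuous (symbolOp p) := by
  have : ⇑(symbolOp p) = fun f => ∑ α ∈ p.support, p.coeff α * multiPartial α f := by
    funext f; simp [symbolOp]
  rw [this]
  exact continuous_finsetSum _ fun α _ => continuous_const.mul (continuous_partials _)

end SmoothFn

/-- `F = C^∞(ℝ^N)[[λ]]`; the power series variable `X` is the formal parameter `λ`. -/
abbrev FormalFn (N : ℕ) : Type := PowerSeries (SmoothFn N)

instance (N : ℕ) : ContinuousConstSMul ℝ⟦X⟧ (FormalFn N) where
  continuous_const_smul r := by
    simp only [Algebra.smul_def]
    exact continuous_const.mul continuous_id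


/-- The formal power series in `λ` of operators `∑ λ^n D_n`, acting on `F`. -/
def formalOp {N : ℕ} (D : ℕ → Module.End ℝ (SmoothFn N)) (f : FormalFn N) : FormalFn N :=
  PowerSeries.mk fun n => ∑ p ∈ Finset.HasAntidiagonal.antidiagonal n, D p.1 (PowerSeries.coeff p.2 f)

theorem formalOp_smul {N : ℕ} (D : ℕ → Module.End ℝ (SmoothFn N)) (r : ℝ⟦X⟧) (f : FormalFn N) :
    formalOp D (r • f) = r • formalOp D f := by
  have key : ∀ (g : FormalFn N) (n : ℕ), PowerSeries.coeff n (r • g) =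
      ∑ p ∈ Finset.HasAntidiagonal.antidiagonal n, PowerSeries.coeff p.1 r • PowerSeries.coeff p.2 g := by
    intro g n
    rw [Algebra.smul_def, PowerSeries.coeff_mul]
    refine Finset.sum_congr rfl fun p _ => ?_
    rw [PowerSeries.algebraMap_apply'', PowerSeries.coeff_map, Algebra.smul_def]
  ext1 n
  rw [key]
  simp only [formalOp, PowerSeries.coeff_mk, key, map_sum, map_smul, Finset.smul_sum]
  rw [Finset.sum_sigma', Finset.sum_sigma']
  refine Finset.sum_nbij' (fun x => ⟨(x.2.1, x.1.1 + x.2.2), (x.1.1, x.2.2)⟩)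
    (fun x => ⟨(x.2.1, x.1.1 + x.2.2), (x.1.1, x.2.2)⟩) ?_ ?_ ?_ ?_ ?_
  all_goals
    rintro ⟨⟨a, b⟩, ⟨c, d⟩⟩ h
    simp only [Finset.mem_sigma, Finset.HasAntidiagonal.mem_antidiagonal] at h ⊢
  · obtain ⟨h1, h2⟩ := h; exact ⟨by omega, trivial⟩
  · obtain ⟨h1, h2⟩ := h; exact ⟨by omega, trivial⟩
  · obtain ⟨h1, h2⟩ := h; subst h2; rfl
  · obtain ⟨h1, h2⟩ := h; subst h2; rfl

/-- The algebra of continuous `ℝ[[λ]]`-linear operators acting on `F` *from the right*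
(whence the opposite multiplication: `f · (S T) = (f · S) · T`). -/
def RightOp (N : ℕ) : Type := (FormalFn N →L[ℝ⟦X⟧] FormalFn N)ᵐᵒᵖ

namespace RightOp

variable {N : ℕ}

instance : Ring (RightOp N) := inferInstanceAs (Ring (FormalFn N →L[ℝ⟦X⟧] FormalFn N)ᵐᵒᵖ)

instance : Algebra ℝ⟦X⟧ (RightOp N) :=
  inferInstanceAs (Algebra ℝ⟦X⟧ (FormalFn N →L[ℝ⟦X⟧] FormalFn N)ᵐᵒᵖ)

/-- The right action `f · T`. -/
def act (f : FormalFn N) (T : RightOp N) : FormalFn N := MulOpposite.unop T f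

theorem continuous_act_left (T : RightOp N) : Continuous fun f => act f T :=
  (MulOpposite.unop T).continuous

theorem act_mul (f : FormalFn N) (S T : RightOp N) : act f (S * T) = act (act f S) T := rfl

theorem act_add (f : FormalFn N) (S T : RightOp N) : act f (S + T) = act f S + act f T := rfl

theorem act_algebraMap (f : FormalFn N) (r : ℝ⟦X⟧) :
    act f (algebraMap ℝ⟦X⟧ (RightOp N) r) = r • f := rfl

/-- The topology of pointwise convergence of operators. -/
instance : TopologicalSpace (RightOp N) :=
  TopologicalSpace.induced (fun T (f : FormalFn N) => act f T) inferInstance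

theorem continuous_iff {Y : Type*} [TopologicalSpace Y] {T : Y → RightOp N} :
    Continuous T ↔ ∀ f, Continuous fun y => act f (T y) := by
  rw [continuous_induced_rng, continuous_pi_iff]; rfl

theorem continuous_act_right (f : FormalFn N) : Continuous fun T => act f T :=
  continuous_iff.1 continuous_id f

instance : IsSemitopologicalSemiring (RightOp N) where
  continuous_add := continuous_iff.2 fun f =>
    ((continuous_act_right f).comp continuous_fst).add ((continuous_act_right f).comp continuous_snd)
  continuous_const_mul {S} := continuous_iff.2 fun f => continuous_act_right (act f S)
  continuous_mul_const {T} := continuous_iff.2 fun f =>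
    (continuous_act_left T).comp (continuous_act_right f)

/-- The operator of the normally ordered expression `∑_n λ^n ∑_α ζ^α a_{n,α}(z)` (all `ζ`'s to the
left), where `z_A` acts from the right on functions of `z` by multiplication by `z_A`, and `ζ^A`
acts from the right by `∂/∂z_A`. -/
def ordered (P : (MvPolynomial (Fin N) (SmoothFn N))⟦X⟧) : RightOp N :=
  MulOpposite.op
    { toFun := formalOp fun n => SmoothFn.symbolOp (PowerSeries.coeff n P)
      map_add' := fun f g => by
        ext1 n; simp [formalOp, Finset.sum_add_distrib]
      map_smul' := fun r f => formalOp_smul _ r f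
      cont := by
        refine continuous_pi fun d => ?_
        obtain ⟨m, rfl⟩ : ∃ m, d = Finsupp.single () m := ⟨d (), by ext; simp⟩
        have h : (fun f : FormalFn N => PowerSeries.coeff m (formalOp (fun n =>
            SmoothFn.symbolOp (PowerSeries.coeff n P)) f)) =
            fun f => ∑ p ∈ Finset.HasAntidiagonal.antidiagonal m,
              SmoothFn.symbolOp (PowerSeries.coeff p.1 P) (PowerSeries.coeff p.2 f) := by
          funext f
          exact PowerSeries.coeff_mk _ _
        change Continuous fun f : FormalFn N => PowerSeries.coeff m (formalOp (fun n =>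
            SmoothFn.symbolOp (PowerSeries.coeff n P)) f)
        rw [h]
        exact continuous_finsetSum _ fun p _ => (SmoothFn.continuous_symbolOp _).comp
          (PowerSeries.WithPiTopology.continuous_coeff _ _) }

theorem act_ordered (f : FormalFn N) (P : (MvPolynomial (Fin N) (SmoothFn N))⟦X⟧) :
    act f (ordered P) = formalOp (fun n => SmoothFn.symbolOp (PowerSeries.coeff n P)) f := rfl

/-- `ω(T)`: the operator applied to the constant function `1`. On a normally ordered expression it
sets `ζ = 0`, see `omega_ordered`. -/
def omega (T : RightOp N) : FormalFn N := act 1 T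

theorem partials_one (w : List (Fin N)) (hw : w ≠ []) :
    SmoothFn.partials w (1 : SmoothFn N) = 0 := by
  induction w using List.reverseRecOn with
  | nil => exact absurd rfl hw
  | append_singleton w A _ =>
    have h : SmoothFn.partialDeriv A (1 : SmoothFn N) = 0 := by
      have h1 := SmoothFn.partialDeriv_mul A (1 : SmoothFn N) 1
      simpa using h1
    simp [SmoothFn.partials, h]

theorem symbolOp_one (p : MvPolynomial (Fin N) (SmoothFn N)) :
    SmoothFn.symbolOp p 1 = MvPolynomial.constantCoeff p := by
  have h : ∀ α : Fin N →₀ ℕ, α ≠ 0 → SmoothFn.multiPartial α (1 : SmoothFn N) = 0 := by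
    intro α hα
    refine partials_one _ fun h0 => hα ?_
    ext A
    simpa using List.flatMap_eq_nil_iff.1 h0 A (List.mem_finRange A)
  simp only [SmoothFn.symbolOp, LinearMap.sum_apply, Module.End.mul_apply, LinearMap.mulLeft_apply]
  rw [Finset.sum_eq_single 0]
  · simp [MvPolynomial.constantCoeff_eq]
  · intro α _ hα
    rw [h α hα, mul_zero]
  · intro h0
    simp [MvPolynomial.notMem_support_iff.1 h0]

/-- `ω(∑ λ^n ζ^α a_{n,α}(z)) = ∑ λ^n a_{n,0}(z)`. -/
theorem omega_ordered (P : (MvPolynomial (Fin N) (SmoothFn N))⟦X⟧) :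
    omega (ordered P) = PowerSeries.map MvPolynomial.constantCoeff P := by
  ext1 n
  rw [omega, act_ordered, formalOp, PowerSeries.coeff_mk, PowerSeries.coeff_map, Finset.sum_eq_single (n, 0)]
  · simp [symbolOp_one]
  · rintro ⟨k, l⟩ hkl hne
    have hl : l ≠ 0 := by
      rintro rfl
      simp only [Finset.HasAntidiagonal.mem_antidiagonal, add_zero] at hkl
      exact hne (by rw [hkl])
    simp [PowerSeries.coeff_one, hl]
  · intro h
    simp at h

end RightOp

/-- Formal power series in `λ` whose coefficients are polynomials in the group coordinates
`ζ^1, …, ζ^N`. -/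
abbrev FormalZeta (N : ℕ) : Type := (MvPolynomial (Fin N) ℝ)⟦X⟧

/-- `∂/∂ζ^C`, coefficientwise. -/
def zetaDeriv {N : ℕ} (C : Fin N) (p : FormalZeta N) : FormalZeta N :=
  PowerSeries.mk fun n => MvPolynomial.pderiv C (PowerSeries.coeff n p)

section LieType

variable {N : ℕ} {𝔤 : Type*} [LieRing 𝔤] [LieAlgebra ℝ 𝔤]

/-- The structure constants `f_{AB}^C`. -/
def structConst (b : Module.Basis (Fin N) ℝ 𝔤) (A B C : Fin N) : ℝ := b.repr ⁅b A, b B⁆ C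

/-- The constants `c_A = ∑_B f_{AB}^B`. -/
def traceConst (b : Module.Basis (Fin N) ℝ 𝔤) (A : Fin N) : ℝ := ∑ B, structConst b A B B

/-- `Z_A = ∑_B ψ_A^B(ζ) ∂/∂ζ^B` are the left-invariant vector fields, in (formal) coordinates `ζ`
vanishing at the identity, of the group of the Lie algebra with bracket
`[ẑ_A, ẑ_B] = λ ∑_C f_{AB}^C ẑ_C`: they satisfy these commutation relations, `Z_A` is `∂/∂ζ^A` at
the identity `ζ = 0`, and `Z_A` reduces to `∂/∂ζ^A` for `λ = 0`. -/
structure IsLeftInvariantFrame (b : Module.Basis (Fin N) ℝ 𝔤)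
    (ψ : Matrix (Fin N) (Fin N) (FormalZeta N)) : Prop where
  counit : ∀ A B, PowerSeries.map MvPolynomial.constantCoeff (ψ A B) = if A = B then 1 else 0
  classical_limit : ∀ A B, PowerSeries.constantCoeff (ψ A B) = if A = B then 1 else 0
  commutator : ∀ A B D,
    ∑ C, (ψ A C * zetaDeriv C (ψ B D) - ψ B C * zetaDeriv C (ψ A D)) =
      PowerSeries.X * ∑ C, structConst b A B C • ψ C D

end LieType

section Quantum

variable {N : ℕ} (ψ : Matrix (Fin N) (Fin N) (FormalZeta N))

/-- The operator `Z_A = ∑_B ψ_A^B(ζ) z_B`. -/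
def frameOp (A : Fin N) : RightOp N :=
  RightOp.ordered (∑ B, PowerSeries.map (MvPolynomial.map (algebraMap ℝ (SmoothFn N))) (ψ A B) *
    PowerSeries.C (MvPolynomial.C (SmoothFn.coord B)))

/-- The completed algebra `F̂` of noncommutative functions `f̂(ẑ)`, realized by the substitution
`ẑ_A ↦ Z_A`: the closure of the `ℝ[[λ]]`-algebra generated by the `Z_A`. -/
def QuantumFn : Subalgebra ℝ⟦X⟧ (RightOp N) :=
  (Algebra.adjoin ℝ⟦X⟧ (Set.range (frameOp ψ))).topologicalClosure

/-- The generator `ẑ_A` of `F̂`. -/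
def qcoord (A : Fin N) : QuantumFn ψ :=
  ⟨frameOp ψ A, subset_closure (Algebra.subset_adjoin ⟨A, rfl⟩)⟩

variable {ψ}

/-- `Ω(f̂(ẑ)) = ω(f̂(Z))`. -/
def Omega (f : QuantumFn ψ) : FormalFn N := RightOp.omega (f : RightOp N)

/-- `K` is the translation `ĝ(ẑ) ↦ ĝ(ẑ + a)` of `F̂`. -/
def IsTranslation (a : Fin N → ℝ⟦X⟧) (K : QuantumFn ψ →ₐ[ℝ⟦X⟧] QuantumFn ψ) : Prop :=
  Continuous K ∧ ∀ A, K (qcoord ψ A) = qcoord ψ A + algebraMap ℝ⟦X⟧ (QuantumFn ψ) (a A)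

end Quantum

/-- Each coefficient in `λ` is Lebesgue integrable over `ℝ^N`. -/
def FormalIntegrable {N : ℕ} (h : FormalFn N) : Prop :=
  ∀ n, MeasureTheory.Integrable (fun z : Fin N → ℝ => PowerSeries.coeff n h z)

/-- `∫ h(z) d^N z`, coefficientwise in `λ`. -/
def formalIntegral {N : ℕ} (h : FormalFn N) : ℝ⟦X⟧ :=
  PowerSeries.mk fun n => ∫ z : Fin N → ℝ, PowerSeries.coeff n h z

/-- The integral `∫ f̂ = ∫ Ω(f̂) d^N z` on `F̂`. -/
def quantumIntegral {N : ℕ} {ψ : Matrix (Fin N) (Fin N) (FormalZeta N)} (f : QuantumFn ψ) :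
    ℝ⟦X⟧ := formalIntegral (Omega f)

/-- All products of a polynomial, an iterated partial derivative of a `λ`-coefficient of `f` and
one of `g` are Lebesgue integrable over `ℝ^N`. -/
def IntegrablePair {N : ℕ} (f g : FormalFn N) : Prop :=
  ∀ (m n : ℕ) (v w : List (Fin N)) (p : MvPolynomial (Fin N) ℝ),
    MeasureTheory.Integrable (fun z : Fin N → ℝ => MvPolynomial.eval z p *
      SmoothFn.partials v (PowerSeries.coeff m f) z * SmoothFn.partials w (PowerSeries.coeff n g) z)

end

noncomputable section

/-! The right action of the `Z_A` is governed by the operators that commute with it. There is a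
formal star product `f ⋆ g = ∑ λ^n b_n(f, g)` of bidifferential operators with polynomial
coefficients, with `b_0` the pointwise product and `1` a right unit, such that left multiplication
`L_f = f ⋆ ·` commutes with every `Z_A`, hence by continuity with every `T` in the completed
algebra. Then `f · T = L_f(1) · T = L_f(1 · T) = f ⋆ Ω(T)`, so `Ω` turns products into star products
(`IsStarProduct.act_eq`).

The star product, the modular function `s` with `Z_A s = λ c_A s`, and the coefficients of the
right-invariant fields all come from one existence theorem for flat sections, `exists_flat_section`.
It proceeds order by order in `λ`, with a Poincaré lemma whose homotopy inverts an Euler operator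
plus one.

The translation by `λ c` is conjugation by `s(∂)`, because `s Z_A s⁻¹ = Z_A + λ c_A`; as `s(0) = 1`,
it becomes `s(∂)` under `Ω`. The trace identity starts at the generators: `L_{z_A}` is the
right-invariant field `∑_B Z_B r_B(∂)`, and for compactly supported `h` the rule `∫ p(∂) h = p(0) ∫
h` gives `∫ z_A ⋆ h = ∫ h · Z_A - λ c_A ∫ h`. Induction over products extends this to `∫ f · T = ∫
(s(∂) Ω(T)) ⋆ f` for compactly supported `f` and `T` in the algebra generated by the `Z_A`.

For general arguments, integration by parts writes the difference of the two sides as `∫ f · D g`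
with a series `D` of differential operators with polynomial coefficients. The special case forces
`D` to kill all `Ω(T)`. Their classical limits exhaust the polynomials, and a differential operator
with polynomial coefficients is determined by its values on polynomials. Hence `D = 0`
(`IsLeftInvariantFrame.formalIntegral_eq_zero`), and the identity holds for every integrable pair,
with no approximation of `f` or `g`. -/

theorem sum_antidiagonal_triple {M : Type*} [AddCommMonoid M] (n : ℕ) (F : ℕ → ℕ → ℕ → M) :
    ∑ p ∈ Finset.HasAntidiagonal.antidiagonal n,
      ∑ q ∈ Finset.HasAntidiagonal.antidiagonal p.1, F q.1 q.2 p.2 =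
    ∑ p ∈ Finset.HasAntidiagonal.antidiagonal n,
      ∑ q ∈ Finset.HasAntidiagonal.antidiagonal p.2, F p.1 q.1 q.2 := by
  rw [Finset.sum_sigma', Finset.sum_sigma']
  refine Finset.sum_nbij' (fun x => ⟨(x.2.1, x.2.2 + x.1.2), (x.2.2, x.1.2)⟩)
    (fun x => ⟨(x.1.1 + x.2.1, x.2.2), (x.1.1, x.2.1)⟩) ?_ ?_ ?_ ?_ ?_
  all_goals
    rintro ⟨⟨a, b⟩, ⟨c, d⟩⟩ h
    simp only [Finset.mem_sigma, Finset.HasAntidiagonal.mem_antidiagonal] at h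
    obtain ⟨h1, h2⟩ := h
    subst h2
  · simp only [Finset.mem_sigma, Finset.HasAntidiagonal.mem_antidiagonal, and_true]; omega
  · simp only [Finset.mem_sigma, Finset.HasAntidiagonal.mem_antidiagonal, and_true]; omega
  all_goals rfl

/-! ### Formal power series of endomorphisms. -/

section SeriesAction

variable {V : Type*} [AddCommGroup V] [Module ℝ V]

/-- A formal power series of endomorphisms of `V` acting on a sequence of elements of `V`, regarded
as a formal power series with coefficients in `V`. -/
def seriesAct (P : PowerSeries (Module.End ℝ V)) (v : ℕ → V) (n : ℕ) : V :=
  ∑ p ∈ Finset.HasAntidiagonal.antidiagonal n, PowerSeries.coeff p.1 P (v p.2)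

theorem seriesAct_mul (P Q : PowerSeries (Module.End ℝ V)) (v : ℕ → V) :
    seriesAct (P * Q) v = seriesAct P (seriesAct Q v) := by
  funext n
  simp only [seriesAct, PowerSeries.coeff_mul, LinearMap.sum_apply, map_sum, Module.End.mul_apply]
  exact sum_antidiagonal_triple n fun i j k =>
    PowerSeries.coeff i P (PowerSeries.coeff j Q (v k))

theorem seriesAct_add_left (P Q : PowerSeries (Module.End ℝ V)) (v : ℕ → V) :
    seriesAct (P + Q) v = seriesAct P v + seriesAct Q v := by
  funext n; simp [seriesAct, Finset.sum_add_distrib]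

theorem seriesAct_sub_left (P Q : PowerSeries (Module.End ℝ V)) (v : ℕ → V) :
    seriesAct (P - Q) v = seriesAct P v - seriesAct Q v := by
  funext n; simp [seriesAct, Finset.sum_sub_distrib]

theorem seriesAct_smul_left (r : ℝ) (P : PowerSeries (Module.End ℝ V)) (v : ℕ → V) :
    seriesAct (r • P) v = r • seriesAct P v := by
  funext n; simp [seriesAct, Finset.smul_sum]

theorem seriesAct_sum_left {ι : Type*} (s : Finset ι) (P : ι → PowerSeries (Module.End ℝ V))
    (v : ℕ → V) : seriesAct (∑ i ∈ s, P i) v = ∑ i ∈ s, seriesAct (P i) v := by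
  funext n
  simp only [seriesAct, map_sum, LinearMap.sum_apply, Finset.sum_apply]
  exact Finset.sum_comm

theorem seriesAct_X_mul_succ (P : PowerSeries (Module.End ℝ V)) (v : ℕ → V) (n : ℕ) :
    seriesAct (PowerSeries.X * P) v (n + 1) = seriesAct P v n := by
  simp only [seriesAct]
  rw [Finset.Nat.sum_antidiagonal_succ]
  simp [PowerSeries.coeff_succ_X_mul]

theorem seriesAct_X_mul_zero (P : PowerSeries (Module.End ℝ V)) (v : ℕ → V) :
    seriesAct (PowerSeries.X * P) v 0 = 0 := by
  simp [seriesAct]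

theorem seriesAct_eq_constantCoeff (P : PowerSeries (Module.End ℝ V)) (v : ℕ → V) (n : ℕ)
    (h : ∀ j < n, v j = 0) : seriesAct P v n = PowerSeries.constantCoeff P (v n) := by
  rw [seriesAct, Finset.sum_eq_single (0, n)]
  · simp
  · rintro ⟨i, j⟩ hij hne
    rw [Finset.HasAntidiagonal.mem_antidiagonal] at hij
    simp only at hij
    have : j < n := by
      rcases Nat.eq_zero_or_pos i with rfl | hi
      · exact absurd (by rw [← hij, zero_add]) hne
      · omega
    simp [h j this]
  · simp

end SeriesAction

/-! ### Poincaré lemma and flat sections, order by order in `λ`. -/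

section FlatSection

variable {N : ℕ} {V : Type*} [AddCommGroup V] [Module ℝ V]

/-- The Euler operator `∑_A ε_A δ_A` of a representation of the Weyl algebra. -/
def eulerOp (ε δ : Fin N → Module.End ℝ V) : Module.End ℝ V := ∑ A, ε A * δ A

theorem eulerOp_apply (ε δ : Fin N → Module.End ℝ V) (u : V) :
    eulerOp ε δ u = ∑ A, ε A (δ A u) := by
  simp [eulerOp]

/-- The submodule `U` is spanned by eigenvectors of `E` whose eigenvalues are natural numbers. -/
def IsGraded (E : Module.End ℝ V) (U : Submodule ℝ V) : Prop :=
  ∀ u ∈ U, u ∈ Submodule.span ℝ {x | x ∈ U ∧ ∃ m : ℕ, E x = (m : ℝ) • x}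

/-- On an eigenvector with eigenvalue `m ≥ 0` one divides by `m + 1`, which is never zero. -/
theorem IsGraded.exists_preimage {E : Module.End ℝ V} {U : Submodule ℝ V} (h : IsGraded E U)
    {u : V} (hu : u ∈ U) : ∃ x ∈ U, E x + x = u := by
  have := h u hu
  clear hu
  induction this using Submodule.span_induction with
  | mem x hx =>
    obtain ⟨hxU, m, hm⟩ := hx
    refine ⟨((m : ℝ) + 1)⁻¹ • x, U.smul_mem _ hxU, ?_⟩
    have : (m : ℝ) + 1 ≠ 0 := by positivity
    have h2 : (m : ℝ) • x + x = ((m : ℝ) + 1) • x := by rw [add_smul, one_smul]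
    rw [map_smul, hm, ← smul_add, h2, smul_smul, inv_mul_cancel₀ this, one_smul]
  | zero => exact ⟨0, U.zero_mem, by simp⟩
  | add x y _ _ hx hy =>
    obtain ⟨a, ha, rfl⟩ := hx
    obtain ⟨b, hb, rfl⟩ := hy
    exact ⟨a + b, U.add_mem ha hb, by rw [map_add]; abel⟩
  | smul r x _ hx =>
    obtain ⟨a, ha, rfl⟩ := hx
    exact ⟨r • a, U.smul_mem _ ha, by rw [map_smul, smul_add]⟩

/-- Some product of factors `E - m` with natural `m` annihilates `u`, while on an eigenvector with
eigenvalue `-s` it acts by the nonzero scalar `∏ (-s - m)`. Eigenvalues of `E` on `U` are therefore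
never negative. -/
theorem IsGraded.eq_zero {E : Module.End ℝ V} {U : Submodule ℝ V} (h : IsGraded E U)
    {u : V} (hu : u ∈ U) {s : ℝ} (hs : 0 < s) (hE : E u = -s • u) : u = 0 := by
  have key : ∃ F : Finset ℕ, (Polynomial.aeval E (∏ m ∈ F, (Polynomial.X - Polynomial.C (m : ℝ)))) u
      = 0 := by
    have := h u hu
    clear hu hE
    induction this using Submodule.span_induction with
    | mem x hx =>
      obtain ⟨-, m, hm⟩ := hx
      exact ⟨{m}, by simp [hm, Nat.cast_smul_eq_nsmul]⟩
    | zero => exact ⟨∅, by simp⟩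
    | add x y _ _ hx hy =>
      classical
      obtain ⟨F, hF⟩ := hx
      obtain ⟨G, hG⟩ := hy
      refine ⟨F ∪ G, ?_⟩
      have h1 : ∀ {F' : Finset ℕ} {z : V}, F' ⊆ F ∪ G → (Polynomial.aeval E
          (∏ m ∈ F', (Polynomial.X - Polynomial.C (m : ℝ)))) z = 0 → (Polynomial.aeval E
          (∏ m ∈ F ∪ G, (Polynomial.X - Polynomial.C (m : ℝ)))) z = 0 := by
        intro F' z hsub hz
        rw [← Finset.prod_sdiff hsub, map_mul, Module.End.mul_apply, hz, map_zero]
      rw [map_add, h1 Finset.subset_union_left hF, h1 Finset.subset_union_right hG, add_zero]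
    | smul r x _ hx =>
      obtain ⟨F, hF⟩ := hx
      exact ⟨F, by rw [map_smul, hF, smul_zero]⟩
  obtain ⟨F, hF⟩ := key
  have h2 : ∀ p : Polynomial ℝ, Polynomial.aeval E p u = p.eval (-s) • u := by
    intro p
    induction p using Polynomial.induction_on with
    | C a => simp [Module.algebraMap_end_apply]
    | add p q hp hq => simp [hp, hq, add_smul]
    | monomial n a ih =>
      have : (Polynomial.C a * Polynomial.X ^ (n + 1) : Polynomial ℝ) =
        Polynomial.X * (Polynomial.C a * Polynomial.X ^ n) := by ring
      rw [this, map_mul, Module.End.mul_apply, ih, map_smul, Polynomial.aeval_X, hE, smul_smul,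
        Polynomial.eval_mul (p := Polynomial.X), Polynomial.eval_X, mul_comm]
  rw [h2, Polynomial.eval_prod, smul_eq_zero] at hF
  refine hF.resolve_left (Finset.prod_ne_zero_iff.2 fun m _ => ?_)
  simp only [Polynomial.eval_sub, Polynomial.eval_X, Polynomial.eval_C]
  have : (0 : ℝ) ≤ m := m.cast_nonneg
  linarith

/-- The Poincaré lemma for a graded representation of the Weyl algebra. -/
theorem exists_potential {ε δ : Fin N → Module.End ℝ V} {U : Submodule ℝ V}
    (hδU : ∀ A, ∀ u ∈ U, δ A u ∈ U)
    (hweyl : ∀ A B, δ A * ε B = ε B * δ A + if A = B then 1 else 0)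
    (hδδ : ∀ A B, δ A * δ B = δ B * δ A) (hgr : IsGraded (eulerOp ε δ) U)
    {h : Fin N → V} (hU : ∀ A, h A ∈ U) (hcl : ∀ A B, δ A (h B) = δ B (h A)) :
    ∃ u : Fin N → V, (∀ A, u A ∈ U) ∧ ∀ B, δ B (∑ A, ε A (u A)) = h B := by
  -- The homotopy formula of the Poincaré lemma: the potential is `∑ ε_A u_A` with `(E + 1) u_A =
  -- h_A`, the division by `m + 1` playing the role of `∫₀¹ t^m dt`.
  choose u huU hu using fun A => hgr.exists_preimage (hU A)
  have hw : ∀ A B (x : V), δ A (ε B x) = ε B (δ A x) + if A = B then x else 0 := by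
    intro A B x
    have := congrArg (fun T : Module.End ℝ V => T x) (hweyl A B)
    simp only [Module.End.mul_apply, LinearMap.add_apply] at this
    rw [this]
    split_ifs <;> simp
  have hc : ∀ A B (x : V), δ A (δ B x) = δ B (δ A x) := fun A B x =>
    congrArg (fun T : Module.End ℝ V => T x) (hδδ A B)
  have hδE : ∀ B (x : V), δ B (eulerOp ε δ x) = eulerOp ε δ (δ B x) + δ B x := by
    intro B x
    simp only [eulerOp_apply, map_sum, hw, Finset.sum_add_distrib]
    congr 1
    · exact Finset.sum_congr rfl fun A _ => by rw [hc]
    · simp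
  -- The family `u` is again closed. Since `δ_B E = E δ_B + δ_B` and `h` is closed, the defect `δ_A
  -- u_B - δ_B u_A` satisfies `E x = -2 x`, which leaves only `x = 0`.
  have hsym : ∀ A B, δ A (u B) = δ B (u A) := by
    intro A B
    rw [← sub_eq_zero]
    refine hgr.eq_zero (U.sub_mem (hδU _ _ (huU _)) (hδU _ _ (huU _))) (s := 2) (by norm_num) ?_
    have h1 : ∀ A B, eulerOp ε δ (δ A (u B)) = δ A (h B) - (2 : ℝ) • δ A (u B) := by
      intro A B
      rw [← hu B, map_add, hδE, two_smul]
      abel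
    rw [map_sub, h1, h1, hcl A B, neg_smul, smul_sub]
    abel
  refine ⟨u, huU, fun B => ?_⟩
  simp only [map_sum, hw, Finset.sum_add_distrib]
  rw [Finset.sum_congr rfl fun A _ => by rw [hsym B A], ← eulerOp_apply]
  simpa using hu B

/-- Solution of the flatness equations `X_A v = 0`, order by order in the formal parameter. -/
theorem exists_flat_section {ε : Fin N → Module.End ℝ V} {U : Submodule ℝ V}
    (X : Fin N → PowerSeries (Module.End ℝ V))
    (hXU : ∀ A n, ∀ u ∈ U, PowerSeries.coeff n (X A) u ∈ U)
    (hεU : ∀ A, ∀ u ∈ U, ε A u ∈ U)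
    (hweyl : ∀ A B, PowerSeries.constantCoeff (X A) * ε B =
      ε B * PowerSeries.constantCoeff (X A) + if A = B then 1 else 0)
    (hgr : IsGraded (eulerOp ε fun A => PowerSeries.constantCoeff (X A)) U)
    (c : Fin N → Fin N → Fin N → ℝ)
    (hcomm : ∀ A B, X A * X B - X B * X A = PowerSeries.X * ∑ C, c A B C • X C)
    {v₀ : V} (hv₀ : v₀ ∈ U) (hδv₀ : ∀ A, PowerSeries.constantCoeff (X A) v₀ = 0) :
    ∃ v : ℕ → V, v 0 = v₀ ∧ (∀ n, v n ∈ U) ∧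
      (∀ n, ∃ u : Fin N → V, (∀ A, u A ∈ U) ∧ v (n + 1) = ∑ A, ε A (u A)) ∧
      ∀ A, seriesAct (X A) v = 0 := by
  classical
  have hδδ : ∀ A B, PowerSeries.constantCoeff (X A) * PowerSeries.constantCoeff (X B) =
      PowerSeries.constantCoeff (X B) * PowerSeries.constantCoeff (X A) := by
    intro A B
    have := congrArg PowerSeries.constantCoeff (hcomm A B)
    simp only [map_sub, map_mul, PowerSeries.constantCoeff_X, zero_mul] at this
    exact sub_eq_zero.1 this
  -- one step: extend a solution modulo `λ ^ n`
  have step : ∀ (n : ℕ) (v : ℕ → V), (∀ j, v j ∈ U) → (∀ j ≥ n, v j = 0) →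
      (∀ A, ∀ m < n, seriesAct (X A) v m = 0) →
      ∃ u : Fin N → V, (∀ A, u A ∈ U) ∧
        ∀ A, seriesAct (X A) v n + PowerSeries.constantCoeff (X A) (∑ B, ε B (u B)) = 0 := by
    intro n v hvU hv hlow
    have hU' : ∀ A, -seriesAct (X A) v n ∈ U := fun A =>
      U.neg_mem (U.sum_mem fun p _ => hXU _ _ _ (hvU _))
    -- The obstruction at order `n` is a closed family. Its closedness is the order-`n` coefficient
    -- of the commutation relation applied to `v`: the right-hand side carries a factor `λ`, so it
    -- only sees the lower orders, where `v` is already flat.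
    have hcl : ∀ A B, PowerSeries.constantCoeff (X A) (-seriesAct (X B) v n) =
        PowerSeries.constantCoeff (X B) (-seriesAct (X A) v n) := by
      intro A B
      have h1 := congrFun (congrArg (fun P => seriesAct P v) (hcomm A B)) n
      simp only [seriesAct_sub_left, seriesAct_mul, Pi.sub_apply] at h1
      rw [seriesAct_eq_constantCoeff (X A) _ n (hlow B),
        seriesAct_eq_constantCoeff (X B) _ n (hlow A), ← seriesAct_mul] at h1
      have h2 : seriesAct (PowerSeries.X * ∑ C, c A B C • X C) v n = 0 := by
        rcases n with _ | n
        · exact seriesAct_X_mul_zero _ _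
        · rw [seriesAct_X_mul_succ, seriesAct_sum_left, Finset.sum_apply]
          refine Finset.sum_eq_zero fun C _ => ?_
          rw [seriesAct_smul_left, Pi.smul_apply, hlow C n (Nat.lt_succ_self n), smul_zero]
      rw [h2, sub_eq_zero] at h1
      rw [map_neg, map_neg, h1]
    obtain ⟨u, huU, hu⟩ := exists_potential (fun A u hu => by
      simpa using hXU A 0 u hu) hweyl hδδ hgr hU' hcl
    exact ⟨u, huU, fun A => by rw [hu]; abel⟩
  choose! u huU hu using step
  -- the truncated solutions
  let w : ℕ → ℕ → V := fun n => Nat.rec (fun j => if j = 0 then v₀ else 0)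
    (fun n v => Function.update v (n + 1) (∑ B, ε B (u (n + 1) v B))) n
  have w_succ : ∀ n, w (n + 1) = Function.update (w n) (n + 1) (∑ B, ε B (u (n + 1) (w n) B)) :=
    fun n => rfl
  have act_update : ∀ A (v : ℕ → V) (n m : ℕ) (x : V), m ≤ n → v n = 0 →
      seriesAct (X A) (Function.update v n x) m = seriesAct (X A) v m +
        if m = n then PowerSeries.constantCoeff (X A) x else 0 := by
    intro A v n m x hm hv
    have h1 : Function.update v n x = v + Pi.single n x := by
      funext j
      by_cases hj : j = n
      · subst hj; simp [hv]
      · simp [hj]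
    have h2 : seriesAct (X A) (v + Pi.single n x) m = seriesAct (X A) v m +
        seriesAct (X A) (Pi.single n x) m := by
      simp [seriesAct, Finset.sum_add_distrib]
    rw [h1, h2, seriesAct_eq_constantCoeff (X A) (Pi.single n x) m]
    · congr 1
      split_ifs with h
      · subst h; simp
      · simp [h]
    · intro j hj
      simp [show j ≠ n by omega]
  have hw : ∀ n, (∀ j, w n j ∈ U) ∧ (∀ j ≥ n + 1, w n j = 0) ∧
      ∀ A, ∀ m < n + 1, seriesAct (X A) (w n) m = 0 := by
    intro n
    induction n with
    | zero =>
      refine ⟨fun j => ?_, fun j hj => ?_, fun A m hm => ?_⟩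
      · change (if j = 0 then v₀ else 0) ∈ U
        split_ifs
        · exact hv₀
        · exact U.zero_mem
      · exact if_neg (by omega)
      · obtain rfl : m = 0 := by omega
        rw [seriesAct_eq_constantCoeff _ _ _ (by simp)]
        exact hδv₀ A
    | succ n ih =>
      obtain ⟨h1, h2, h3⟩ := ih
      have huU' := huU (n + 1) (w n) h1 h2 h3
      refine ⟨fun j => ?_, fun j hj => ?_, fun A m hm => ?_⟩
      · rw [w_succ]
        by_cases hj : j = n + 1
        · subst hj
          rw [Function.update_self]
          exact U.sum_mem fun B _ => hεU _ _ (huU' B)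
        · rw [Function.update_of_ne hj]
          exact h1 j
      · rw [w_succ, Function.update_of_ne (by omega)]
        exact h2 j (by omega)
      · rw [w_succ, act_update A _ _ _ _ (by omega) (h2 _ le_rfl)]
        split_ifs with h
        · subst h
          exact hu (n + 1) (w n) h1 h2 h3 A
        · rw [h3 A m (by omega), add_zero]
  have hstab : ∀ n m, n ≤ m → w m n = w n n := by
    intro n m hnm
    induction m, hnm using Nat.le_induction with
    | base => rfl
    | succ m hm ih => rw [w_succ, Function.update_of_ne (by omega), ih]
  -- The diagonal sequence agrees with `w n` up to order `n`, and the order-`n` coefficient of the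
  -- equation involves no higher terms.
  refine ⟨fun n => w n n, rfl, fun n => (hw n).1 n, fun n => ?_, fun A => ?_⟩
  · refine ⟨u (n + 1) (w n), huU (n + 1) (w n) (hw n).1 (hw n).2.1 (hw n).2.2, ?_⟩
    simp only [w_succ, Function.update_self]
  · funext n
    have : seriesAct (X A) (fun n => w n n) n = seriesAct (X A) (w n) n := by
      refine Finset.sum_congr rfl fun p hp => ?_
      have := Finset.HasAntidiagonal.mem_antidiagonal.1 hp
      rw [hstab p.2 n (by omega)]
    rw [this]
    exact (hw n).2.2 A n (Nat.lt_succ_self n)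

end FlatSection

end

/-! ### The Weyl algebra acting on smooth functions. -/

noncomputable section

namespace SmoothFn

variable {N : ℕ}

theorem partialDeriv_apply (A : Fin N) (f : SmoothFn N) (z : Fin N → ℝ) :
    partialDeriv A f z = fderiv ℝ f z (Pi.single A 1) := rfl

theorem partialDeriv_one (A : Fin N) : partialDeriv A (1 : SmoothFn N) = 0 := by
  simpa using partialDeriv_mul A (1 : SmoothFn N) 1

theorem partialDeriv_coord (A B : Fin N) :
    partialDeriv A (coord B) = if A = B then 1 else 0 := by
  ext z
  have h : (coord B : (Fin N → ℝ) → ℝ) =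
      (ContinuousLinearMap.proj B : (Fin N → ℝ) →L[ℝ] ℝ) := rfl
  rw [partialDeriv_apply, h, ContinuousLinearMap.fderiv]
  rw [ContinuousLinearMap.proj_apply, Pi.single_apply]
  by_cases hAB : A = B
  · subst hAB; simp; rfl
  · rw [if_neg hAB, if_neg (Ne.symm hAB)]; rfl

theorem partialDeriv_comm (A B : Fin N) :
    partialDeriv (N := N) A * partialDeriv B = partialDeriv B * partialDeriv A := by
  refine LinearMap.ext fun f => ?_
  ext z
  have hd : DifferentiableAt ℝ (fderiv ℝ (f : (Fin N → ℝ) → ℝ)) z :=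
    ((f.contDiff.fderiv_right (m := ∞) (by simp)).differentiable (by simp)) z
  have h : ∀ A B : Fin N, partialDeriv A (partialDeriv B f) z =
      fderiv ℝ (fderiv ℝ (f : (Fin N → ℝ) → ℝ)) z (Pi.single A 1) (Pi.single B 1) := by
    intro A B
    change fderiv ℝ (fun y => fderiv ℝ (f : (Fin N → ℝ) → ℝ) y (Pi.single B 1)) z _ = _
    rw [fderiv_clm_apply hd (differentiableAt_const _)]
    simp
  rw [Module.End.mul_apply, Module.End.mul_apply, h, h]
  exact (f.contDiff.contDiffAt.isSymmSndFDerivAt (by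
    rw [minSmoothness_of_isRCLikeNormedField]; exact WithTop.coe_le_coe.2 le_top)).eq _ _

/-- Multiplication by the coordinate `z_A`. -/
def mulCoord (A : Fin N) : Module.End ℝ (SmoothFn N) := LinearMap.mulLeft ℝ (coord A)

@[simp] theorem mulCoord_apply (A : Fin N) (f : SmoothFn N) : mulCoord A f = coord A * f := rfl

theorem mulCoord_comm (A B : Fin N) :
    mulCoord (N := N) A * mulCoord B = mulCoord B * mulCoord A := by
  refine LinearMap.ext fun f => ?_
  simp only [Module.End.mul_apply, mulCoord_apply]
  ring

theorem partialDeriv_mul_mulCoord (A B : Fin N) :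
    partialDeriv A * mulCoord B = mulCoord B * partialDeriv A + if A = B then 1 else 0 := by
  refine LinearMap.ext fun f => ?_
  simp only [Module.End.mul_apply, mulCoord_apply, partialDeriv_mul, partialDeriv_coord,
    LinearMap.add_apply]
  split_ifs
  · simp [add_comm]
  · simp

/-- The Weyl algebra of differential operators with polynomial coefficients. -/
def weyl (N : ℕ) : Subalgebra ℝ (Module.End ℝ (SmoothFn N)) :=
  Algebra.adjoin ℝ (Set.range mulCoord ∪ Set.range partialDeriv)

theorem mulCoord_mem_weyl (A : Fin N) : mulCoord A ∈ weyl N :=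
  Algebra.subset_adjoin (Or.inl ⟨A, rfl⟩)

theorem partialDeriv_mem_weyl (A : Fin N) : partialDeriv A ∈ weyl N :=
  Algebra.subset_adjoin (Or.inr ⟨A, rfl⟩)

theorem weyl_induction {p : Module.End ℝ (SmoothFn N) → Prop} (hz : ∀ A, p (mulCoord A))
    (hd : ∀ A, p (partialDeriv A)) (hC : ∀ r : ℝ, p (algebraMap ℝ _ r))
    (hadd : ∀ P Q, P ∈ weyl N → Q ∈ weyl N → p P → p Q → p (P + Q))
    (hmul : ∀ P Q, P ∈ weyl N → Q ∈ weyl N → p P → p Q → p (P * Q))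
    {P : Module.End ℝ (SmoothFn N)} (hP : P ∈ weyl N) : p P := by
  induction hP using Algebra.adjoin_induction with
  | mem x hx =>
    rcases hx with ⟨A, rfl⟩ | ⟨A, rfl⟩
    · exact hz A
    · exact hd A
  | algebraMap r => exact hC r
  | add x y hx hy h1 h2 => exact hadd x y hx hy h1 h2
  | mul x y hx hy h1 h2 => exact hmul x y hx hy h1 h2

theorem partials_mem_weyl (w : List (Fin N)) : partials w ∈ weyl N :=
  Subalgebra.list_prod_mem _ fun x hx => by
    obtain ⟨A, -, rfl⟩ := List.mem_map.1 hx
    exact partialDeriv_mem_weyl A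

theorem continuous_of_mem_weyl {P : Module.End ℝ (SmoothFn N)} (hP : P ∈ weyl N) :
    Continuous P := by
  refine weyl_induction (p := fun P => Continuous P) (fun A => continuous_const.mul continuous_id)
    continuous_partialDeriv (fun r => ?_) (fun P Q _ _ h1 h2 => h1.add h2)
    (fun P Q _ _ h1 h2 => h1.comp h2) hP
  · have : ⇑(algebraMap ℝ (Module.End ℝ (SmoothFn N)) r) =
        fun f => algebraMap ℝ (SmoothFn N) r * f := by
      funext f; rw [Module.algebraMap_end_apply, Algebra.smul_def]
    rw [this]
    exact continuous_const.mul continuous_id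

/-- Polynomials are evaluated in commutative algebras only, so `constOp` evaluates inside the
commutative subalgebra generated by the partial derivatives. -/
instance (N : ℕ) : IsMulCommutative (Algebra.adjoin ℝ (Set.range (partialDeriv (N := N)))) :=
  Algebra.isMulCommutative_adjoin ℝ (by
    rintro _ ⟨A, rfl⟩ _ ⟨B, rfl⟩
    exact partialDeriv_comm A B)

instance partialDerivCommRing (N : ℕ) :
    CommRing (Algebra.adjoin ℝ (Set.range (partialDeriv (N := N)))) :=
  { (inferInstance : Ring (Algebra.adjoin ℝ (Set.range (partialDeriv (N := N))))) with
    mul_comm := fun a b => Std.Commutative.comm a b }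

/-- The differential operator with constant coefficients `p(∂)`. -/
def constOp : MvPolynomial (Fin N) ℝ →ₐ[ℝ] Module.End ℝ (SmoothFn N) :=
  (Algebra.adjoin ℝ (Set.range (partialDeriv (N := N)))).val.comp
    (MvPolynomial.aeval fun A => ⟨partialDeriv A, Algebra.subset_adjoin ⟨A, rfl⟩⟩)

@[simp] theorem constOp_X (A : Fin N) : constOp (MvPolynomial.X A) = partialDeriv A := by
  simp [constOp]

@[simp] theorem constOp_C (r : ℝ) :
    constOp (MvPolynomial.C r : MvPolynomial (Fin N) ℝ) = algebraMap ℝ _ r := by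
  rw [← MvPolynomial.algebraMap_eq, AlgHom.commutes]

theorem constOp_mem_weyl (p : MvPolynomial (Fin N) ℝ) : constOp p ∈ weyl N := by
  induction p using MvPolynomial.induction_on with
  | C r => rw [constOp_C]; exact Subalgebra.algebraMap_mem _ r
  | add p q hp hq => rw [map_add]; exact add_mem hp hq
  | mul_X p A hp => rw [map_mul, constOp_X]; exact mul_mem hp (partialDeriv_mem_weyl A)

theorem constOp_comm (p q : MvPolynomial (Fin N) ℝ) :
    constOp p * constOp q = constOp q * constOp p := by
  rw [← map_mul, mul_comm, map_mul]

/-- The commutator with `z_A` realizes `∂/∂ζ^A` on symbols. Through this rule, differential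
identities for `ψ` become operator identities. -/
theorem constOp_mul_mulCoord (p : MvPolynomial (Fin N) ℝ) (A : Fin N) :
    constOp p * mulCoord A = mulCoord A * constOp p + constOp (MvPolynomial.pderiv A p) := by
  induction p using MvPolynomial.induction_on with
  | C r => simp [Algebra.commutes]
  | add p q hp hq => simp only [map_add, add_mul, mul_add, hp, hq]; abel
  | mul_X p B hp =>
    rw [Derivation.leibniz, MvPolynomial.pderiv_X]
    simp only [smul_eq_mul, map_mul, map_add, constOp_X]
    rw [mul_assoc, partialDeriv_mul_mulCoord, mul_add, ← mul_assoc, hp, add_mul, mul_assoc]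
    by_cases h : B = A
    · subst h
      simp only [if_true, Pi.single_eq_same, map_one, mul_one]
      rw [← constOp_X, constOp_comm (MvPolynomial.X B)]
      abel
    · simp only [h, if_false, Pi.single_eq_of_ne h, map_zero,
        mul_zero, add_zero, zero_add]
      rw [← constOp_X, constOp_comm (MvPolynomial.X B)]

theorem constOp_one (p : MvPolynomial (Fin N) ℝ) :
    constOp p (1 : SmoothFn N) = algebraMap ℝ _ (MvPolynomial.constantCoeff p) := by
  induction p using MvPolynomial.induction_on with
  | C r => simp [Module.algebraMap_end_apply, Algebra.smul_def]
  | add p q hp hq => simp [hp, hq]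
  | mul_X p A hp => simp [partialDeriv_one]

theorem multiPartial_eq_constOp (α : Fin N →₀ ℕ) :
    multiPartial α = constOp (MvPolynomial.monomial α (1 : ℝ)) := by
  have h : ∀ l : List (Fin N), partials (l.flatMap fun A => List.replicate (α A) A) =
      constOp ((l.map fun A => (MvPolynomial.X A : MvPolynomial (Fin N) ℝ) ^ α A).prod) := by
    intro l
    induction l with
    | nil => simp [partials]
    | cons A l ih =>
      simp only [List.flatMap_cons, List.map_cons, List.prod_cons, map_mul, map_pow, constOp_X]
      rw [← ih]
      simp [partials]
  rw [multiPartial, h, MvPolynomial.monomial_eq, MvPolynomial.C_1, one_mul, Finsupp.prod_fintype]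
  · rw [← List.ofFn_eq_map, List.prod_ofFn]
  · simp

theorem symbolOp_eq_sum {p : MvPolynomial (Fin N) (SmoothFn N)} {s : Finset (Fin N →₀ ℕ)}
    (h : p.support ⊆ s) :
    symbolOp p = ∑ α ∈ s, LinearMap.mulLeft ℝ (p.coeff α) * multiPartial α := by
  refine Finset.sum_subset h fun α _ hα => ?_
  rw [MvPolynomial.notMem_support_iff.1 hα]
  ext1 f
  simp

theorem symbolOp_add (p q : MvPolynomial (Fin N) (SmoothFn N)) :
    symbolOp (p + q) = symbolOp p + symbolOp q := by
  classical
  rw [symbolOp_eq_sum (s := p.support ∪ q.support) MvPolynomial.support_add,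
    symbolOp_eq_sum (p := p) Finset.subset_union_left,
    symbolOp_eq_sum (p := q) Finset.subset_union_right, ← Finset.sum_add_distrib]
  refine Finset.sum_congr rfl fun α _ => ?_
  ext1 f
  simp [add_mul]

theorem symbolOp_sum {ι : Type*} (s : Finset ι) (p : ι → MvPolynomial (Fin N) (SmoothFn N)) :
    symbolOp (∑ i ∈ s, p i) = ∑ i ∈ s, symbolOp (p i) := by
  classical
  induction s using Finset.induction_on with
  | empty => simp [symbolOp]
  | insert i s hi ih => rw [Finset.sum_insert hi, Finset.sum_insert hi, symbolOp_add, ih]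

/-- In a right action the leftmost factor acts first, so with all `ζ`'s on the left the derivatives
are applied before the multiplication by `a`. -/
theorem symbolOp_map_mul_C (p : MvPolynomial (Fin N) ℝ) (a : SmoothFn N) :
    symbolOp (MvPolynomial.map (algebraMap ℝ (SmoothFn N)) p * MvPolynomial.C a) =
      LinearMap.mulLeft ℝ a * constOp p := by
  have h : constOp p = ∑ α ∈ p.support, p.coeff α • multiPartial α := by
    conv_lhs => rw [p.as_sum]
    rw [map_sum]
    refine Finset.sum_congr rfl fun α _ => ?_
    rw [multiPartial_eq_constOp, ← map_smul, MvPolynomial.smul_monomial, smul_eq_mul, mul_one]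
  rw [symbolOp_eq_sum (s := p.support), h, Finset.mul_sum]
  · refine Finset.sum_congr rfl fun α _ => ?_
    ext1 f
    simp only [mul_comm _ (MvPolynomial.C a), MvPolynomial.coeff_C_mul, MvPolynomial.coeff_map, Module.End.mul_apply,
      LinearMap.mulLeft_apply, LinearMap.smul_apply, map_smul]
    rw [mul_assoc, ← Algebra.smul_def, mul_smul_comm]
  · intro α hα
    rw [MvPolynomial.mem_support_iff] at hα ⊢
    intro h0
    exact hα (by simp [mul_comm _ (MvPolynomial.C a), MvPolynomial.coeff_C_mul, MvPolynomial.coeff_map, h0])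

end SmoothFn
end

/-! ### Formal series of operators acting on `F`. -/

noncomputable section

section OperatorSeries

variable {N : ℕ}

theorem coeff_smul_formalFn (r : ℝ⟦X⟧) (f : FormalFn N) (n : ℕ) :
    PowerSeries.coeff n (r • f) = ∑ p ∈ Finset.HasAntidiagonal.antidiagonal n,
      PowerSeries.coeff p.1 r • PowerSeries.coeff p.2 f := by
  rw [Algebra.smul_def, PowerSeries.coeff_mul]
  refine Finset.sum_congr rfl fun p _ => ?_
  rw [PowerSeries.algebraMap_apply'', PowerSeries.coeff_map, Algebra.smul_def]

theorem X_smul_formalFn (f : FormalFn N) :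
    (PowerSeries.X : ℝ⟦X⟧) • f = PowerSeries.X * f := by
  rw [Algebra.smul_def, PowerSeries.algebraMap_apply'', PowerSeries.map_X]

theorem C_smul_formalFn (r : ℝ) (f : FormalFn N) :
    (PowerSeries.C r : ℝ⟦X⟧) • f = r • f := by
  ext1 n
  rw [Algebra.smul_def, PowerSeries.algebraMap_apply'', PowerSeries.map_C, PowerSeries.coeff_C_mul,
    ← Algebra.smul_def]
  rfl

/-- The `ℝ[[λ]]`-linear operator on `F` given by a formal power series of operators. -/
def opLin (P : PowerSeries (Module.End ℝ (SmoothFn N))) : Module.End ℝ⟦X⟧ (FormalFn N) where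
  toFun := formalOp fun n => PowerSeries.coeff n P
  map_add' := fun f g => by ext1 n; simp [formalOp, Finset.sum_add_distrib]
  map_smul' := fun r f => formalOp_smul _ r f

theorem coeff_opLin (P : PowerSeries (Module.End ℝ (SmoothFn N))) (f : FormalFn N) (n : ℕ) :
    PowerSeries.coeff n (opLin P f) = ∑ p ∈ Finset.HasAntidiagonal.antidiagonal n,
      PowerSeries.coeff p.1 P (PowerSeries.coeff p.2 f) := by
  have h : opLin P f = formalOp (fun n => PowerSeries.coeff n P) f := rfl
  rw [h, formalOp, PowerSeries.coeff_mk]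

/-- The action on `F` of a formal power series of operators on `C^∞(ℝ^N)`. -/
def opHom (N : ℕ) : PowerSeries (Module.End ℝ (SmoothFn N)) →+* Module.End ℝ⟦X⟧ (FormalFn N) where
  toFun P := opLin P
  map_one' := by
    refine LinearMap.ext fun f => ?_
    ext1 n
    rw [coeff_opLin, Finset.sum_eq_single (0, n)]
    · simp
    · rintro ⟨i, j⟩ hij hne
      have : i ≠ 0 := by
        rintro rfl
        rw [Finset.HasAntidiagonal.mem_antidiagonal] at hij
        simp only [zero_add] at hij
        exact hne (by rw [hij])
      simp [PowerSeries.coeff_one, this]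
    · simp
  map_zero' := by
    refine LinearMap.ext fun f => ?_
    ext1 n
    simp [coeff_opLin]
  map_add' P Q := by
    refine LinearMap.ext fun f => ?_
    ext1 n
    simp [coeff_opLin, Finset.sum_add_distrib]
  map_mul' P Q := by
    refine LinearMap.ext fun f => ?_
    ext1 n
    simp only [Module.End.mul_apply, coeff_opLin]
    exact congrFun (seriesAct_mul P Q fun n => PowerSeries.coeff n f) n

theorem coeff_opHom (P : PowerSeries (Module.End ℝ (SmoothFn N))) (f : FormalFn N) (n : ℕ) :
    PowerSeries.coeff n (opHom N P f) = ∑ p ∈ Finset.HasAntidiagonal.antidiagonal n,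
      PowerSeries.coeff p.1 P (PowerSeries.coeff p.2 f) := coeff_opLin _ _ _

theorem coeff_opHom_C (P : PowerSeries (Module.End ℝ (SmoothFn N))) (f : SmoothFn N) (n : ℕ) :
    PowerSeries.coeff n (opHom N P (PowerSeries.C f)) = PowerSeries.coeff n P f := by
  rw [coeff_opHom, Finset.sum_eq_single (n, 0)]
  · simp
  · rintro ⟨i, j⟩ hij hne
    have : j ≠ 0 := by
      rintro rfl
      rw [Finset.HasAntidiagonal.mem_antidiagonal] at hij
      simp only [add_zero] at hij
      exact hne (by rw [hij])
    simp [PowerSeries.coeff_C, this]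
  · simp

theorem opHom_X (f : FormalFn N) : opHom N PowerSeries.X f = (PowerSeries.X : ℝ⟦X⟧) • f := by
  rw [X_smul_formalFn]
  ext1 n
  rw [coeff_opHom]
  rcases n with _ | n
  · simp
  · rw [Finset.Nat.sum_antidiagonal_succ, PowerSeries.coeff_succ_X_mul]
    rw [Finset.sum_eq_single (0, n)]
    · simp
    · rintro ⟨i, j⟩ hij hne
      have : i ≠ 0 := by
        rintro rfl
        rw [Finset.HasAntidiagonal.mem_antidiagonal] at hij
        simp only [zero_add] at hij
        exact hne (by rw [hij])
      simp [PowerSeries.coeff_X, this]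
    · simp

theorem opHom_smul (r : ℝ) (P : PowerSeries (Module.End ℝ (SmoothFn N))) (f : FormalFn N) :
    opHom N (r • P) f = r • opHom N P f := by
  ext1 n
  change _ = r • PowerSeries.coeff n (opHom N P f)
  rw [coeff_opHom, coeff_opHom, Finset.smul_sum]
  exact Finset.sum_congr rfl fun p _ => rfl

theorem continuous_opHom {P : PowerSeries (Module.End ℝ (SmoothFn N))}
    (hP : ∀ n, Continuous ⇑(PowerSeries.coeff n P)) : Continuous (opHom N P) := by
  refine continuous_pi fun d => ?_
  obtain ⟨m, rfl⟩ : ∃ m, d = Finsupp.single () m := ⟨d (), by ext; simp⟩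
  have h : (fun f : FormalFn N => PowerSeries.coeff m (opHom N P f)) =
      fun f => ∑ p ∈ Finset.HasAntidiagonal.antidiagonal m,
        PowerSeries.coeff p.1 P (PowerSeries.coeff p.2 f) := by
    funext f
    exact coeff_opHom _ _ _
  change Continuous fun f : FormalFn N => PowerSeries.coeff m (opHom N P f)
  rw [h]
  exact continuous_finsetSum _ fun p _ => (hP _).comp
    (PowerSeries.WithPiTopology.continuous_coeff _ _)

/-- A formal power series of continuous operators as an element of `RightOp N`. -/
def RightOp.ofSeries (P : PowerSeries (Module.End ℝ (SmoothFn N)))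
    (hP : ∀ n, Continuous ⇑(PowerSeries.coeff n P)) : RightOp N :=
  MulOpposite.op ⟨opHom N P, continuous_opHom hP⟩

theorem RightOp.act_ofSeries (P : PowerSeries (Module.End ℝ (SmoothFn N)))
    (hP : ∀ n, Continuous ⇑(PowerSeries.coeff n P)) (f : FormalFn N) :
    RightOp.act f (RightOp.ofSeries P hP) = opHom N P f := rfl

theorem RightOp.ext_act {S T : RightOp N} (h : ∀ f, RightOp.act f S = RightOp.act f T) : S = T :=
  MulOpposite.unop_injective (ContinuousLinearMap.ext h)

/-- Hausdorff targets make the locus where two continuous maps agree closed, which is how identities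
pass from the algebra generated by the `Z_A` to its closure. -/
instance : T2Space (SmoothFn N) := by
  refine T2Space.of_injective_continuous (f := SmoothFn.partialsC (N := N) []) ?_
    (SmoothFn.continuous_partialsC [])
  intro f g h
  ext z
  have := congrArg (fun F : C((Fin N → ℝ), ℝ) => F z) h
  simpa [SmoothFn.partialsC, SmoothFn.partials] using this

instance : T2Space (FormalFn N) := PowerSeries.WithPiTopology.instT2Space _

instance : T2Space (RightOp N) := by
  refine T2Space.of_injective_continuous (f := fun T (f : FormalFn N) => RightOp.act f T) ?_
    continuous_induced_dom
  intro S T h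
  exact RightOp.ext_act (congrFun h)

end OperatorSeries

/-! ### The left-invariant frame as a series of differential operators. -/

section Frame

variable {N : ℕ}

open SmoothFn

/-- The formal power series of operators with constant coefficients `∑ λ^n p_n(∂)`. -/
def constSeries : FormalZeta N →+* PowerSeries (Module.End ℝ (SmoothFn N)) :=
  PowerSeries.map (constOp (N := N)).toRingHom

@[simp] theorem coeff_constSeries (p : FormalZeta N) (n : ℕ) :
    PowerSeries.coeff n (constSeries p) = constOp (PowerSeries.coeff n p) :=
  PowerSeries.coeff_map _ _ _

theorem constSeries_smul (r : ℝ) (p : FormalZeta N) :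
    constSeries (r • p) = r • constSeries p := by
  ext1 n
  rw [coeff_constSeries]
  change constOp (r • PowerSeries.coeff n p) = r • PowerSeries.coeff n (constSeries p)
  rw [map_smul, coeff_constSeries]

theorem constSeries_X : constSeries (PowerSeries.X : FormalZeta N) = PowerSeries.X :=
  PowerSeries.map_X _

theorem constSeries_mul_C_mulCoord (p : FormalZeta N) (A : Fin N) :
    constSeries p * PowerSeries.C (mulCoord A) =
      PowerSeries.C (mulCoord A) * constSeries p + constSeries (zetaDeriv A p) := by
  ext1 n
  rw [map_add, PowerSeries.coeff_mul_C, PowerSeries.coeff_C_mul, coeff_constSeries,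
    coeff_constSeries, zetaDeriv, PowerSeries.coeff_mk, constOp_mul_mulCoord]

/-- The formal power series of differential operators by which `Z_A` acts. -/
def frameSeries (ψ : Matrix (Fin N) (Fin N) (FormalZeta N)) (A : Fin N) :
    PowerSeries (Module.End ℝ (SmoothFn N)) :=
  ∑ B, PowerSeries.C (mulCoord B) * constSeries (ψ A B)

variable (ψ : Matrix (Fin N) (Fin N) (FormalZeta N))

theorem coeff_frameSeries (A : Fin N) (n : ℕ) : PowerSeries.coeff n (frameSeries ψ A) =
    ∑ B, mulCoord B * constOp (PowerSeries.coeff n (ψ A B)) := by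
  simp [frameSeries, PowerSeries.coeff_C_mul]

theorem coeff_frameSeries_mem_weyl (A : Fin N) (n : ℕ) :
    PowerSeries.coeff n (frameSeries ψ A) ∈ weyl N := by
  rw [coeff_frameSeries]
  exact sum_mem fun B _ => mul_mem (mulCoord_mem_weyl B) (constOp_mem_weyl _)

theorem act_frameOp (A : Fin N) (f : FormalFn N) :
    RightOp.act f (frameOp ψ A) = opHom N (frameSeries ψ A) f := by
  ext1 n
  rw [frameOp, RightOp.act_ordered, coeff_opHom, formalOp, PowerSeries.coeff_mk]
  refine Finset.sum_congr rfl fun p _ => ?_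
  rw [coeff_frameSeries, map_sum, symbolOp_sum]
  congr 1
  refine Finset.sum_congr rfl fun B _ => ?_
  rw [PowerSeries.coeff_mul_C, PowerSeries.coeff_map, symbolOp_map_mul_C]
  rfl

variable {ψ} {𝔤 : Type*} [LieRing 𝔤] [LieAlgebra ℝ 𝔤] {b : Module.Basis (Fin N) ℝ 𝔤}

/-- The factors on the left are reversed because the `Z_A` act from the right, whereas endomorphisms
compose from the left. After moving all `z`'s to the left, the part quadratic in `z` is symmetric
and cancels, and the linear part is the commutator of the vector fields. -/
theorem IsLeftInvariantFrame.frameSeries_commutator (hψ : IsLeftInvariantFrame b ψ) (A B : Fin N) :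
    frameSeries ψ B * frameSeries ψ A - frameSeries ψ A * frameSeries ψ B =
      PowerSeries.X * ∑ C, structConst b A B C • frameSeries ψ C := by
  have key : ∀ A B : Fin N, frameSeries ψ B * frameSeries ψ A =
      ∑ E, ∑ C, PowerSeries.C (mulCoord E * mulCoord C) * constSeries (ψ B E * ψ A C) +
        ∑ E, PowerSeries.C (mulCoord E) * constSeries (∑ C, ψ A C * zetaDeriv C (ψ B E)) := by
    intro A B
    simp only [frameSeries, Finset.sum_mul, Finset.mul_sum, map_sum, ← Finset.sum_add_distrib]
    rw [Finset.sum_comm]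
    refine Finset.sum_congr rfl fun E _ => Finset.sum_congr rfl fun C _ => ?_
    rw [mul_assoc, ← mul_assoc (constSeries (ψ B E)), constSeries_mul_C_mulCoord, map_mul, map_mul,
      mul_comm (ψ A C), map_mul]
    noncomm_ring
  have hsym : ∑ E, ∑ C, PowerSeries.C (mulCoord E * mulCoord C) * constSeries (ψ B E * ψ A C) =
      ∑ E, ∑ C, PowerSeries.C (mulCoord E * mulCoord C) * constSeries (ψ A E * ψ B C) := by
    rw [Finset.sum_comm]
    refine Finset.sum_congr rfl fun E _ => Finset.sum_congr rfl fun C _ => ?_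
    rw [mulCoord_comm, mul_comm (ψ B C)]
  rw [key A B, key B A, hsym, add_sub_add_left_eq_sub, ← Finset.sum_sub_distrib]
  simp only [← mul_sub, ← map_sub, ← Finset.sum_sub_distrib, hψ.commutator]
  simp only [frameSeries, map_mul, constSeries_X, map_sum, constSeries_smul, Finset.mul_sum,
    Finset.smul_sum]
  rw [Finset.sum_comm]
  refine Finset.sum_congr rfl fun E _ => Finset.sum_congr rfl fun C _ => ?_
  rw [mul_smul_comm, mul_smul_comm, mul_smul_comm, ← mul_assoc, ← mul_assoc,
    (PowerSeries.commute_X _).eq]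

theorem IsLeftInvariantFrame.constantCoeff_frameSeries (hψ : IsLeftInvariantFrame b ψ)
    (A : Fin N) : PowerSeries.constantCoeff (frameSeries ψ A) = mulCoord A := by
  rw [← PowerSeries.coeff_zero_eq_constantCoeff_apply, coeff_frameSeries]
  simp only [PowerSeries.coeff_zero_eq_constantCoeff, hψ.classical_limit]
  simp [apply_ite]

/-- On the function `1` only the constant terms in `ζ` survive, and `counit` gives these. -/
theorem IsLeftInvariantFrame.opHom_frameSeries_one (hψ : IsLeftInvariantFrame b ψ)
    (A : Fin N) : opHom N (frameSeries ψ A) 1 = PowerSeries.C (coord A) := by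
  ext1 n
  rw [← map_one PowerSeries.C, coeff_opHom_C, coeff_frameSeries]
  have h : ∀ B, MvPolynomial.constantCoeff (PowerSeries.coeff n (ψ A B)) =
      if n = 0 then if A = B then (1 : ℝ) else 0 else 0 := by
    intro B
    have := congrArg (PowerSeries.coeff n) (hψ.counit A B)
    rw [PowerSeries.coeff_map] at this
    rw [this]
    split_ifs <;> simp_all [PowerSeries.coeff_one]
  simp only [LinearMap.sum_apply, Module.End.mul_apply, constOp_one, h, mulCoord_apply,
    PowerSeries.coeff_C]
  split_ifs <;> simp [apply_ite]

end Frame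
end

noncomputable section

/-! ### Flat sections over the formal group. -/

section PolynomialSections

variable {N : ℕ} {ι : Type*}

/-- Componentwise multiplication of tuples of polynomials by a polynomial. -/
def tupleMul (N : ℕ) (ι : Type*) :
    MvPolynomial (Fin N) ℝ →+* Module.End ℝ (ι → MvPolynomial (Fin N) ℝ) where
  toFun p := LinearMap.pi fun i => LinearMap.mulLeft ℝ p ∘ₗ LinearMap.proj i
  map_one' := by ext1 r; funext i; simp
  map_zero' := by ext1 r; funext i; simp
  map_add' p q := by ext1 r; funext i; simp [add_mul]
  map_mul' p q := by ext1 r; funext i; simp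

theorem tupleMul_apply (p : MvPolynomial (Fin N) ℝ) (r : ι → MvPolynomial (Fin N) ℝ) (i : ι) :
    tupleMul N ι p r i = p * r i := rfl

/-- Componentwise partial derivative of tuples of polynomials. -/
def tupleDeriv (ι : Type*) (A : Fin N) : Module.End ℝ (ι → MvPolynomial (Fin N) ℝ) :=
  LinearMap.pi fun i => (MvPolynomial.pderiv A).toLinearMap ∘ₗ LinearMap.proj i

theorem map_tupleMul_smul (ι : Type*) (c : ℝ) (p : FormalZeta N) :
    PowerSeries.map (tupleMul N ι) (c • p) = c • PowerSeries.map (tupleMul N ι) p := by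
  ext1 n
  have h : ∀ q : MvPolynomial (Fin N) ℝ, tupleMul N ι (c • q) = c • tupleMul N ι q := by
    intro q
    ext1 r; funext i
    exact smul_mul_assoc _ _ _
  change PowerSeries.coeff n (PowerSeries.map (tupleMul N ι) (c • p)) =
    c • PowerSeries.coeff n (PowerSeries.map (tupleMul N ι) p)
  rw [PowerSeries.coeff_map, PowerSeries.coeff_map, ← h]
  rfl

theorem tupleDeriv_apply (A : Fin N) (r : ι → MvPolynomial (Fin N) ℝ) (i : ι) :
    tupleDeriv ι A r i = MvPolynomial.pderiv A (r i) := rfl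

theorem tupleDeriv_mul_tupleMul (A : Fin N) (p : MvPolynomial (Fin N) ℝ) :
    tupleDeriv ι A * tupleMul N ι p =
      tupleMul N ι p * tupleDeriv ι A + tupleMul N ι (MvPolynomial.pderiv A p) := by
  ext1 r; funext i
  simp only [Module.End.mul_apply, LinearMap.add_apply, Pi.add_apply, tupleMul_apply,
    tupleDeriv_apply, Derivation.leibniz, smul_eq_mul]
  ring

theorem tupleDeriv_comm (A B : Fin N) :
    tupleDeriv ι A * tupleDeriv ι B = tupleDeriv ι B * tupleDeriv ι A := by
  have h : ∀ p : MvPolynomial (Fin N) ℝ, MvPolynomial.pderiv A (MvPolynomial.pderiv B p) =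
      MvPolynomial.pderiv B (MvPolynomial.pderiv A p) := by
    intro p
    induction p using MvPolynomial.induction_on with
    | C r => simp
    | add p q hp hq => simp only [map_add, hp, hq]
    | mul_X p C hp =>
      have hX : ∀ A B : Fin N, MvPolynomial.pderiv A
          ((Pi.single B 1 : Fin N → MvPolynomial (Fin N) ℝ) C) = 0 := by
        intro A B
        by_cases hBC : C = B
        · subst hBC; simp
        · simp [Pi.single_eq_of_ne hBC]
      simp only [Derivation.leibniz, MvPolynomial.pderiv_X, map_add, smul_eq_mul, hp, hX]
      ring
  ext1 r; funext i
  simp only [Module.End.mul_apply, tupleDeriv_apply, h]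

/-- The vector field `Z_A`, acting componentwise on tuples. -/
def tupleField (ι : Type*) (ψ : Matrix (Fin N) (Fin N) (FormalZeta N)) (A : Fin N) :
    PowerSeries (Module.End ℝ (ι → MvPolynomial (Fin N) ℝ)) :=
  ∑ B, PowerSeries.map (tupleMul N ι) (ψ A B) * PowerSeries.C (tupleDeriv ι B)

variable {ψ : Matrix (Fin N) (Fin N) (FormalZeta N)} {𝔤 : Type*} [LieRing 𝔤] [LieAlgebra ℝ 𝔤]
  {b : Module.Basis (Fin N) ℝ 𝔤}

/-- Here the vector fields act from the left on functions of `ζ`, so there is no reversal of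
factors. The second-order part cancels by symmetry of second derivatives. -/
theorem IsLeftInvariantFrame.tupleField_commutator (hψ : IsLeftInvariantFrame b ψ) (A B : Fin N) :
    tupleField ι ψ A * tupleField ι ψ B - tupleField ι ψ B * tupleField ι ψ A =
      PowerSeries.X * ∑ C, structConst b A B C • tupleField ι ψ C := by
  have hd : ∀ (A : Fin N) (p : FormalZeta N),
      PowerSeries.C (tupleDeriv ι A) * PowerSeries.map (tupleMul N ι) p =
        PowerSeries.map (tupleMul N ι) p * PowerSeries.C (tupleDeriv ι A) +
          PowerSeries.map (tupleMul N ι) (zetaDeriv A p) := by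
    intro A p
    ext1 n
    rw [map_add, PowerSeries.coeff_mul_C, PowerSeries.coeff_C_mul, PowerSeries.coeff_map,
      PowerSeries.coeff_map, tupleDeriv_mul_tupleMul, zetaDeriv, PowerSeries.coeff_mk]
  have key : ∀ A B : Fin N, tupleField ι ψ A * tupleField ι ψ B =
      ∑ C, ∑ E, PowerSeries.map (tupleMul N ι) (ψ A C * ψ B E) *
        PowerSeries.C (tupleDeriv ι C * tupleDeriv ι E) +
      ∑ E, PowerSeries.map (tupleMul N ι) (∑ C, ψ A C * zetaDeriv C (ψ B E)) *
        PowerSeries.C (tupleDeriv ι E) := by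
    intro A B
    rw [Finset.sum_comm]
    simp only [tupleField, Finset.sum_mul, Finset.mul_sum, map_sum, ← Finset.sum_add_distrib]
    refine Finset.sum_congr rfl fun E _ => Finset.sum_congr rfl fun C _ => ?_
    rw [mul_assoc, ← mul_assoc (PowerSeries.C (tupleDeriv ι C)), hd, map_mul, map_mul, map_mul]
    noncomm_ring
  have hsym : ∑ C, ∑ E, PowerSeries.map (tupleMul N ι) (ψ A C * ψ B E) *
        PowerSeries.C (tupleDeriv ι C * tupleDeriv ι E) =
      ∑ C, ∑ E, PowerSeries.map (tupleMul N ι) (ψ B C * ψ A E) *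
        PowerSeries.C (tupleDeriv ι C * tupleDeriv ι E) := by
    rw [Finset.sum_comm]
    refine Finset.sum_congr rfl fun E _ => Finset.sum_congr rfl fun C _ => ?_
    rw [tupleDeriv_comm, mul_comm (ψ A C)]
  rw [key A B, key B A, hsym, add_sub_add_left_eq_sub, ← Finset.sum_sub_distrib]
  simp only [← sub_mul, ← map_sub, ← Finset.sum_sub_distrib, hψ.commutator]
  simp only [tupleField, map_mul, PowerSeries.map_X, map_sum, Finset.mul_sum, Finset.sum_mul,
    Finset.smul_sum, map_tupleMul_smul]
  rw [Finset.sum_comm]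
  refine Finset.sum_congr rfl fun E _ => Finset.sum_congr rfl fun C _ => ?_
  rw [mul_smul_comm, mul_smul_comm, smul_mul_assoc, mul_assoc]

theorem tupleDeriv_mul_tupleMul_X (A B : Fin N) :
    tupleDeriv ι A * tupleMul N ι (MvPolynomial.X B) =
      tupleMul N ι (MvPolynomial.X B) * tupleDeriv ι A + if A = B then 1 else 0 := by
  rw [tupleDeriv_mul_tupleMul, MvPolynomial.pderiv_X]
  congr 1
  by_cases h : A = B
  · subst h; simp
  · simp [h]

variable [Fintype ι]

/-- The action of a real matrix on tuples of polynomials. -/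
def tupleMatrix (N : ℕ) (M : Matrix ι ι ℝ) : Module.End ℝ (ι → MvPolynomial (Fin N) ℝ) :=
  LinearMap.pi fun i => ∑ j, M i j • LinearMap.proj j

theorem tupleMatrix_apply (M : Matrix ι ι ℝ) (r : ι → MvPolynomial (Fin N) ℝ) (i : ι) :
    tupleMatrix N M r i = ∑ j, M i j • r j := by
  simp [tupleMatrix]

theorem tupleMatrix_mul (M M' : Matrix ι ι ℝ) :
    tupleMatrix N (M * M') = tupleMatrix N M * tupleMatrix N M' := by
  ext1 r; funext i
  simp only [Module.End.mul_apply, tupleMatrix_apply, Matrix.mul_apply, Finset.sum_smul,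
    Finset.smul_sum, smul_smul]
  exact Finset.sum_comm

theorem tupleMatrix_sub (M M' : Matrix ι ι ℝ) :
    tupleMatrix N (M - M') = tupleMatrix N M - tupleMatrix N M' := by
  ext1 r; funext i
  simp only [LinearMap.sub_apply, Pi.sub_apply, tupleMatrix_apply, Matrix.sub_apply, sub_smul,
    Finset.sum_sub_distrib]

theorem tupleMatrix_sum_smul {κ : Type*} (s : Finset κ) (c : κ → ℝ) (M : κ → Matrix ι ι ℝ) :
    tupleMatrix N (∑ k ∈ s, c k • M k) = ∑ k ∈ s, c k • tupleMatrix N (M k) := by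
  ext1 r; funext i
  simp only [LinearMap.sum_apply, LinearMap.smul_apply, Finset.sum_apply, Pi.smul_apply,
    tupleMatrix_apply, Matrix.sum_apply, Matrix.smul_apply, Finset.sum_smul, Finset.smul_sum,
    smul_smul, smul_eq_mul]
  exact Finset.sum_comm

theorem tupleMatrix_comm_tupleMul (M : Matrix ι ι ℝ) (p : MvPolynomial (Fin N) ℝ) :
    tupleMatrix N M * tupleMul N ι p = tupleMul N ι p * tupleMatrix N M := by
  ext1 r; funext i
  simp only [Module.End.mul_apply, tupleMatrix_apply, tupleMul_apply, Finset.mul_sum,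
    mul_smul_comm]

theorem tupleMatrix_comm_tupleDeriv (M : Matrix ι ι ℝ) (A : Fin N) :
    tupleMatrix N M * tupleDeriv ι A = tupleDeriv ι A * tupleMatrix N M := by
  ext1 r; funext i
  simp only [Module.End.mul_apply, tupleMatrix_apply, tupleDeriv_apply, map_sum, Derivation.map_smul]

/-- Tuples with a single monomial entry are eigenvectors, with the total degree as eigenvalue. -/
theorem isGraded_tuple : IsGraded
    (eulerOp (fun A => tupleMul N ι (MvPolynomial.X A)) (tupleDeriv ι)) ⊤ := by
  classical
  intro r _
  have h1 : r = ∑ i, ∑ α ∈ (r i).support,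
      (r i).coeff α • (Pi.single i (MvPolynomial.monomial α (1 : ℝ)) : ι → MvPolynomial (Fin N) ℝ) := by
    funext j
    rw [Finset.sum_apply, Finset.sum_eq_single j]
    · simp only [Finset.sum_apply, Pi.smul_apply, Pi.single_eq_same, MvPolynomial.smul_monomial,
        smul_eq_mul, mul_one]
      exact (r j).as_sum
    · intro i _ hij
      simp [Pi.single_eq_of_ne (Ne.symm hij)]
    · simp
  rw [h1]
  refine Submodule.sum_mem _ fun i _ => Submodule.sum_mem _ fun α _ => Submodule.smul_mem _ _
    (Submodule.subset_span ⟨trivial, ∑ A, α A, ?_⟩)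
  rw [eulerOp_apply]
  funext j
  simp only [Finset.sum_apply, tupleMul_apply, tupleDeriv_apply, Pi.smul_apply]
  by_cases hij : j = i
  · subst hij
    simp only [Pi.single_eq_same, MvPolynomial.X_mul_pderiv_monomial]
    rw [← Finset.sum_smul, Nat.cast_smul_eq_nsmul]
  · simp [Pi.single_eq_of_ne hij]

/-- Flat sections: the equations `Z_A r + λ ρ_A r = 0` for a representation `ρ` of the Lie algebra
have a unique solution with given value at `ζ = 0`; this is existence. -/
theorem IsLeftInvariantFrame.exists_flat (hψ : IsLeftInvariantFrame b ψ)
    (ρ : Fin N → Matrix ι ι ℝ)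
    (hρ : ∀ A B, ρ A * ρ B - ρ B * ρ A = ∑ C, structConst b A B C • ρ C) (v : ι → ℝ) :
    ∃ r : ι → FormalZeta N,
      (∀ i, PowerSeries.constantCoeff (r i) = MvPolynomial.C (v i)) ∧
      (∀ i, PowerSeries.map MvPolynomial.constantCoeff (r i) = PowerSeries.C (v i)) ∧
      ∀ A i, ∑ B, ψ A B * zetaDeriv B (r i) +
        PowerSeries.X * ∑ j, ρ A i j • r j = 0 := by
  have hX0 : ∀ A, PowerSeries.constantCoeff (tupleField ι ψ A +
      PowerSeries.X * PowerSeries.C (tupleMatrix N (ρ A))) = tupleDeriv ι A := by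
    intro A
    simp only [tupleField, map_add, map_sum, map_mul, PowerSeries.constantCoeff_X, zero_mul,
      add_zero, PowerSeries.constantCoeff_C]
    have : ∀ B, PowerSeries.constantCoeff (PowerSeries.map (tupleMul N ι) (ψ A B)) =
        if A = B then 1 else 0 := by
      intro B
      rw [← PowerSeries.coeff_zero_eq_constantCoeff_apply, PowerSeries.coeff_map,
        PowerSeries.coeff_zero_eq_constantCoeff_apply, hψ.classical_limit]
      split_ifs <;> simp
    simp [this]
  -- Constant matrices commute with the vector fields, so the commutator of `Z_A + λ ρ_A` and `Z_B +
  -- λ ρ_B` has no cross terms, and both remaining parts close with the same structure constants.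
  have hfm : ∀ A B, Commute (tupleField ι ψ A)
      (PowerSeries.X * PowerSeries.C (tupleMatrix N (ρ B))) := by
    intro A B
    refine Commute.mul_right (PowerSeries.commute_X _) ?_
    refine Commute.sum_left _ _ _ fun C _ => Commute.mul_left ?_ ?_
    · ext1 n
      rw [PowerSeries.coeff_mul_C, PowerSeries.coeff_C_mul, PowerSeries.coeff_map,
        tupleMatrix_comm_tupleMul]
    · rw [Commute, SemiconjBy, ← map_mul, ← map_mul, tupleMatrix_comm_tupleDeriv]
  obtain ⟨w, hw0, -, hwn, hw⟩ := exists_flat_section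
    (V := ι → MvPolynomial (Fin N) ℝ) (U := ⊤)
    (ε := fun A => tupleMul N ι (MvPolynomial.X A))
    (fun A => tupleField ι ψ A + PowerSeries.X * PowerSeries.C (tupleMatrix N (ρ A)))
    (fun _ _ _ _ => trivial) (fun _ _ _ => trivial)
    (fun A B => by rw [hX0]; exact tupleDeriv_mul_tupleMul_X A B)
    (by simp only [hX0]; exact isGraded_tuple) (structConst b)
    (fun A B => by
      have h1 : PowerSeries.X * PowerSeries.C (tupleMatrix N (ρ A)) *
            (PowerSeries.X * PowerSeries.C (tupleMatrix N (ρ B))) -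
          PowerSeries.X * PowerSeries.C (tupleMatrix N (ρ B)) *
            (PowerSeries.X * PowerSeries.C (tupleMatrix N (ρ A))) =
          PowerSeries.X * ∑ C, structConst b A B C •
            (PowerSeries.X * PowerSeries.C (tupleMatrix N (ρ C))) := by
        have hX : ∀ P Q : PowerSeries (Module.End ℝ (ι → MvPolynomial (Fin N) ℝ)),
            PowerSeries.X * P * (PowerSeries.X * Q) = PowerSeries.X * (PowerSeries.X * (P * Q)) := by
          intro P Q
          rw [mul_assoc, ← mul_assoc P, (PowerSeries.commute_X P).eq, mul_assoc]
        rw [hX, hX, ← mul_sub, ← mul_sub, ← map_mul, ← map_mul, ← map_sub, ← tupleMatrix_mul,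
          ← tupleMatrix_mul, ← tupleMatrix_sub, hρ, tupleMatrix_sum_smul, map_sum]
        simp only [Finset.mul_sum]
        refine Finset.sum_congr rfl fun C _ => ?_
        have hC : PowerSeries.C (structConst b A B C • tupleMatrix N (ρ C)) =
            structConst b A B C • PowerSeries.C (tupleMatrix N (ρ C)) := by
          ext1 n
          change _ = structConst b A B C • PowerSeries.coeff n (PowerSeries.C (tupleMatrix N (ρ C)))
          rw [PowerSeries.coeff_C, PowerSeries.coeff_C]
          split_ifs <;> simp
        rw [hC, mul_smul_comm, mul_smul_comm]
      have h2 := hψ.tupleField_commutator (ι := ι) A B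
      have h3 := hfm A B
      have h4 := hfm B A
      simp only [smul_add, Finset.sum_add_distrib, mul_add (PowerSeries.X)]
      rw [← h2, ← h1, add_mul, mul_add, mul_add, add_mul, mul_add, mul_add, h3.eq, ← h4.eq]
      abel)
    (v₀ := fun i => MvPolynomial.C (v i)) trivial
    (fun A => by rw [hX0]; funext i; simp [tupleDeriv_apply])
  refine ⟨fun i => PowerSeries.mk fun n => w n i, fun i => ?_, fun i => ?_, fun A i => ?_⟩
  · rw [← PowerSeries.coeff_zero_eq_constantCoeff_apply, PowerSeries.coeff_mk, hw0]
  · ext1 n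
    rw [PowerSeries.coeff_map, PowerSeries.coeff_mk, PowerSeries.coeff_C]
    rcases n with _ | n
    · simp [hw0]
    -- The corrections of positive order in `λ` are sums of multiples of the `ζ^A`, so they vanish
    -- at `ζ = 0` and the initial value is kept.
    · obtain ⟨u, -, hu⟩ := hwn n
      simp [hu, tupleMul_apply]
  · ext1 n
    have h := congrFun (congrFun (hw A) n) i
    rw [seriesAct_add_left, Pi.add_apply, Pi.add_apply] at h
    rw [map_add]
    refine Eq.trans (congrArg₂ _ ?_ ?_) h
    · rw [tupleField, seriesAct_sum_left, Finset.sum_apply, Finset.sum_apply, map_sum]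
      refine Finset.sum_congr rfl fun B _ => ?_
      rw [PowerSeries.coeff_mul, seriesAct, Finset.sum_apply]
      refine Finset.sum_congr rfl fun p _ => ?_
      rw [PowerSeries.coeff_mul_C, PowerSeries.coeff_map, Module.End.mul_apply, tupleMul_apply,
        tupleDeriv_apply, zetaDeriv, PowerSeries.coeff_mk, PowerSeries.coeff_mk]
    · rcases n with _ | n
      · rw [seriesAct_X_mul_zero]; simp
      · rw [seriesAct_X_mul_succ, PowerSeries.coeff_succ_X_mul, map_sum]
        rw [seriesAct, Finset.sum_eq_single (0, n)]
        · rw [PowerSeries.coeff_zero_C, tupleMatrix_apply]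
          exact Finset.sum_congr rfl fun j _ => congrArg (ρ A i j • ·)
            (PowerSeries.coeff_mk n fun n => w n j)
        · rintro ⟨k, l⟩ hkl hne
          have : k ≠ 0 := by
            rintro rfl
            rw [Finset.HasAntidiagonal.mem_antidiagonal] at hkl
            simp only [zero_add] at hkl
            exact hne (by rw [hkl])
          simp [PowerSeries.coeff_C, this]
        · simp

end PolynomialSections
end

/-! ### Bidifferential operators and their grading. -/

noncomputable section

namespace SmoothFn

variable {N : ℕ}

theorem partials_cons (A : Fin N) (w : List (Fin N)) :
    partials (A :: w) = partialDeriv A * partials w := by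
  simp [partials]

theorem partials_append_singleton (w : List (Fin N)) (A : Fin N) :
    partials (w ++ [A]) = partials w * partialDeriv A := by
  simp [partials]

theorem partials_mul_partialDeriv (w : List (Fin N)) (A : Fin N) :
    partials w * partialDeriv A = partialDeriv A * partials w := by
  induction w with
  | nil => simp [partials]
  | cons B w ih => rw [partials_cons, mul_assoc, ih, ← mul_assoc, ← mul_assoc, partialDeriv_comm]

theorem commutator_partials_cons (A B : Fin N) (w : List (Fin N)) :
    partials (B :: w) * mulCoord A - mulCoord A * partials (B :: w) =
      partialDeriv B * (partials w * mulCoord A - mulCoord A * partials w) +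
        if B = A then partials w else 0 := by
  rw [partials_cons, mul_sub, ← mul_assoc (partialDeriv B) (mulCoord A),
    partialDeriv_mul_mulCoord, add_mul]
  split_ifs
  · rw [one_mul]; noncomm_ring
  · rw [zero_mul]; noncomm_ring

/-- By the Leibniz rule a commutator with `z_A` removes exactly one derivative. -/
theorem commutator_partials_mem (w : List (Fin N)) (A : Fin N) :
    partials w * mulCoord A - mulCoord A * partials w ∈
      Submodule.span ℝ {P | ∃ u : List (Fin N), u.length + 1 = w.length ∧ P = partials u} := by
  induction w with
  | nil => simp [partials]
  | cons B w ih =>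
    rw [commutator_partials_cons]
    refine add_mem ?_ ?_
    · have := Submodule.mem_map_of_mem (f := LinearMap.mulLeft ℝ (partialDeriv B)) ih
      rw [Submodule.map_span] at this
      refine Submodule.span_mono ?_ this
      rintro _ ⟨_, ⟨u, hu, rfl⟩, rfl⟩
      exact ⟨B :: u, by simp [← hu], by rw [partials_cons]; rfl⟩
    · split_ifs
      · exact Submodule.subset_span ⟨w, by simp, rfl⟩
      · exact zero_mem _

/-- This is Euler's identity for homogeneous polynomials: on symbols the commutator with `z_A` is
`∂/∂ζ^A` and composition with `∂_A` is multiplication by `ζ^A`. -/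
theorem sum_commutator_partials (w : List (Fin N)) :
    ∑ A, (partials w * mulCoord A - mulCoord A * partials w) * partialDeriv A =
      (w.length : ℝ) • partials w := by
  induction w with
  | nil => simp [partials]
  | cons B w ih =>
    simp only [commutator_partials_cons, add_mul, mul_assoc (partialDeriv B),
      Finset.sum_add_distrib, ← Finset.mul_sum, ih, ite_mul, zero_mul]
    rw [Finset.sum_ite_eq]
    simp only [Finset.mem_univ, if_true, partials_mul_partialDeriv, List.length_cons, Nat.cast_add,
      Nat.cast_one, add_smul, one_smul, partials_cons, mul_smul_comm]

end SmoothFn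

open SmoothFn

section Bidifferential

variable {N : ℕ}

/-- Bilinear maps on `C^∞(ℝ^N)`. -/
abbrev Bil (N : ℕ) : Type := SmoothFn N →ₗ[ℝ] SmoothFn N →ₗ[ℝ] SmoothFn N

instance : AddCommGroup (Bil N) := LinearMap.addCommGroup

/-- The bilinear map `(f, g) ↦ P f * Q g`. -/
def tensorOp (P Q : Module.End ℝ (SmoothFn N)) : Bil N :=
  (LinearMap.mul ℝ (SmoothFn N)).compl₁₂ P Q

@[simp] theorem tensorOp_apply (P Q : Module.End ℝ (SmoothFn N)) (f g : SmoothFn N) :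
    tensorOp P Q f g = P f * Q g := rfl

/-- Substitution of an operator into the second argument. -/
def rightSubst (Q : Module.End ℝ (SmoothFn N)) : Module.End ℝ (Bil N) where
  toFun β := β.compl₂ Q
  map_add' _ _ := rfl
  map_smul' _ _ := rfl

@[simp] theorem rightSubst_apply (Q : Module.End ℝ (SmoothFn N)) (β : Bil N) (f g : SmoothFn N) :
    rightSubst Q β f g = β f (Q g) := rfl

/-- Composition of a bilinear map with an operator. -/
def postComp (N : ℕ) : Module.End ℝ (SmoothFn N) →+* Module.End ℝ (Bil N) where
  toFun P :=
    { toFun := fun β => β.compr₂ P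
      map_add' := fun β γ => by ext1 f; ext1 g; simp
      map_smul' := fun r β => by ext1 f; ext1 g; simp }
  map_one' := rfl
  map_mul' P Q := rfl
  map_zero' := rfl
  map_add' P Q := rfl

@[simp] theorem postComp_apply (P : Module.End ℝ (SmoothFn N)) (β : Bil N) (f g : SmoothFn N) :
    postComp N P β f g = P (β f g) := rfl

theorem Bil.ext {β γ : Bil N} (h : ∀ f g, β f g = γ f g) : β = γ :=
  LinearMap.ext fun f => LinearMap.ext fun g => h f g

theorem rightSubst_mul (P Q : Module.End ℝ (SmoothFn N)) :
    rightSubst (P * Q) = rightSubst Q * rightSubst P := rfl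

theorem rightSubst_add (P Q : Module.End ℝ (SmoothFn N)) :
    rightSubst (P + Q) = rightSubst P + rightSubst Q :=
  LinearMap.ext fun β => Bil.ext fun f _ => map_add (β f) _ _

theorem rightSubst_sub (P Q : Module.End ℝ (SmoothFn N)) :
    rightSubst (P - Q) = rightSubst P - rightSubst Q :=
  LinearMap.ext fun β => Bil.ext fun f _ => map_sub (β f) _ _

theorem rightSubst_smul (r : ℝ) (P : Module.End ℝ (SmoothFn N)) :
    rightSubst (r • P) = r • rightSubst P :=
  LinearMap.ext fun β => Bil.ext fun f _ => map_smul (β f) _ _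

theorem rightSubst_sum {ι : Type*} (s : Finset ι) (P : ι → Module.End ℝ (SmoothFn N)) :
    rightSubst (∑ i ∈ s, P i) = ∑ i ∈ s, rightSubst (P i) :=
  LinearMap.ext fun β => Bil.ext fun f g => by simp [LinearMap.sum_apply]

theorem postComp_mul_rightSubst (P Q : Module.End ℝ (SmoothFn N)) :
    postComp N P * rightSubst Q = rightSubst Q * postComp N P := rfl

/-- Bidifferential operators with polynomial coefficients. -/
def bidiff (N : ℕ) : Submodule ℝ (Bil N) :=
  Submodule.span ℝ {β | ∃ P ∈ weyl N, ∃ Q ∈ weyl N, β = tensorOp P Q}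

theorem tensorOp_mem_bidiff {P Q : Module.End ℝ (SmoothFn N)} (hP : P ∈ weyl N)
    (hQ : Q ∈ weyl N) : tensorOp P Q ∈ bidiff N :=
  Submodule.subset_span ⟨P, hP, Q, hQ, rfl⟩

theorem bidiff_induction {p : Bil N → Prop}
    (hT : ∀ P ∈ weyl N, ∀ Q ∈ weyl N, p (tensorOp P Q)) (h0 : p 0)
    (hadd : ∀ β γ, β ∈ bidiff N → γ ∈ bidiff N → p β → p γ → p (β + γ))
    (hsmul : ∀ (r : ℝ) β, β ∈ bidiff N → p β → p (r • β)) {β : Bil N} (hβ : β ∈ bidiff N) :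
    p β := by
  induction hβ using Submodule.span_induction with
  | mem x hx => obtain ⟨P, hP, Q, hQ, rfl⟩ := hx; exact hT P hP Q hQ
  | zero => exact h0
  | add x y hx hy h1 h2 => exact hadd x y hx hy h1 h2
  | smul r x hx h1 => exact hsmul r x hx h1

theorem rightSubst_mem_bidiff {Q : Module.End ℝ (SmoothFn N)} (hQ : Q ∈ weyl N) {β : Bil N}
    (hβ : β ∈ bidiff N) : rightSubst Q β ∈ bidiff N :=
  bidiff_induction (p := fun β => rightSubst Q β ∈ bidiff N)
    (fun _ hP _ hR => tensorOp_mem_bidiff hP (mul_mem hR hQ)) (by simp)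
    (fun _ _ _ _ h1 h2 => by rw [map_add]; exact add_mem h1 h2)
    (fun r _ _ h => by rw [map_smul]; exact Submodule.smul_mem _ r h) hβ

theorem flip_mem_bidiff {β : Bil N} (hβ : β ∈ bidiff N) : β.flip ∈ bidiff N :=
  bidiff_induction (p := fun β => β.flip ∈ bidiff N)
    (fun P hP Q hQ => by
      have : (tensorOp P Q).flip = tensorOp Q P := Bil.ext fun f g => mul_comm _ _
      rw [this]
      exact tensorOp_mem_bidiff hQ hP) (zero_mem _)
    (fun β γ _ _ h1 h2 => by
      have : (β + γ).flip = β.flip + γ.flip := rfl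
      rw [this]; exact add_mem h1 h2)
    (fun r β _ h => by
      have : (r • β).flip = r • β.flip := rfl
      rw [this]; exact Submodule.smul_mem _ r h) hβ

theorem postComp_mem_bidiff {P : Module.End ℝ (SmoothFn N)} (hP : P ∈ weyl N) {β : Bil N}
    (hβ : β ∈ bidiff N) : postComp N P β ∈ bidiff N := by
  have key : ∀ P : Module.End ℝ (SmoothFn N),
      (∀ R ∈ weyl N, ∀ Q ∈ weyl N, postComp N P (tensorOp R Q) ∈ bidiff N) →
      ∀ β ∈ bidiff N, postComp N P β ∈ bidiff N := fun P h β hβ =>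
    bidiff_induction (p := fun β => postComp N P β ∈ bidiff N) h (by simp)
      (fun _ _ _ _ h1 h2 => by rw [map_add]; exact add_mem h1 h2)
      (fun r _ _ h => by rw [map_smul]; exact Submodule.smul_mem _ r h) hβ
  refine weyl_induction (p := fun P => ∀ β ∈ bidiff N, postComp N P β ∈ bidiff N)
    (fun A => key _ fun R hR Q hQ => ?_) (fun A => key _ fun R hR Q hQ => ?_) (fun r β hβ => ?_)
    (fun P Q _ _ h1 h2 β hβ => ?_) (fun P Q _ _ h1 h2 β hβ => ?_) hP β hβ
  · have : postComp N (mulCoord A) (tensorOp R Q) = tensorOp (mulCoord A * R) Q :=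
      Bil.ext fun f g => (mul_assoc _ _ _).symm
    rw [this]
    exact tensorOp_mem_bidiff (mul_mem (mulCoord_mem_weyl A) hR) hQ
  · have : postComp N (partialDeriv A) (tensorOp R Q) =
        tensorOp (partialDeriv A * R) Q + tensorOp R (partialDeriv A * Q) :=
      Bil.ext fun f g => partialDeriv_mul _ _ _
    rw [this]
    exact add_mem (tensorOp_mem_bidiff (mul_mem (partialDeriv_mem_weyl A) hR) hQ)
      (tensorOp_mem_bidiff hR (mul_mem (partialDeriv_mem_weyl A) hQ))
  · exact Submodule.smul_mem _ r hβ
  · rw [map_add]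
    exact add_mem (h1 β hβ) (h2 β hβ)
  · rw [map_mul]
    exact h1 _ (h2 β hβ)

/-- A normal form with pure derivatives on the second argument. Coordinates there are commuted to
the left of the derivatives, at the cost of shorter words, and are then absorbed by the first factor
since functions multiply commutatively. -/
theorem bidiff_eq_span_partials {β : Bil N} (hβ : β ∈ bidiff N) :
    β ∈ Submodule.span ℝ {β : Bil N | ∃ P ∈ weyl N, ∃ w : List (Fin N),
      β = tensorOp P (partials w)} := by
  set M := Submodule.span ℝ {β : Bil N | ∃ P ∈ weyl N, ∃ w : List (Fin N),
      β = tensorOp P (partials w)} with hM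
  have hstab : ∀ T : Module.End ℝ (Bil N),
      (∀ P ∈ weyl N, ∀ w : List (Fin N), T (tensorOp P (partials w)) ∈ M) →
      ∀ β ∈ M, T β ∈ M := by
    intro T hT β hβ
    induction hβ using Submodule.span_induction with
    | mem x hx => obtain ⟨P, hP, w, rfl⟩ := hx; exact hT P hP w
    | zero => rw [map_zero]; exact zero_mem _
    | add x y _ _ h1 h2 => rw [map_add]; exact add_mem h1 h2
    | smul r x _ h1 => rw [map_smul]; exact Submodule.smul_mem _ r h1
  have hspan : ∀ P ∈ weyl N, ∀ Q ∈ Submodule.span ℝ (Set.range (partials (N := N))),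
      tensorOp P Q ∈ M := by
    intro P hP Q hQ
    have h1 : ∀ Q, tensorOp P Q = rightSubst Q (tensorOp P 1) := fun Q => rfl
    induction hQ using Submodule.span_induction with
    | mem x hx => obtain ⟨w, rfl⟩ := hx; exact Submodule.subset_span ⟨P, hP, w, rfl⟩
    | zero =>
      have : tensorOp P 0 = 0 := Bil.ext fun f g => mul_zero _
      rw [this]; exact zero_mem _
    | add x y _ _ h2 h3 =>
      rw [h1, rightSubst_add]; exact add_mem h2 h3
    | smul r x _ h2 =>
      rw [h1, rightSubst_smul]; exact Submodule.smul_mem _ r h2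
  have hright : ∀ Q ∈ weyl N, ∀ β ∈ M, rightSubst Q β ∈ M := by
    intro Q hQ
    refine weyl_induction (p := fun Q => ∀ β ∈ M, rightSubst Q β ∈ M)
      (fun A => hstab _ fun P hP w => ?_) (fun A => hstab _ fun P hP w => ?_) (fun r β hβ => ?_)
      (fun P Q _ _ h1 h2 β hβ => ?_) (fun P Q _ _ h1 h2 β hβ => ?_) hQ
    · have : rightSubst (mulCoord A) (tensorOp P (partials w)) =
          tensorOp P (partials w * mulCoord A - mulCoord A * partials w) +
            tensorOp (mulCoord A * P) (partials w) := by
        refine Bil.ext fun f g => ?_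
        simp only [rightSubst_apply, tensorOp_apply, LinearMap.add_apply, LinearMap.sub_apply,
          Module.End.mul_apply, mulCoord_apply]
        ring
      rw [this]
      refine add_mem (hspan P hP _ (Submodule.span_mono ?_ (commutator_partials_mem w A)))
        (Submodule.subset_span ⟨_, mul_mem (mulCoord_mem_weyl A) hP, w, rfl⟩)
      rintro _ ⟨u, -, rfl⟩
      exact ⟨u, rfl⟩
    · refine Submodule.subset_span ⟨P, hP, w ++ [A], ?_⟩
      rw [partials_append_singleton]
      rfl
    · have : rightSubst (algebraMap ℝ _ r) β = r • β := Bil.ext fun f g => map_smul (β f) r g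
      rw [this]
      exact Submodule.smul_mem _ r hβ
    · rw [rightSubst_add]
      exact add_mem (h1 β hβ) (h2 β hβ)
    · rw [rightSubst_mul]
      exact h2 _ (h1 β hβ)
  refine bidiff_induction (p := fun β => β ∈ M) (fun P hP Q hQ => ?_) (zero_mem _)
    (fun _ _ _ _ h1 h2 => add_mem h1 h2) (fun r _ _ h => Submodule.smul_mem _ r h) hβ
  have h1 : tensorOp P (partials []) ∈ M := Submodule.subset_span ⟨P, hP, [], rfl⟩
  exact hright Q hQ _ h1

/-- The Weyl pair consists of precomposition with `∂_A` in the second argument and the commutator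
with `z_A` there, so the Euler operator counts the derivatives on the second argument of a normal
form. -/
theorem isGraded_bidiff : IsGraded (eulerOp (fun A => rightSubst (partialDeriv A))
    (fun A => rightSubst (mulCoord A) - postComp N (mulCoord A))) (bidiff N) := by
  intro β hβ
  refine Submodule.span_mono ?_ (bidiff_eq_span_partials hβ)
  rintro _ ⟨P, hP, w, rfl⟩
  refine ⟨tensorOp_mem_bidiff hP (partials_mem_weyl w), w.length, ?_⟩
  rw [eulerOp_apply]
  refine Bil.ext fun f g => ?_
  have h := congrArg (fun T : Module.End ℝ (SmoothFn N) => P f * T g) (sum_commutator_partials w)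
  simp only [LinearMap.sum_apply, Finset.mul_sum, LinearMap.smul_apply, mul_smul_comm] at h
  simp only [LinearMap.sum_apply, LinearMap.smul_apply, tensorOp_apply]
  rw [← h]
  refine Finset.sum_congr rfl fun A _ => ?_
  simp only [rightSubst_apply, LinearMap.sub_apply, tensorOp_apply, postComp_apply,
    Module.End.mul_apply, mulCoord_apply]
  ring

end Bidifferential

/-! ### Existence of the star product. -/

section StarProduct

variable {N : ℕ} {ψ : Matrix (Fin N) (Fin N) (FormalZeta N)}

/-- The bidifferential operators `b_n` are the coefficients of a star product on `F` which has `1`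
as right unit and commutes with the right action of the `Z_A`. -/
structure IsStarProduct (ψ : Matrix (Fin N) (Fin N) (FormalZeta N)) (b : ℕ → Bil N) : Prop where
  mem_bidiff : ∀ n, b n ∈ bidiff N
  zero : ∀ f g, b 0 f g = f * g
  succ_one : ∀ n f, b (n + 1) f 1 = 0
  frame : ∀ A n f g, ∑ p ∈ Finset.HasAntidiagonal.antidiagonal n,
      b p.2 f (PowerSeries.coeff p.1 (frameSeries ψ A) g) =
    ∑ p ∈ Finset.HasAntidiagonal.antidiagonal n,
      PowerSeries.coeff p.1 (frameSeries ψ A) (b p.2 f g)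

/-- The star product is a flat section starting at pointwise multiplication: compatibility with
`Z_A` says that `Y_A`, which inserts `Z_A` in the second argument minus applying `Z_A` to the
result, annihilates the series `b`. -/
theorem IsLeftInvariantFrame.exists_starProduct {𝔤 : Type*} [LieRing 𝔤] [LieAlgebra ℝ 𝔤]
    {bs : Module.Basis (Fin N) ℝ 𝔤} (hψ : IsLeftInvariantFrame bs ψ) :
    ∃ b : ℕ → Bil N, IsStarProduct ψ b := by
  let R : PowerSeries (Module.End ℝ (SmoothFn N)) → PowerSeries (Module.End ℝ (Bil N)) :=
    fun P => PowerSeries.mk fun n => rightSubst (PowerSeries.coeff n P)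
  let L : PowerSeries (Module.End ℝ (SmoothFn N)) →+* PowerSeries (Module.End ℝ (Bil N)) :=
    PowerSeries.map (postComp N)
  have hR : ∀ P n, PowerSeries.coeff n (R P) = rightSubst (PowerSeries.coeff n P) :=
    fun P n => PowerSeries.coeff_mk _ _
  have hL : ∀ P n, PowerSeries.coeff n (L P) = postComp N (PowerSeries.coeff n P) :=
    fun P n => PowerSeries.coeff_map _ _ _
  have hRmul : ∀ P Q, R P * R Q = R (Q * P) := by
    intro P Q
    ext1 n
    rw [PowerSeries.coeff_mul, hR, PowerSeries.coeff_mul, rightSubst_sum,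
      ← Finset.Nat.sum_antidiagonal_swap]
    exact Finset.sum_congr rfl fun p _ => by rw [hR, hR, rightSubst_mul]; rfl
  have hRL : ∀ P Q, R P * L Q = L Q * R P := by
    intro P Q
    ext1 n
    rw [PowerSeries.coeff_mul, PowerSeries.coeff_mul, ← Finset.Nat.sum_antidiagonal_swap]
    exact Finset.sum_congr rfl fun p _ => by
      rw [hR, hR, hL, hL]; exact (postComp_mul_rightSubst _ _).symm
  have hRsub : ∀ P Q, R P - R Q = R (P - Q) := by
    intro P Q
    ext1 n
    rw [map_sub, hR, hR, hR, map_sub, rightSubst_sub]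
  let Y : Fin N → PowerSeries (Module.End ℝ (Bil N)) :=
    fun A => R (frameSeries ψ A) - L (frameSeries ψ A)
  have hY0 : ∀ A, PowerSeries.constantCoeff (Y A) =
      rightSubst (mulCoord A) - postComp N (mulCoord A) := by
    intro A
    have := hψ.constantCoeff_frameSeries A
    rw [← PowerSeries.coeff_zero_eq_constantCoeff_apply] at this ⊢
    rw [map_sub, hR, hL, this]
  -- Insertion `R` reverses products, application `L` preserves them, and the two commute. The
  -- commutator of the `Y`'s is thus `R - L` of the reversed commutator of the `Z`'s, which is `λ ∑
  -- f_{AB}^C Z_C`.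
  have hcomm : ∀ A B, Y A * Y B - Y B * Y A =
      PowerSeries.X * ∑ C, structConst bs A B C • Y C := by
    intro A B
    have h := hψ.frameSeries_commutator A B
    have h1 : Y A * Y B - Y B * Y A =
        R (frameSeries ψ B * frameSeries ψ A - frameSeries ψ A * frameSeries ψ B) -
          L (frameSeries ψ B * frameSeries ψ A - frameSeries ψ A * frameSeries ψ B) := by
      simp only [Y, sub_mul, mul_sub, hRL, hRmul, ← hRsub, map_sub, map_mul]
      abel
    rw [h1, h]
    ext1 n
    have hsum : ∀ m, PowerSeries.coeff m (∑ C, structConst bs A B C • Y C) =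
        rightSubst (PowerSeries.coeff m (∑ C, structConst bs A B C • frameSeries ψ C)) -
        postComp N (PowerSeries.coeff m (∑ C, structConst bs A B C • frameSeries ψ C)) := by
      intro m
      have hs : ∀ (c : ℝ) (P : PowerSeries (Module.End ℝ (SmoothFn N))),
          PowerSeries.coeff m (c • P) = c • PowerSeries.coeff m P := fun _ _ => rfl
      have hs' : ∀ (c : ℝ) (P : PowerSeries (Module.End ℝ (Bil N))),
          PowerSeries.coeff m (c • P) = c • PowerSeries.coeff m P := fun _ _ => rfl
      simp only [map_sum, hs, hs', rightSubst_sum, rightSubst_smul, Y, map_sub, hR, hL,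
        ← Finset.sum_sub_distrib, smul_sub]
      rfl
    rw [map_sub, hR, hL]
    rcases n with _ | n
    · simp only [PowerSeries.coeff_zero_X_mul, map_zero, sub_zero]
      exact LinearMap.ext fun β => Bil.ext fun f g => map_zero (β f)
    · rw [PowerSeries.coeff_succ_X_mul, PowerSeries.coeff_succ_X_mul, hsum]
  obtain ⟨b, hb0, hbU, hbs, hb⟩ := exists_flat_section (U := bidiff N) Y
    (ε := fun A => rightSubst (partialDeriv A))
    (fun A n β hβ => by
      simp only [Y, map_sub, hR, hL]
      exact sub_mem (rightSubst_mem_bidiff (coeff_frameSeries_mem_weyl ψ A n) hβ)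
        (postComp_mem_bidiff (coeff_frameSeries_mem_weyl ψ A n) hβ))
    (fun A β hβ => rightSubst_mem_bidiff (partialDeriv_mem_weyl A) hβ)
    (fun A B => by
      rw [hY0, sub_mul, mul_sub, ← rightSubst_mul, ← rightSubst_mul, partialDeriv_mul_mulCoord,
        rightSubst_add, postComp_mul_rightSubst]
      by_cases h : A = B
      · subst h
        have : rightSubst (1 : Module.End ℝ (SmoothFn N)) = 1 := rfl
        simp only [if_true, this]
        abel
      · have : rightSubst (0 : Module.End ℝ (SmoothFn N)) = 0 :=
          LinearMap.ext fun β => Bil.ext fun f g => map_zero (β f)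
        simp only [h, Ne.symm h, if_false, this]
        abel)
    (by simp only [hY0]; exact isGraded_bidiff) (structConst bs) hcomm
    (v₀ := tensorOp 1 1) (tensorOp_mem_bidiff (one_mem _) (one_mem _))
    (fun A => by
      rw [hY0]
      refine Bil.ext fun f g => ?_
      simp only [LinearMap.sub_apply, rightSubst_apply, postComp_apply, tensorOp_apply,
        mulCoord_apply, Module.End.one_apply, LinearMap.zero_apply]
      ring)
  refine ⟨b, hbU, fun f g => by rw [hb0]; rfl, fun n f => ?_, fun A n f g => ?_⟩
  -- Each correction differentiates its second argument first, hence vanishes there at `1`; this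
  -- makes `1` a right unit.
  · obtain ⟨u, -, hu⟩ := hbs n
    rw [hu]
    simp [LinearMap.sum_apply, partialDeriv_one]
  · have h := congrArg (fun β : Bil N => β f g) (congrFun (hb A) n)
    simp only [Y, seriesAct_sub_left, Pi.sub_apply, LinearMap.sub_apply, Pi.zero_apply,
      LinearMap.zero_apply, sub_eq_zero] at h
    simp only [seriesAct, LinearMap.sum_apply, hR, hL, rightSubst_apply, postComp_apply] at h
    exact h

end StarProduct
end

/-! ### Differential operators are determined by their values on polynomials. -/

noncomputable section

open SmoothFn

section Faithful

variable {N : ℕ}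

/-- The subalgebra of polynomial functions. -/
def polyFn (N : ℕ) : Subalgebra ℝ (SmoothFn N) := Algebra.adjoin ℝ (Set.range coord)

theorem coord_mem_polyFn (A : Fin N) : coord A ∈ polyFn N := Algebra.subset_adjoin ⟨A, rfl⟩

theorem weyl_apply_mem_polyFn {P : Module.End ℝ (SmoothFn N)} (hP : P ∈ weyl N) {f : SmoothFn N}
    (hf : f ∈ polyFn N) : P f ∈ polyFn N := by
  refine weyl_induction (p := fun P => ∀ f ∈ polyFn N, P f ∈ polyFn N)
    (fun A f hf => mul_mem (coord_mem_polyFn A) hf) (fun A f hf => ?_)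
    (fun r f hf => Subalgebra.smul_mem _ hf r)
    (fun P Q _ _ h1 h2 f hf => add_mem (h1 f hf) (h2 f hf))
    (fun P Q _ _ h1 h2 f hf => h1 _ (h2 f hf)) hP f hf
  induction hf using Algebra.adjoin_induction with
  | mem x hx =>
    obtain ⟨B, rfl⟩ := hx
    rw [partialDeriv_coord]
    split_ifs
    · exact one_mem _
    · exact zero_mem _
  | algebraMap r =>
    rw [Algebra.algebraMap_eq_smul_one, map_smul, partialDeriv_one, smul_zero]
    exact zero_mem _
  | add x y _ _ h1 h2 => rw [map_add]; exact add_mem h1 h2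
  | mul x y hx hy h1 h2 =>
    rw [partialDeriv_mul]
    exact add_mem (mul_mem h1 hy) (mul_mem hx h2)

theorem mulLeft_mem_weyl {f : SmoothFn N} (hf : f ∈ polyFn N) : LinearMap.mulLeft ℝ f ∈ weyl N := by
  induction hf using Algebra.adjoin_induction with
  | mem x hx => obtain ⟨B, rfl⟩ := hx; exact mulCoord_mem_weyl B
  | algebraMap r =>
    have : LinearMap.mulLeft ℝ (algebraMap ℝ (SmoothFn N) r) = algebraMap ℝ _ r := by
      ext1 f
      rw [LinearMap.mulLeft_apply, Module.algebraMap_end_apply, Algebra.smul_def]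
    rw [this]
    exact Subalgebra.algebraMap_mem _ r
  | add x y _ _ h1 h2 =>
    have : LinearMap.mulLeft ℝ (x + y) = LinearMap.mulLeft ℝ x + LinearMap.mulLeft ℝ y := by
      ext1 f; simp [add_mul]
    rw [this]; exact add_mem h1 h2
  | mul x y _ _ h1 h2 =>
    rw [LinearMap.mulLeft_mul]
    exact mul_mem h1 h2

/-- Differential operators of order less than `m` with smooth coefficients. -/
def orderLT (N m : ℕ) : Submodule ℝ (Module.End ℝ (SmoothFn N)) :=
  Submodule.span ℝ {P | ∃ (f : SmoothFn N) (w : List (Fin N)), w.length < m ∧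
    P = LinearMap.mulLeft ℝ f * partials w}

theorem orderLT_mono {m n : ℕ} (h : m ≤ n) : orderLT N m ≤ orderLT N n := by
  refine Submodule.span_mono ?_
  rintro _ ⟨f, w, hw, rfl⟩
  exact ⟨f, w, hw.trans_le h, rfl⟩

/-- The normal form of bidifferential operators, with the first argument set to `1`. -/
theorem exists_mem_orderLT {P : Module.End ℝ (SmoothFn N)} (hP : P ∈ weyl N) :
    ∃ m, P ∈ orderLT N m := by
  have h := bidiff_eq_span_partials (tensorOp_mem_bidiff (one_mem (weyl N)) hP)
  have h1 : (tensorOp 1 P : Bil N) 1 = P := by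
    ext1 f
    simp
  rw [← h1]
  generalize (tensorOp 1 P : Bil N) = β at h
  induction h using Submodule.span_induction with
  | mem x hx =>
    obtain ⟨Q, -, w, rfl⟩ := hx
    exact ⟨w.length + 1, Submodule.subset_span ⟨Q 1, w, Nat.lt_succ_self _, rfl⟩⟩
  | zero => exact ⟨0, zero_mem _⟩
  | add x y _ _ h1 h2 =>
    obtain ⟨m, hm⟩ := h1
    obtain ⟨n, hn⟩ := h2
    exact ⟨max m n, add_mem (orderLT_mono (le_max_left _ _) hm) (orderLT_mono (le_max_right _ _) hn)⟩
  | smul r x _ h1 =>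
    obtain ⟨m, hm⟩ := h1
    exact ⟨m, Submodule.smul_mem _ r hm⟩

/-- Commutators with the `z_A` have lower order and still kill polynomials, so they vanish by
induction. Euler's identity recovers the top-order part of `P` from these commutators, so the order
of `P` itself drops. -/
theorem orderLT_eq_zero (m : ℕ) : ∀ P ∈ orderLT N m, (∀ f ∈ polyFn N, P f = 0) → P = 0 := by
  induction m with
  | zero =>
    intro P hP _
    simpa [orderLT] using hP
  | succ m ih =>
    intro P hP h0
    have hcomm : ∀ A, P * mulCoord A - mulCoord A * P = 0 := by
      intro A
      refine ih _ ?_ fun f hf => ?_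
      · clear h0
        induction hP using Submodule.span_induction with
        | mem x hx =>
          obtain ⟨f, w, hw, rfl⟩ := hx
          have h1 : LinearMap.mulLeft ℝ f * partials w * mulCoord A -
              mulCoord A * (LinearMap.mulLeft ℝ f * partials w) =
              LinearMap.mulLeft ℝ f * (partials w * mulCoord A - mulCoord A * partials w) := by
            ext1 g
            simp only [LinearMap.sub_apply, Module.End.mul_apply, LinearMap.mulLeft_apply,
              mulCoord_apply, mul_sub]
            ring
          rw [h1]
          have := Submodule.mem_map_of_mem (f := LinearMap.mulLeft ℝ (LinearMap.mulLeft ℝ f))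
            (commutator_partials_mem w A)
          rw [Submodule.map_span] at this
          refine Submodule.span_mono ?_ this
          rintro _ ⟨_, ⟨u, hu, rfl⟩, rfl⟩
          exact ⟨f, u, by omega, rfl⟩
        | zero => simp
        | add x y _ _ h1 h2 =>
          have : (x + y) * mulCoord A - mulCoord A * (x + y) =
            (x * mulCoord A - mulCoord A * x) + (y * mulCoord A - mulCoord A * y) := by noncomm_ring
          rw [this]
          exact add_mem h1 h2
        | smul r x _ h1 =>
          rw [smul_mul_assoc, mul_smul_comm, ← smul_sub]
          exact Submodule.smul_mem _ r h1
      · rw [LinearMap.sub_apply, Module.End.mul_apply, Module.End.mul_apply, h0 f hf, map_zero,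
          mulCoord_apply, h0 _ (mul_mem (coord_mem_polyFn A) hf), sub_zero]
    -- Words of length `m` are reproduced with factor exactly `m`; what remains has order less than
    -- `m`.
    have hE : ∑ A, (P * mulCoord A - mulCoord A * P) * partialDeriv A - (m : ℝ) • P ∈
        orderLT N m := by
      clear h0 hcomm
      induction hP using Submodule.span_induction with
      | mem x hx =>
        obtain ⟨f, w, hw, rfl⟩ := hx
        have h1 : ∑ A, (LinearMap.mulLeft ℝ f * partials w * mulCoord A -
            mulCoord A * (LinearMap.mulLeft ℝ f * partials w)) * partialDeriv A =
            LinearMap.mulLeft ℝ f *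
              ∑ A, (partials w * mulCoord A - mulCoord A * partials w) * partialDeriv A := by
          rw [Finset.mul_sum]
          refine Finset.sum_congr rfl fun A _ => ?_
          ext1 g
          simp only [LinearMap.sub_apply, Module.End.mul_apply, LinearMap.mulLeft_apply,
            mulCoord_apply, mul_sub]
          ring
        rw [h1, sum_commutator_partials, mul_smul_comm]
        rcases Nat.lt_succ_iff_lt_or_eq.1 hw with hlt | heq
        · have h2 : LinearMap.mulLeft ℝ f * partials w ∈ orderLT N m :=
            Submodule.subset_span ⟨f, w, hlt, rfl⟩
          exact sub_mem (Submodule.smul_mem _ _ h2) (Submodule.smul_mem _ _ h2)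
        · rw [heq, sub_self]
          exact zero_mem _
      | zero => simp
      | add x y _ _ h1 h2 =>
        convert add_mem h1 h2 using 1
        rw [smul_add, sub_add_sub_comm, ← Finset.sum_add_distrib]
        congr 1
        exact Finset.sum_congr rfl fun A _ => by
          rw [← add_mul, add_mul x y, mul_add (mulCoord A), sub_add_sub_comm]
      | smul r x _ h1 =>
        convert Submodule.smul_mem _ r h1 using 1
        rw [smul_sub, Finset.smul_sum, smul_comm]
        congr 1
        exact Finset.sum_congr rfl fun A _ => by
          rw [smul_mul_assoc, mul_smul_comm, ← smul_sub, smul_mul_assoc]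
    simp only [hcomm, zero_mul, Finset.sum_const_zero, zero_sub] at hE
    -- For `m = 0` Euler's identity carries no information, but then `P` is multiplication by `P 1 =
    -- 0`.
    rcases Nat.eq_zero_or_pos m with rfl | hm
    · have h1 : P = LinearMap.mulLeft ℝ (P 1) := by
        clear h0 hcomm hE
        induction hP using Submodule.span_induction with
        | mem x hx =>
          obtain ⟨f, w, hw, rfl⟩ := hx
          obtain rfl : w = [] := List.length_eq_zero_iff.1 (by omega)
          ext1 g
          simp [partials]
        | zero => ext1 g; simp
        | add x y _ _ h1 h2 =>
          ext1 g
          have h3 := congrArg (fun T : Module.End ℝ (SmoothFn N) => T g) h1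
          have h4 := congrArg (fun T : Module.End ℝ (SmoothFn N) => T g) h2
          simp only [LinearMap.mulLeft_apply] at h3 h4
          simp only [LinearMap.mulLeft_apply, LinearMap.add_apply, add_mul, ← h3, ← h4]
        | smul r x _ h1 =>
          ext1 g
          have h3 := congrArg (fun T : Module.End ℝ (SmoothFn N) => T g) h1
          simp only [LinearMap.mulLeft_apply] at h3
          simp only [LinearMap.mulLeft_apply, LinearMap.smul_apply, smul_mul_assoc, ← h3]
      rw [h1, h0 1 (one_mem _)]
      ext1 g
      simp
    · refine ih P ?_ h0
      have := Submodule.smul_mem _ (-(m : ℝ)⁻¹) hE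
      rwa [smul_neg, neg_smul, neg_neg, smul_smul, inv_mul_cancel₀ (by positivity), one_smul] at this

/-- A differential operator with polynomial coefficients which kills all polynomials is zero. -/
theorem weyl_eq_zero {P : Module.End ℝ (SmoothFn N)} (hP : P ∈ weyl N)
    (h : ∀ f ∈ polyFn N, P f = 0) : P = 0 := by
  obtain ⟨m, hm⟩ := exists_mem_orderLT hP
  exact orderLT_eq_zero m P hm h

end Faithful

/-! ### The algebra generated by the `Z_A` and the operators commuting with it. -/

section FrameAlgebra

variable {N : ℕ} (ψ : Matrix (Fin N) (Fin N) (FormalZeta N))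

/-- The algebra generated by the `Z_A`. -/
abbrev frameAlg : Subalgebra ℝ⟦X⟧ (RightOp N) := Algebra.adjoin ℝ⟦X⟧ (Set.range (frameOp ψ))

variable {ψ}

theorem opHom_act_of_mem_frameAlg {P : PowerSeries (Module.End ℝ (SmoothFn N))}
    (hP : ∀ A, P * frameSeries ψ A = frameSeries ψ A * P) {T : RightOp N} (hT : T ∈ frameAlg ψ)
    (f : FormalFn N) : opHom N P (RightOp.act f T) = RightOp.act (opHom N P f) T := by
  induction hT using Algebra.adjoin_induction generalizing f with
  | mem x hx =>
    obtain ⟨A, rfl⟩ := hx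
    rw [act_frameOp, act_frameOp, ← Module.End.mul_apply, ← map_mul, hP, map_mul,
      Module.End.mul_apply]
  | algebraMap r => rw [RightOp.act_algebraMap, RightOp.act_algebraMap, map_smul]
  | add x y _ _ h1 h2 => rw [RightOp.act_add, RightOp.act_add, map_add, h1, h2]
  | mul x y _ _ h1 h2 => rw [RightOp.act_mul, RightOp.act_mul, h2, h1]

/-- Both sides are continuous in `T` for pointwise convergence, so commutation with the generators
passes to the closure. -/
theorem opHom_act_of_mem_quantumFn {P : PowerSeries (Module.End ℝ (SmoothFn N))}
    (hP : ∀ A, P * frameSeries ψ A = frameSeries ψ A * P)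
    (hc : ∀ n, Continuous ⇑(PowerSeries.coeff n P)) {T : RightOp N} (hT : T ∈ QuantumFn ψ)
    (f : FormalFn N) : opHom N P (RightOp.act f T) = RightOp.act (opHom N P f) T := by
  have hcl : IsClosed {T : RightOp N | opHom N P (RightOp.act f T) =
      RightOp.act (opHom N P f) T} :=
    isClosed_eq ((continuous_opHom hc).comp (RightOp.continuous_act_right f))
      (RightOp.continuous_act_right _)
  exact closure_minimal (fun T hT => opHom_act_of_mem_frameAlg hP hT f) hcl hT

variable {𝔤 : Type*} [LieRing 𝔤] [LieAlgebra ℝ 𝔤] {bs : Module.Basis (Fin N) ℝ 𝔤}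

/-- Modulo `λ` each `Z_A` is multiplication by `z_A`, so all of the generated algebra acts by
multiplications. -/
theorem IsLeftInvariantFrame.constantCoeff_act (hψ : IsLeftInvariantFrame bs ψ)
    {T : RightOp N} (hT : T ∈ frameAlg ψ) (f : FormalFn N) :
    PowerSeries.constantCoeff (RightOp.act f T) =
      PowerSeries.constantCoeff f * PowerSeries.constantCoeff (RightOp.act 1 T) := by
  induction hT using Algebra.adjoin_induction generalizing f with
  | mem x hx =>
    obtain ⟨A, rfl⟩ := hx
    have h : ∀ f : FormalFn N, PowerSeries.constantCoeff (RightOp.act f (frameOp ψ A)) =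
        coord A * PowerSeries.constantCoeff f := by
      intro f
      rw [act_frameOp, ← PowerSeries.coeff_zero_eq_constantCoeff_apply, coeff_opHom]
      simp [hψ.constantCoeff_frameSeries]
    rw [h, h, map_one, mul_one, mul_comm]
  | algebraMap r =>
    rw [RightOp.act_algebraMap, RightOp.act_algebraMap, Algebra.smul_def, Algebra.smul_def, map_mul,
      map_mul, map_one, mul_one, mul_comm]
  | add x y _ _ h1 h2 =>
    rw [RightOp.act_add, RightOp.act_add, map_add, map_add, h1, h2, mul_add]
  | mul x y _ _ h1 h2 =>
    rw [RightOp.act_mul, RightOp.act_mul, h2, h1, h2 (RightOp.act 1 x), mul_assoc]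

/-- The classical limit of `Ω` is multiplicative by `constantCoeff_act`, and it sends `Z_A` to
`z_A`. -/
theorem IsLeftInvariantFrame.exists_constantCoeff_eq (hψ : IsLeftInvariantFrame bs ψ)
    {f : SmoothFn N} (hf : f ∈ polyFn N) :
    ∃ T ∈ frameAlg ψ, PowerSeries.constantCoeff (RightOp.act 1 T) = f := by
  induction hf using Algebra.adjoin_induction with
  | mem x hx =>
    obtain ⟨A, rfl⟩ := hx
    refine ⟨frameOp ψ A, Algebra.subset_adjoin ⟨A, rfl⟩, ?_⟩
    rw [act_frameOp, hψ.opHom_frameSeries_one, PowerSeries.constantCoeff_C]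
  | algebraMap r =>
    refine ⟨algebraMap _ _ (PowerSeries.C r), Subalgebra.algebraMap_mem _ _, ?_⟩
    rw [RightOp.act_algebraMap, C_smul_formalFn, ← PowerSeries.coeff_zero_eq_constantCoeff_apply]
    change r • PowerSeries.coeff 0 (1 : FormalFn N) = _
    rw [PowerSeries.coeff_zero_eq_constantCoeff_apply, map_one, Algebra.algebraMap_eq_smul_one]
  | add x y _ _ h1 h2 =>
    obtain ⟨S, hS, rfl⟩ := h1
    obtain ⟨T, hT, rfl⟩ := h2
    exact ⟨S + T, add_mem hS hT, by rw [RightOp.act_add, map_add]⟩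
  | mul x y _ _ h1 h2 =>
    obtain ⟨S, hS, rfl⟩ := h1
    obtain ⟨T, hT, rfl⟩ := h2
    exact ⟨S * T, mul_mem hS hT, by rw [RightOp.act_mul, hψ.constantCoeff_act hT]⟩

/-- A formal power series of differential operators with polynomial coefficients which kills
`Ω(T)` for all `T` in the algebra generated by the `Z_A` is zero. -/
theorem IsLeftInvariantFrame.series_eq_zero (hψ : IsLeftInvariantFrame bs ψ)
    {P : PowerSeries (Module.End ℝ (SmoothFn N))} (hP : ∀ n, PowerSeries.coeff n P ∈ weyl N)
    (h : ∀ T ∈ frameAlg ψ, opHom N P (RightOp.act 1 T) = 0) : P = 0 := by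
  ext1 n
  induction n using Nat.strong_induction_on with
  | _ n ih =>
    rw [map_zero]
    -- Once the lower coefficients of `P` vanish, the coefficient of `λ^n` in `P Ω(T)` is `P_n`
    -- applied to the classical limit of `Ω(T)`, which can be any polynomial.
    refine weyl_eq_zero (hP n) fun f hf => ?_
    obtain ⟨T, hT, rfl⟩ := hψ.exists_constantCoeff_eq hf
    have h1 := congrArg (PowerSeries.coeff n) (h T hT)
    rw [coeff_opHom, map_zero, Finset.sum_eq_single (n, 0)] at h1
    · simpa using h1
    · rintro ⟨i, j⟩ hij hne
      rw [Finset.HasAntidiagonal.mem_antidiagonal] at hij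
      simp only at hij
      have : i < n := by
        rcases Nat.eq_zero_or_pos j with rfl | hj
        · exact absurd (by rw [← hij, add_zero]) hne
        · omega
      rw [ih i this]
      simp
    · simp

/-- If `P` commutes with the `Z_A`, then `P (1 · T) = (P 1) · T`, so the value at `1` determines `P`
on all `Ω(T)`. This uniqueness is used to identify left star multiplications. -/
theorem IsLeftInvariantFrame.series_eq (hψ : IsLeftInvariantFrame bs ψ)
    {P Q : PowerSeries (Module.End ℝ (SmoothFn N))} (hP : ∀ n, PowerSeries.coeff n P ∈ weyl N)
    (hQ : ∀ n, PowerSeries.coeff n Q ∈ weyl N)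
    (hPc : ∀ A, P * frameSeries ψ A = frameSeries ψ A * P)
    (hQc : ∀ A, Q * frameSeries ψ A = frameSeries ψ A * Q) (h : opHom N P 1 = opHom N Q 1) :
    P = Q := by
  rw [← sub_eq_zero]
  refine hψ.series_eq_zero (fun n => by rw [map_sub]; exact sub_mem (hP n) (hQ n))
    fun T hT => ?_
  rw [map_sub, LinearMap.sub_apply, opHom_act_of_mem_frameAlg hPc hT,
    opHom_act_of_mem_frameAlg hQc hT, h, sub_self]

theorem coeff_mul_mem_weyl {P Q : PowerSeries (Module.End ℝ (SmoothFn N))}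
    (hP : ∀ n, PowerSeries.coeff n P ∈ weyl N) (hQ : ∀ n, PowerSeries.coeff n Q ∈ weyl N) (n : ℕ) :
    PowerSeries.coeff n (P * Q) ∈ weyl N := by
  rw [PowerSeries.coeff_mul]
  exact sum_mem fun p _ => mul_mem (hP _) (hQ _)

theorem coeff_constSeries_mem_weyl (p : FormalZeta N) (n : ℕ) :
    PowerSeries.coeff n (constSeries p) ∈ weyl N := by
  rw [coeff_constSeries]
  exact constOp_mem_weyl _

/-- All coefficients belong to `V`. -/
def CoeffsIn (V : Submodule ℝ (SmoothFn N)) (f : FormalFn N) : Prop :=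
  ∀ n, PowerSeries.coeff n f ∈ V

section CoeffsIn

variable {V : Submodule ℝ (SmoothFn N)} {f g : FormalFn N}

theorem CoeffsIn.smul (hf : CoeffsIn V f) (r : ℝ⟦X⟧) : CoeffsIn V (r • f) := fun n => by
  rw [coeff_smul_formalFn]
  exact sum_mem fun p _ => V.smul_mem _ (hf _)

theorem CoeffsIn.add (hf : CoeffsIn V f) (hg : CoeffsIn V g) : CoeffsIn V (f + g) := fun n => by
  rw [map_add]
  exact add_mem (hf n) (hg n)

theorem CoeffsIn.C {f : SmoothFn N} (hf : f ∈ V) : CoeffsIn V (PowerSeries.C f) := fun n => by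
  rw [PowerSeries.coeff_C]
  split_ifs
  · exact hf
  · exact zero_mem _

theorem CoeffsIn.opHom (hV : ∀ P ∈ weyl N, ∀ f ∈ V, P f ∈ V)
    {P : PowerSeries (Module.End ℝ (SmoothFn N))} (hf : CoeffsIn V f)
    (hP : ∀ n, PowerSeries.coeff n P ∈ weyl N) : CoeffsIn V (opHom N P f) := fun n => by
  rw [coeff_opHom]
  exact sum_mem fun p _ => hV _ (hP _) _ (hf _)

theorem CoeffsIn.act (hV : ∀ P ∈ weyl N, ∀ f ∈ V, P f ∈ V) (hf : CoeffsIn V f) {T : RightOp N}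
    (hT : T ∈ frameAlg ψ) : CoeffsIn V (RightOp.act f T) := by
  induction hT using Algebra.adjoin_induction generalizing f with
  | mem x hx =>
    obtain ⟨A, rfl⟩ := hx
    rw [act_frameOp]
    exact hf.opHom hV (coeff_frameSeries_mem_weyl ψ A)
  | algebraMap r => rw [RightOp.act_algebraMap]; exact hf.smul r
  | add x y _ _ h1 h2 => rw [RightOp.act_add]; exact (h1 hf).add (h2 hf)
  | mul x y _ _ h1 h2 => rw [RightOp.act_mul]; exact h2 (h1 hf)

end CoeffsIn

/-- All coefficients are polynomial functions. -/
abbrev HasPolyCoeffs (f : FormalFn N) : Prop := CoeffsIn (polyFn N).toSubmodule f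

theorem hasPolyCoeffs_one : HasPolyCoeffs (1 : FormalFn N) := by
  rw [← map_one PowerSeries.C]
  exact CoeffsIn.C (one_mem (polyFn N))

end FrameAlgebra

/-! ### Left star multiplication. -/

section LeftMultiplication

variable {N : ℕ}

theorem sum_antidiagonal_triple_swap {M : Type*} [AddCommMonoid M] (n : ℕ) (F : ℕ → ℕ → ℕ → M) :
    ∑ p ∈ Finset.HasAntidiagonal.antidiagonal n,
      ∑ q ∈ Finset.HasAntidiagonal.antidiagonal p.2, F p.1 q.1 q.2 =
    ∑ p ∈ Finset.HasAntidiagonal.antidiagonal n,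
      ∑ q ∈ Finset.HasAntidiagonal.antidiagonal p.2, F q.1 p.1 q.2 := by
  rw [← sum_antidiagonal_triple, ← sum_antidiagonal_triple n fun a b c => F b a c]
  refine Finset.sum_congr rfl fun p _ => ?_
  rw [← Finset.Nat.sum_antidiagonal_swap]
  rfl

/-- The operator series `g ↦ f ⋆ g` of left star multiplication by `f`. -/
def leftSeries (b : ℕ → Bil N) (f : FormalFn N) : PowerSeries (Module.End ℝ (SmoothFn N)) :=
  PowerSeries.mk fun n => ∑ p ∈ Finset.HasAntidiagonal.antidiagonal n,
    b p.2 (PowerSeries.coeff p.1 f)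

theorem coeff_leftSeries (b : ℕ → Bil N) (f : FormalFn N) (n : ℕ) :
    PowerSeries.coeff n (leftSeries b f) = ∑ p ∈ Finset.HasAntidiagonal.antidiagonal n,
      b p.2 (PowerSeries.coeff p.1 f) := PowerSeries.coeff_mk _ _

theorem continuous_bidiff {β : Bil N} (hβ : β ∈ bidiff N) (f : SmoothFn N) : Continuous (β f) := by
  refine bidiff_induction (p := fun β => Continuous (β f)) (fun P _ Q hQ => ?_) continuous_zero
    (fun _ _ _ _ h1 h2 => h1.add h2) (fun r β _ h => ?_) hβ
  · exact continuous_const.mul (continuous_of_mem_weyl hQ)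
  · have : ⇑((r • β) f) = fun g => algebraMap ℝ (SmoothFn N) r * β f g := by
      funext g
      rw [← Algebra.smul_def]; rfl
    rw [this]
    exact continuous_const.mul h

theorem bidiff_apply_mem_weyl {β : Bil N} (hβ : β ∈ bidiff N) {f : SmoothFn N}
    (hf : f ∈ polyFn N) : β f ∈ weyl N := by
  refine bidiff_induction (p := fun β => β f ∈ weyl N) (fun P hP Q hQ => ?_) (zero_mem _)
    (fun _ _ _ _ h1 h2 => add_mem h1 h2) (fun r β _ h => Subalgebra.smul_mem _ h r) hβ
  exact mul_mem (mulLeft_mem_weyl (weyl_apply_mem_polyFn hP hf)) hQ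

namespace IsStarProduct

variable {ψ : Matrix (Fin N) (Fin N) (FormalZeta N)} {b : ℕ → Bil N}

theorem continuous_coeff_leftSeries (hb : IsStarProduct ψ b) (f : FormalFn N) (n : ℕ) :
    Continuous ⇑(PowerSeries.coeff n (leftSeries b f)) := by
  rw [coeff_leftSeries]
  have : ⇑(∑ p ∈ Finset.HasAntidiagonal.antidiagonal n, b p.2 (PowerSeries.coeff p.1 f)) =
      fun g => ∑ p ∈ Finset.HasAntidiagonal.antidiagonal n, b p.2 (PowerSeries.coeff p.1 f) g := by
    funext g; rw [LinearMap.sum_apply]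
  rw [this]
  exact continuous_finsetSum _ fun p _ => continuous_bidiff (hb.mem_bidiff _) _

theorem coeff_leftSeries_mem_weyl (hb : IsStarProduct ψ b) {f : FormalFn N} (hf : HasPolyCoeffs f) (n : ℕ) :
    PowerSeries.coeff n (leftSeries b f) ∈ weyl N := by
  rw [coeff_leftSeries]
  exact sum_mem fun p _ => bidiff_apply_mem_weyl (hb.mem_bidiff _) (hf _)

/-- This is the axiom `frame`, convolved with the coefficients of `f`. -/
theorem leftSeries_commute (hb : IsStarProduct ψ b) (f : FormalFn N) (A : Fin N) :
    leftSeries b f * frameSeries ψ A = frameSeries ψ A * leftSeries b f := by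
  ext1 n
  rw [PowerSeries.coeff_mul, PowerSeries.coeff_mul]
  simp only [coeff_leftSeries, Finset.sum_mul, Finset.mul_sum]
  rw [sum_antidiagonal_triple n fun l k j =>
      b k (PowerSeries.coeff l f) * PowerSeries.coeff j (frameSeries ψ A),
    sum_antidiagonal_triple_swap n fun j l k =>
      PowerSeries.coeff j (frameSeries ψ A) * b k (PowerSeries.coeff l f)]
  refine Finset.sum_congr rfl fun p _ => ?_
  ext1 g
  have h := hb.frame A p.2 (PowerSeries.coeff p.1 f) g
  rw [← Finset.Nat.sum_antidiagonal_swap] at h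
  simpa [LinearMap.sum_apply] using h

theorem opHom_leftSeries_one (hb : IsStarProduct ψ b) (f : FormalFn N) : opHom N (leftSeries b f) 1 = f := by
  ext1 n
  rw [← map_one PowerSeries.C, coeff_opHom_C, coeff_leftSeries, LinearMap.sum_apply,
    Finset.sum_eq_single (n, 0)]
  · simp [hb.zero]
  · rintro ⟨i, j⟩ hij hne
    rcases j with _ | j
    · rw [Finset.HasAntidiagonal.mem_antidiagonal] at hij
      simp only [add_zero] at hij
      exact absurd (by rw [hij]) hne
    · exact hb.succ_one _ _
  · simp

/-- Elements of the completed algebra act by star multiplication. -/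
theorem act_eq (hb : IsStarProduct ψ b) {T : RightOp N} (hT : T ∈ QuantumFn ψ) (f : FormalFn N) :
    RightOp.act f T = opHom N (leftSeries b f) (RightOp.act 1 T) := by
  -- Left multiplication by `f` commutes with `T` and sends `1` to `f`.
  rw [opHom_act_of_mem_quantumFn (hb.leftSeries_commute f) (hb.continuous_coeff_leftSeries f) hT,
    hb.opHom_leftSeries_one]

end IsStarProduct

end LeftMultiplication
end

/-! ### The adjoint representation, the modular function and right-invariant fields. -/

noncomputable section

open SmoothFn

section LieData

variable {N : ℕ} {𝔤 : Type*} [LieRing 𝔤] [LieAlgebra ℝ 𝔤] (bs : Module.Basis (Fin N) ℝ 𝔤)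

/-- The matrix of `ad ẑ_A`. -/
def adMatrix (A : Fin N) : Matrix (Fin N) (Fin N) ℝ :=
  LinearMap.toMatrix bs bs (LieAlgebra.ad ℝ 𝔤 (bs A))

theorem adMatrix_apply (A B C : Fin N) : adMatrix bs A C B = structConst bs A B C := by
  rw [adMatrix, LinearMap.toMatrix_apply, LieAlgebra.ad_apply, structConst]

theorem adMatrix_commutator (A B : Fin N) :
    adMatrix bs A * adMatrix bs B - adMatrix bs B * adMatrix bs A =
      ∑ C, structConst bs A B C • adMatrix bs C := by
  have h : ⁅bs A, bs B⁆ = ∑ C, structConst bs A B C • bs C := (bs.sum_repr _).symm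
  simp only [adMatrix, ← LinearMap.toMatrix_mul, ← map_sub, ← map_smul, ← map_sum]
  congr 1
  refine LinearMap.ext fun x => ?_
  simp only [LinearMap.sub_apply, Module.End.mul_apply, LieAlgebra.ad_apply]
  rw [← lie_lie, h]

theorem trace_adMatrix (A : Fin N) : (adMatrix bs A).trace = traceConst bs A := by
  simp [Matrix.trace, adMatrix_apply, traceConst]

/-- The trace of a commutator of `ad` matrices is zero, so `c` is a character of the Lie algebra.
This is the integrability condition for the modular function. -/
theorem sum_structConst_mul_traceConst (A B : Fin N) :
    ∑ C, structConst bs A B C * traceConst bs C = 0 := by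
  have h := congrArg Matrix.trace (adMatrix_commutator bs A B)
  rw [Matrix.trace_sub, Matrix.trace_mul_comm, sub_self, Matrix.trace_sum] at h
  simpa [Matrix.trace_smul, trace_adMatrix] using h.symm

end LieData

section Modular

variable {N : ℕ} {ψ : Matrix (Fin N) (Fin N) (FormalZeta N)} {𝔤 : Type*} [LieRing 𝔤]
  [LieAlgebra ℝ 𝔤] {bs : Module.Basis (Fin N) ℝ 𝔤}

/-- Commuting `r(∂)` past `Z_A` differentiates the symbol `r` along the vector field `Z_A`. -/
theorem constSeries_mul_frameSeries (r : FormalZeta N) (A : Fin N) :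
    constSeries r * frameSeries ψ A =
      frameSeries ψ A * constSeries r + constSeries (∑ B, ψ A B * zetaDeriv B r) := by
  simp only [frameSeries, Finset.mul_sum, Finset.sum_mul, map_sum, ← Finset.sum_add_distrib]
  refine Finset.sum_congr rfl fun B _ => ?_
  rw [← mul_assoc, constSeries_mul_C_mulCoord, add_mul, mul_assoc, mul_assoc, ← map_mul, ← map_mul,
    ← map_mul, mul_comm r, mul_comm (zetaDeriv B r)]

theorem opHom_constSeries_one (p : FormalZeta N) :
    opHom N (constSeries p) 1 = PowerSeries.map MvPolynomial.constantCoeff p • (1 : FormalFn N) := by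
  ext1 n
  rw [← map_one PowerSeries.C, coeff_opHom_C, coeff_constSeries, constOp_one, map_one,
    Algebra.smul_def, mul_one, PowerSeries.algebraMap_apply'', PowerSeries.coeff_map,
    PowerSeries.coeff_map]

/-- The modular function: a unit `s` of the algebra of formal functions on the group with `s(0) = 1`
and `Z_A s = λ c_A s`. -/
theorem IsLeftInvariantFrame.exists_modular (hψ : IsLeftInvariantFrame bs ψ) :
    ∃ s t : FormalZeta N, s * t = 1 ∧ PowerSeries.map MvPolynomial.constantCoeff s = 1 ∧
      ∀ A, ∑ B, ψ A B * zetaDeriv B s = PowerSeries.X * (traceConst bs A • s) := by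
  -- A flat section of the one-dimensional representation `A ↦ -c_A`, the sign being that of the
  -- flatness equation `Z_A r + λ ρ_A r = 0`.
  obtain ⟨r, hr0, hr1, hr⟩ := hψ.exists_flat (ι := Unit)
    (fun A => Matrix.of fun _ _ => -traceConst bs A)
    (fun A B => by
      ext i j
      have := sum_structConst_mul_traceConst bs A B
      simp [Matrix.mul_apply, Matrix.sum_apply, this, mul_comm (traceConst bs A)]) 1
  have hu : IsUnit (r ()) := by
    rw [PowerSeries.isUnit_iff_constantCoeff, hr0]
    simp
  obtain ⟨t, ht⟩ := hu.exists_right_inv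
  refine ⟨r (), t, ht, by simpa using hr1 (), fun A => ?_⟩
  have h := hr A ()
  simp only [Matrix.of_apply, Finset.univ_unique, Finset.sum_singleton, neg_smul, mul_neg] at h
  exact add_neg_eq_zero.1 h

/-- The right-invariant vector fields, in terms of the left-invariant ones and the adjoint
representation of the group. -/
theorem IsLeftInvariantFrame.exists_rightInvariant (hψ : IsLeftInvariantFrame bs ψ) (A : Fin N) :
    ∃ r : Fin N → FormalZeta N,
      (∀ B, PowerSeries.map MvPolynomial.constantCoeff (r B) = if B = A then 1 else 0) ∧
      (∀ C B, PowerSeries.map MvPolynomial.constantCoeff (zetaDeriv C (r B)) =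
        -(PowerSeries.X * PowerSeries.C (structConst bs C A B))) ∧
      ∀ C, (∑ B, frameSeries ψ B * constSeries (r B)) * frameSeries ψ C =
        frameSeries ψ C * ∑ B, frameSeries ψ B * constSeries (r B) := by
  obtain ⟨r, -, hr1, hr⟩ := hψ.exists_flat (adMatrix bs) (adMatrix_commutator bs) (Pi.single A 1)
  have hr1' : ∀ B, PowerSeries.map MvPolynomial.constantCoeff (r B) = if B = A then 1 else 0 := by
    intro B
    rw [hr1, Pi.single_apply]
    split_ifs <;> simp
  refine ⟨r, hr1', fun C B => ?_, fun C => ?_⟩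
  -- The flatness equation at `ζ = 0`, where `ψ` is the identity matrix, gives the first derivatives
  -- of `r`.
  · have h := congrArg (PowerSeries.map MvPolynomial.constantCoeff) (hr C B)
    have hs : ∀ (c : ℝ) (p : FormalZeta N), PowerSeries.map MvPolynomial.constantCoeff (c • p) =
        PowerSeries.C c * PowerSeries.map MvPolynomial.constantCoeff p := by
      intro c p
      ext1 n
      rw [PowerSeries.coeff_C_mul, PowerSeries.coeff_map, PowerSeries.coeff_map]
      change MvPolynomial.constantCoeff (c • PowerSeries.coeff n p) = _
      rw [MvPolynomial.constantCoeff_smul, smul_eq_mul]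
    simp only [map_add, map_sum, map_mul, hψ.counit, PowerSeries.map_X, hs, hr1', ite_mul, one_mul,
      zero_mul, mul_ite, mul_one, mul_zero, Finset.sum_ite_eq, Finset.sum_ite_eq', Finset.mem_univ,
      if_true, adMatrix_apply, map_zero] at h
    exact eq_neg_of_add_eq_zero_left h
  · have h1 : ∀ B, constSeries (r B) * frameSeries ψ C = frameSeries ψ C * constSeries (r B) -
        PowerSeries.X * ∑ E, structConst bs C E B • constSeries (r E) := by
      intro B
      rw [constSeries_mul_frameSeries, eq_neg_of_add_eq_zero_left (hr C B), map_neg, map_mul,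
        constSeries_X, map_sum, sub_eq_add_neg]
      simp only [constSeries_smul, adMatrix_apply]
    have h2 : ∀ B, frameSeries ψ B * frameSeries ψ C = frameSeries ψ C * frameSeries ψ B +
        PowerSeries.X * ∑ E, structConst bs C B E • frameSeries ψ E := fun B => by
      rw [← hψ.frameSeries_commutator]; abel
    rw [Finset.sum_mul, Finset.mul_sum, ← sub_eq_zero, ← Finset.sum_sub_distrib]
    -- One sum comes from the commutator of the frame fields, the other from differentiating `r`.
    -- After summation over `B` they cancel by exchanging `B` and `E`.
    have h3 : ∀ B, frameSeries ψ B * constSeries (r B) * frameSeries ψ C -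
        frameSeries ψ C * (frameSeries ψ B * constSeries (r B)) =
        PowerSeries.X * (∑ E, structConst bs C B E • (frameSeries ψ E * constSeries (r B)) -
          ∑ E, structConst bs C E B • (frameSeries ψ B * constSeries (r E))) := by
      intro B
      rw [mul_assoc, h1, mul_sub, ← mul_assoc, h2, add_mul, ← mul_assoc (frameSeries ψ B),
        (PowerSeries.commute_X (frameSeries ψ B)).eq, mul_assoc, mul_assoc PowerSeries.X,
        mul_assoc PowerSeries.X]
      simp only [Finset.sum_mul, Finset.mul_sum, mul_sub, smul_mul_assoc, mul_smul_comm]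
      abel
    simp only [h3, ← Finset.mul_sum, Finset.sum_sub_distrib]
    rw [Finset.sum_comm, sub_self, mul_zero]

/-- Both series commute with all `Z_C` and send `1` to `z_A`, so `series_eq` identifies them: left
multiplication by a coordinate is a right-invariant field. -/
theorem IsStarProduct.leftSeries_coord {b : ℕ → Bil N} (hb : IsStarProduct ψ b)
    (hψ : IsLeftInvariantFrame bs ψ) {A : Fin N} {r : Fin N → FormalZeta N}
    (hr : ∀ B, PowerSeries.map MvPolynomial.constantCoeff (r B) = if B = A then 1 else 0)
    (hc : ∀ C, (∑ B, frameSeries ψ B * constSeries (r B)) * frameSeries ψ C =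
      frameSeries ψ C * ∑ B, frameSeries ψ B * constSeries (r B)) :
    leftSeries b (PowerSeries.C (coord A)) = ∑ B, frameSeries ψ B * constSeries (r B) := by
  refine hψ.series_eq (hb.coeff_leftSeries_mem_weyl (CoeffsIn.C (coord_mem_polyFn A)))
    (fun n => ?_) (hb.leftSeries_commute _) hc ?_
  · rw [map_sum]
    exact sum_mem fun B _ => coeff_mul_mem_weyl (coeff_frameSeries_mem_weyl ψ B)
      (coeff_constSeries_mem_weyl _) n
  · rw [hb.opHom_leftSeries_one, map_sum, LinearMap.sum_apply, Finset.sum_eq_single A]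
    · rw [map_mul, Module.End.mul_apply, opHom_constSeries_one, hr, if_pos rfl, one_smul,
        hψ.opHom_frameSeries_one]
    · intro B _ hBA
      rw [map_mul, Module.End.mul_apply, opHom_constSeries_one, hr, if_neg hBA, zero_smul, map_zero]
    · simp

end Modular

/-! ### The translation by `λ c` as conjugation by the modular function. -/

section Translation

variable {N : ℕ} {ψ : Matrix (Fin N) (Fin N) (FormalZeta N)}

/-- Two translations agree on the generators, hence on a dense subalgebra, hence everywhere by
continuity. -/
theorem IsTranslation.unique {a : Fin N → ℝ⟦X⟧} {K K' : QuantumFn ψ →ₐ[ℝ⟦X⟧] QuantumFn ψ}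
    (hK : IsTranslation a K) (hK' : IsTranslation a K') : K = K' := by
  have hcl : IsClosed {x : QuantumFn ψ | K x = K' x} := isClosed_eq hK.1 hK'.1
  have hgen : ∀ T (hT : T ∈ frameAlg ψ), K ⟨T, subset_closure hT⟩ = K' ⟨T, subset_closure hT⟩ := by
    intro T hT
    induction hT using Algebra.adjoin_induction with
    | mem x hx => obtain ⟨A, rfl⟩ := hx; exact (hK.2 A).trans (hK'.2 A).symm
    | algebraMap r => exact (K.commutes r).trans (K'.commutes r).symm
    | add x y hx hy h1 h2 =>
      exact (map_add K ⟨x, subset_closure hx⟩ ⟨y, subset_closure hy⟩).trans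
        ((congrArg₂ _ h1 h2).trans (map_add K' _ _).symm)
    | mul x y hx hy h1 h2 =>
      exact (map_mul K ⟨x, subset_closure hx⟩ ⟨y, subset_closure hy⟩).trans
        ((congrArg₂ _ h1 h2).trans (map_mul K' _ _).symm)
  refine AlgHom.ext fun x => ?_
  have hx : x ∈ closure {x : QuantumFn ψ | (x : RightOp N) ∈ frameAlg ψ} := by
    rw [closure_subtype]
    refine closure_mono ?_ x.2
    intro T hT
    exact ⟨⟨T, subset_closure hT⟩, hT, rfl⟩
  exact closure_minimal (s := {x : QuantumFn ψ | (x : RightOp N) ∈ frameAlg ψ})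
    (fun y hy => hgen y hy) hcl hx

/-- Conjugation by an invertible element, as an algebra endomorphism. -/
def conjHom {R A : Type*} [CommRing R] [Ring A] [Algebra R A] (u v : A) (huv : u * v = 1)
    (hvu : v * u = 1) : A →ₐ[R] A where
  toFun x := v * x * u
  map_one' := by rw [mul_one, hvu]
  map_mul' x y := by
    rw [mul_assoc v x u, mul_assoc v (x * u), ← mul_assoc (x * u), ← mul_assoc (x * u),
      mul_assoc x u v, huv, mul_one]
    noncomm_ring
  map_zero' := by simp
  map_add' x y := by rw [mul_add, add_mul]
  commutes' r := by rw [← Algebra.commutes, mul_assoc, hvu, mul_one]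

variable {𝔤 : Type*} [LieRing 𝔤] [LieAlgebra ℝ 𝔤] {bs : Module.Basis (Fin N) ℝ 𝔤}

/-- In operators, `s Z_A s⁻¹ = Z_A + (Z_A s) s⁻¹ = Z_A + λ c_A`. -/
theorem conj_frameOp {s t : FormalZeta N} (hst : s * t = 1)
    (hs : ∀ A, ∑ B, ψ A B * zetaDeriv B s = PowerSeries.X * (traceConst bs A • s)) (A : Fin N)
    (f : FormalFn N) : opHom N (constSeries s) (opHom N (frameSeries ψ A)
      (opHom N (constSeries t) f)) = opHom N (frameSeries ψ A) f +
        (PowerSeries.X * PowerSeries.C (traceConst bs A) : ℝ⟦X⟧) • f := by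
  have h : constSeries s * frameSeries ψ A * constSeries t =
      frameSeries ψ A + PowerSeries.X * (traceConst bs A • 1) := by
    rw [constSeries_mul_frameSeries, hs, add_mul, mul_assoc, ← map_mul, ← map_mul, hst, map_one,
      mul_one, mul_assoc, smul_mul_assoc, hst, map_mul, constSeries_X, constSeries_smul, map_one]
  rw [← Module.End.mul_apply, ← Module.End.mul_apply, ← map_mul, ← map_mul, h, map_add,
    LinearMap.add_apply, map_mul, Module.End.mul_apply, opHom_X, opHom_smul, map_one,
    Module.End.one_apply, mul_smul, C_smul_formalFn]

/-- The translation by `λ c` is conjugation by the modular function. -/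
theorem exists_translation {s t : FormalZeta N} (hst : s * t = 1)
    (ht1 : PowerSeries.map MvPolynomial.constantCoeff s = 1)
    (hs : ∀ A, ∑ B, ψ A B * zetaDeriv B s = PowerSeries.X * (traceConst bs A • s)) :
    ∃ K : QuantumFn ψ →ₐ[ℝ⟦X⟧] QuantumFn ψ,
      IsTranslation (fun A => PowerSeries.X * PowerSeries.C (traceConst bs A)) K ∧
      ∀ x, Omega (K x) = opHom N (constSeries s) (Omega x) := by
  have hcont : ∀ (p : FormalZeta N) (n : ℕ), Continuous ⇑(PowerSeries.coeff n (constSeries p)) :=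
    fun p n => continuous_of_mem_weyl (coeff_constSeries_mem_weyl p n)
  have hinv : ∀ p q : FormalZeta N, p * q = 1 → RightOp.ofSeries (constSeries p) (hcont p) *
      RightOp.ofSeries (constSeries q) (hcont q) = 1 := by
    intro p q hpq
    refine RightOp.ext_act fun f => ?_
    rw [RightOp.act_mul, RightOp.act_ofSeries, RightOp.act_ofSeries, ← Module.End.mul_apply,
      ← map_mul, ← map_mul, mul_comm, hpq, map_one, map_one]
    rfl
  set K₀ : RightOp N →ₐ[ℝ⟦X⟧] RightOp N := conjHom (RightOp.ofSeries (constSeries s) (hcont s))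
    (RightOp.ofSeries (constSeries t) (hcont t)) (hinv s t hst) (hinv t s (by rw [mul_comm, hst]))
    with hK₀
  have hact : ∀ x f, RightOp.act f (K₀ x) =
      opHom N (constSeries s) (RightOp.act (opHom N (constSeries t) f) x) := fun x f => rfl
  have hK₀c : Continuous K₀ :=
    (continuous_mul_const _).comp (continuous_const_mul (RightOp.ofSeries (constSeries t) (hcont t)))
  have hgen : ∀ A, K₀ (frameOp ψ A) = frameOp ψ A +
      algebraMap ℝ⟦X⟧ (RightOp N) (PowerSeries.X * PowerSeries.C (traceConst bs A)) := by
    intro A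
    refine RightOp.ext_act fun f => ?_
    rw [hact, act_frameOp, conj_frameOp hst hs, RightOp.act_add, act_frameOp,
      RightOp.act_algebraMap]
  have hfr : ∀ T ∈ frameAlg ψ, K₀ T ∈ frameAlg ψ := by
    intro T hT
    induction hT using Algebra.adjoin_induction with
    | mem x hx =>
      obtain ⟨A, rfl⟩ := hx
      rw [hgen]
      exact add_mem (Algebra.subset_adjoin ⟨A, rfl⟩) (Subalgebra.algebraMap_mem _ _)
    | algebraMap r => rw [AlgHom.commutes]; exact Subalgebra.algebraMap_mem _ _
    | add x y _ _ h1 h2 => rw [map_add]; exact add_mem h1 h2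
    | mul x y _ _ h1 h2 => rw [map_mul]; exact mul_mem h1 h2
  have hq : ∀ T ∈ QuantumFn ψ, K₀ T ∈ QuantumFn ψ := fun T hT =>
    map_mem_closure hK₀c hT hfr
  let K : QuantumFn ψ →ₐ[ℝ⟦X⟧] QuantumFn ψ :=
    (K₀.comp (QuantumFn ψ).val).codRestrict (QuantumFn ψ) fun x => hq x x.2
  have hK : ∀ x, (K x : RightOp N) = K₀ x := fun x => rfl
  refine ⟨K, ⟨(hK₀c.comp continuous_subtype_val).subtype_mk _, fun A => Subtype.ext (hgen A)⟩,
    fun x => ?_⟩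
  -- Conjugation applies `t(∂)` first and `s(∂)` last. Since `t(0) = 1`, the first factor is
  -- invisible on `1`, so only `s(∂)` remains after applying `Ω`.
  have h1 : opHom N (constSeries t) 1 = 1 := by
    have h2 : PowerSeries.map MvPolynomial.constantCoeff t = (1 : ℝ⟦X⟧) := by
      have := congrArg (PowerSeries.map MvPolynomial.constantCoeff) hst
      rwa [map_mul, ht1, one_mul, map_one] at this
    rw [opHom_constSeries_one, h2, one_smul]
  rw [Omega, RightOp.omega, hK, hact, h1]
  rfl

end Translation
end

/-! ### Integration by parts for differential and bidifferential operators. -/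

noncomputable section

open SmoothFn MeasureTheory

section Integration

variable {N : ℕ}

/-- All products of a polynomial and of iterated partial derivatives of `f` and `g` are integrable. -/
def IntegrableProducts (f g : SmoothFn N) : Prop :=
  ∀ (v w : List (Fin N)) (p : MvPolynomial (Fin N) ℝ),
    Integrable fun z : Fin N → ℝ => MvPolynomial.eval z p * partials v f z * partials w g z

theorem IntegrableProducts.symm {f g : SmoothFn N} (h : IntegrableProducts f g) :
    IntegrableProducts g f := fun v w p => by
  simpa only [mul_right_comm] using h w v p

/-- Allowing all polynomial weights and all derivatives makes the condition stable: a factor `z_A`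
joins the weight, up to commutators that are combinations of shorter derivatives. -/
theorem IntegrableProducts.right {f g : SmoothFn N} (h : IntegrableProducts f g)
    {P : Module.End ℝ (SmoothFn N)} (hP : P ∈ weyl N) : IntegrableProducts f (P g) := by
  refine weyl_induction (p := fun P => ∀ g, IntegrableProducts f g → IntegrableProducts f (P g))
    (fun A g h v w p => ?_) (fun A g h v w p => ?_) (fun r g h v w p => ?_)
    (fun P Q _ _ h1 h2 g h v w p => ?_) (fun P Q _ _ h1 h2 g h => h1 _ (h2 _ h)) hP g h
  · have h1 : partials w (mulCoord A g) = coord A * partials w g +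
        (partials w * mulCoord A - mulCoord A * partials w) g := by
      simp
    have h2 : ∀ T ∈ Submodule.span ℝ {P | ∃ u : List (Fin N), u.length + 1 = w.length ∧
        P = partials u},
        Integrable fun z : Fin N → ℝ => MvPolynomial.eval z p * partials v f z * T g z := by
      intro T hT
      induction hT using Submodule.span_induction with
      | mem x hx => obtain ⟨u, -, rfl⟩ := hx; exact h v u p
      | zero =>
        have : (fun z : Fin N → ℝ => MvPolynomial.eval z p * partials v f z *
            (0 : Module.End ℝ (SmoothFn N)) g z) = fun _ => 0 := by
          funext z; exact mul_zero _
        rw [this]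
        exact integrable_zero _ _ _
      | add x y _ _ h1 h2 =>
        refine (h1.add h2).congr (Filter.Eventually.of_forall fun z => ?_)
        exact (mul_add _ _ _).symm
      | smul r x _ h1 =>
        refine (h1.const_mul r).congr (Filter.Eventually.of_forall fun z => ?_)
        exact mul_left_comm _ _ _
    refine ((h v w (MvPolynomial.X A * p)).add (h2 _ (commutator_partials_mem w A))).congr
      (Filter.Eventually.of_forall fun z => ?_)
    change _ = _ * _ * (partials w (mulCoord A g)) z
    rw [h1, SmoothFn.add_apply, SmoothFn.mul_apply]
    simp only [Pi.add_apply, map_mul, MvPolynomial.eval_X]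
    change _ = _ * (z A * _ + _)
    ring
  · have h1 : partials w (partialDeriv A g) = partials (w ++ [A]) g := by
      rw [partials_append_singleton]; rfl
    rw [h1]
    exact h v (w ++ [A]) p
  · refine ((h v w p).const_mul r).congr (Filter.Eventually.of_forall fun z => ?_)
    have : partials w (algebraMap ℝ (Module.End ℝ (SmoothFn N)) r g) = r • partials w g :=
      by rw [Module.algebraMap_end_apply, map_smul]
    rw [this]
    exact mul_left_comm _ _ _
  · refine ((h1 g h v w p).add (h2 g h v w p)).congr (Filter.Eventually.of_forall fun z => ?_)
    rw [LinearMap.add_apply, map_add]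
    exact (mul_add _ _ _).symm

theorem IntegrableProducts.left {f g : SmoothFn N} (h : IntegrableProducts f g)
    {P : Module.End ℝ (SmoothFn N)} (hP : P ∈ weyl N) : IntegrableProducts (P f) g :=
  (h.symm.right hP).symm

theorem IntegrableProducts.integrable_mul {f g : SmoothFn N} (h : IntegrableProducts f g) :
    Integrable fun z : Fin N → ℝ => (f * g) z := by
  simpa [partials] using h [] [] 1

theorem IntegrableProducts.integrable_bidiff {f g : SmoothFn N} (h : IntegrableProducts f g)
    {β : Bil N} (hβ : β ∈ bidiff N) : Integrable fun z : Fin N → ℝ => β f g z :=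
  bidiff_induction (p := fun β => Integrable (fun z : Fin N → ℝ => β f g z) volume)
    (fun _ hP _ hQ => ((h.left hP).right hQ).integrable_mul) (integrable_zero (Fin N → ℝ) ℝ volume)
    (fun _ _ _ _ h1 h2 => h1.add h2) (fun r _ _ h1 => h1.const_mul r) hβ

/-- There is no boundary term because the product and both differentiated products are integrable.
-/
theorem IntegrableProducts.integral_partialDeriv {f g : SmoothFn N} (h : IntegrableProducts f g)
    (A : Fin N) : ∫ z : Fin N → ℝ, (partialDeriv A f * g) z =
      -∫ z : Fin N → ℝ, (f * partialDeriv A g) z := by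
  have h1 := (h.left (partialDeriv_mem_weyl A)).integrable_mul
  have h2 := (h.right (partialDeriv_mem_weyl A)).integrable_mul
  have h3 := integral_mul_fderiv_eq_neg_fderiv_mul_of_integrable (μ := volume)
    (v := (Pi.single A 1 : Fin N → ℝ)) h1 h2 h.integrable_mul
    (fun x _ => f.contDiff.differentiable (by simp) x)
    (fun x _ => g.contDiff.differentiable (by simp) x)
  exact (neg_eq_iff_eq_neg.2 h3).symm

/-- The formal adjoint of a differential operator. -/
theorem exists_adjoint {P : Module.End ℝ (SmoothFn N)} (hP : P ∈ weyl N) :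
    ∃ Q ∈ weyl N, ∀ f g, IntegrableProducts f g →
      ∫ z : Fin N → ℝ, (P f * g) z = ∫ z : Fin N → ℝ, (f * Q g) z := by
  refine weyl_induction (p := fun P => ∃ Q ∈ weyl N, ∀ f g, IntegrableProducts f g →
      ∫ z : Fin N → ℝ, (P f * g) z = ∫ z : Fin N → ℝ, (f * Q g) z)
    (fun A => ⟨mulCoord A, mulCoord_mem_weyl A, fun f g _ => ?_⟩)
    (fun A => ⟨-partialDeriv A, neg_mem (partialDeriv_mem_weyl A), fun f g h => ?_⟩)
    (fun r => ⟨algebraMap ℝ _ r, Subalgebra.algebraMap_mem _ r, fun f g _ => ?_⟩) ?_ ?_ hP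
  · rw [mulCoord_apply, mulCoord_apply, mul_left_comm, mul_assoc]
  · have h1 : f * (-partialDeriv A) g = -(f * partialDeriv A g) := by
      rw [LinearMap.neg_apply, mul_neg]
    rw [h.integral_partialDeriv, h1, ← integral_neg]
    rfl
  · rw [Module.algebraMap_end_apply, Module.algebraMap_end_apply, smul_mul_assoc, mul_smul_comm]
  · rintro P₁ P₂ hP₁ hP₂ ⟨Q₁, hQ₁, h1⟩ ⟨Q₂, hQ₂, h2⟩
    refine ⟨Q₁ + Q₂, add_mem hQ₁ hQ₂, fun f g h => ?_⟩
    rw [LinearMap.add_apply, LinearMap.add_apply, add_mul, mul_add]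
    simp only [SmoothFn.add_apply]
    rw [integral_add (h.left hP₁).integrable_mul (h.left hP₂).integrable_mul,
      integral_add (h.right hQ₁).integrable_mul (h.right hQ₂).integrable_mul, h1 f g h, h2 f g h]
  · rintro P₁ P₂ hP₁ hP₂ ⟨Q₁, hQ₁, h1⟩ ⟨Q₂, hQ₂, h2⟩
    refine ⟨Q₂ * Q₁, mul_mem hQ₂ hQ₁, fun f g h => ?_⟩
    rw [Module.End.mul_apply, Module.End.mul_apply, h1 _ g (h.left hP₂), h2 f _ (h.right hQ₁)]

/-- The operator on the first argument is moved to the second by its formal adjoint, so a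
bidifferential operator under the integral is one operator acting on `g`. -/
theorem exists_transpose {β : Bil N} (hβ : β ∈ bidiff N) :
    ∃ D ∈ weyl N, ∀ f g, IntegrableProducts f g →
      ∫ z : Fin N → ℝ, β f g z = ∫ z : Fin N → ℝ, (f * D g) z := by
  refine bidiff_induction (p := fun β => ∃ D ∈ weyl N, ∀ f g, IntegrableProducts f g →
      ∫ z : Fin N → ℝ, β f g z = ∫ z : Fin N → ℝ, (f * D g) z) (fun P hP Q hQ => ?_)
      ⟨0, zero_mem _, fun f g _ => by simp⟩ ?_ ?_ hβ
  · obtain ⟨R, hR, h⟩ := exists_adjoint hP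
    exact ⟨R * Q, mul_mem hR hQ, fun f g hfg => h f (Q g) (hfg.right hQ)⟩
  · rintro β γ hβ hγ ⟨D, hD, h1⟩ ⟨E, hE, h2⟩
    refine ⟨D + E, add_mem hD hE, fun f g h => ?_⟩
    rw [LinearMap.add_apply, LinearMap.add_apply, LinearMap.add_apply, mul_add]
    refine (integral_add (h.integrable_bidiff hβ) (h.integrable_bidiff hγ)).trans ?_
    rw [h1 f g h, h2 f g h]
    exact (integral_add (h.right hD).integrable_mul (h.right hE).integrable_mul).symm
  · rintro r β hβ ⟨D, hD, h1⟩
    refine ⟨r • D, Subalgebra.smul_mem _ hD r, fun f g h => ?_⟩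
    rw [LinearMap.smul_apply, LinearMap.smul_apply, LinearMap.smul_apply, mul_smul_comm]
    refine (integral_const_mul r _).trans ?_
    rw [h1 f g h]
    exact (integral_const_mul r _).symm

/-- Smooth functions with compact support. -/
def compactFn (N : ℕ) : Submodule ℝ (SmoothFn N) where
  carrier := {f | HasCompactSupport (f : (Fin N → ℝ) → ℝ)}
  add_mem' hf hg := HasCompactSupport.add hf hg
  zero_mem' := HasCompactSupport.zero
  smul_mem' r _ hf := HasCompactSupport.smul_left (f := fun _ => r) hf

theorem weyl_apply_mem_compactFn {P : Module.End ℝ (SmoothFn N)} (hP : P ∈ weyl N) {f : SmoothFn N}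
    (hf : f ∈ compactFn N) : P f ∈ compactFn N :=
  weyl_induction (p := fun P => ∀ f ∈ compactFn N, P f ∈ compactFn N)
    (fun _ _ hf => HasCompactSupport.mul_left hf)
    (fun A _ hf => HasCompactSupport.fderiv_apply ℝ hf (Pi.single A 1))
    (fun r _ hf => Submodule.smul_mem _ r hf)
    (fun _ _ _ _ h1 h2 f hf => add_mem (h1 f hf) (h2 f hf))
    (fun _ _ _ _ h1 h2 f hf => h1 _ (h2 f hf)) hP f hf

theorem integrable_of_mem_compactFn {f : SmoothFn N} (hf : f ∈ compactFn N) :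
    Integrable fun z : Fin N → ℝ => f z :=
  f.contDiff.continuous.integrable_of_hasCompactSupport hf

theorem integrableProducts_of_mem_compactFn {f : SmoothFn N} (hf : f ∈ compactFn N)
    (g : SmoothFn N) : IntegrableProducts f g := by
  intro v w p
  have h1 : HasCompactSupport (partials v f : (Fin N → ℝ) → ℝ) :=
    weyl_apply_mem_compactFn (partials_mem_weyl v) hf
  refine Continuous.integrable_of_hasCompactSupport ?_ ?_
  · exact ((MvPolynomial.continuous_eval p).mul (partials v f).contDiff.continuous).mul
      (partials w g).contDiff.continuous
  · exact HasCompactSupport.mul_right (HasCompactSupport.mul_left h1)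

/-- A derivative of a compactly supported function integrates to zero, as one sees by integrating by
parts against `1`; only the constant term of `p` remains. -/
theorem integral_constOp (p : MvPolynomial (Fin N) ℝ) {f : SmoothFn N} (hf : f ∈ compactFn N) :
    ∫ z : Fin N → ℝ, constOp p f z = MvPolynomial.constantCoeff p * ∫ z : Fin N → ℝ, f z := by
  induction p using MvPolynomial.induction_on generalizing f with
  | C r =>
    rw [constOp_C, Module.algebraMap_end_apply, MvPolynomial.constantCoeff_C, ← integral_const_mul]
    rfl
  | add p q hp hq =>
    rw [map_add, map_add, add_mul, ← hp hf, ← hq hf, ← integral_add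
      (integrable_of_mem_compactFn (weyl_apply_mem_compactFn (constOp_mem_weyl p) hf))
      (integrable_of_mem_compactFn (weyl_apply_mem_compactFn (constOp_mem_weyl q) hf))]
    rfl
  | mul_X p A hp =>
    have h1 := (integrableProducts_of_mem_compactFn hf 1).integral_partialDeriv A
    rw [mul_one, partialDeriv_one, mul_zero] at h1
    have h2 : ∫ z : Fin N → ℝ, (0 : SmoothFn N) z = 0 := integral_zero _ _
    rw [h2, neg_zero] at h1
    rw [map_mul, constOp_X, Module.End.mul_apply,
      hp (weyl_apply_mem_compactFn (partialDeriv_mem_weyl A) hf), h1]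
    simp

/-- The fundamental lemma of the calculus of variations, with continuity removing the exceptional
null set. -/
theorem eq_zero_of_integral_compactFn {f : SmoothFn N}
    (h : ∀ g ∈ compactFn N, ∫ z : Fin N → ℝ, (g * f) z = 0) : f = 0 := by
  have h1 := ae_eq_zero_of_integral_contDiff_smul_eq_zero (μ := (volume : Measure (Fin N → ℝ)))
    f.contDiff.continuous.locallyIntegrable fun g hg hc => h ⟨g, hg⟩ hc
  have h2 := (Continuous.ae_eq_iff_eq volume f.contDiff.continuous continuous_zero).1 h1
  exact SmoothFn.ext fun z => congrFun h2 z

end Integration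

/-! ### Coefficientwise integrals of formal series. -/

section FormalIntegration

variable {N : ℕ}

theorem coeff_formalIntegral (f : FormalFn N) (n : ℕ) :
    PowerSeries.coeff n (formalIntegral f) = ∫ z : Fin N → ℝ, PowerSeries.coeff n f z :=
  PowerSeries.coeff_mk _ _

theorem integrable_finset_sum_apply {ι : Type*} (s : Finset ι) {f : ι → SmoothFn N}
    (hf : ∀ i ∈ s, Integrable fun z : Fin N → ℝ => f i z) :
    (Integrable fun z : Fin N → ℝ => (∑ i ∈ s, f i) z) ∧
      ∫ z : Fin N → ℝ, (∑ i ∈ s, f i) z = ∑ i ∈ s, ∫ z : Fin N → ℝ, f i z := by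
  have h : ∀ z : Fin N → ℝ, (∑ i ∈ s, f i) z = ∑ i ∈ s, f i z := by
    classical
    intro z
    induction s using Finset.induction_on with
    | empty => rfl
    | insert i s hi ih =>
      rw [Finset.sum_insert hi, Finset.sum_insert hi, SmoothFn.add_apply,
        ih fun j hj => hf j (Finset.mem_insert_of_mem hj)]
  simp only [h]
  exact ⟨integrable_finsetSum s hf, integral_finsetSum s hf⟩

theorem CoeffsIn.formalIntegrable {f : FormalFn N} (hf : CoeffsIn (compactFn N) f) :
    FormalIntegrable f := fun n => integrable_of_mem_compactFn (hf n)

theorem FormalIntegrable.formalIntegral_add {f g : FormalFn N} (hf : FormalIntegrable f)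
    (hg : FormalIntegrable g) :
    formalIntegral (f + g) = formalIntegral f + formalIntegral g := by
  ext1 n
  rw [map_add, coeff_formalIntegral, coeff_formalIntegral, coeff_formalIntegral,
    ← integral_add (hf n) (hg n), map_add]
  rfl

theorem FormalIntegrable.formalIntegral_sub {f g : FormalFn N} (hf : FormalIntegrable f)
    (hg : FormalIntegrable g) :
    formalIntegral (f - g) = formalIntegral f - formalIntegral g := by
  ext1 n
  rw [map_sub, coeff_formalIntegral, coeff_formalIntegral, coeff_formalIntegral,
    ← integral_sub (hf n) (hg n), map_sub]
  rfl

theorem FormalIntegrable.formalIntegral_smul {f : FormalFn N} (hf : FormalIntegrable f)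
    (r : ℝ⟦X⟧) : formalIntegral (r • f) = r * formalIntegral f := by
  have h1 : ∀ p : ℕ × ℕ, Integrable fun z : Fin N → ℝ =>
      (PowerSeries.coeff p.1 r • PowerSeries.coeff p.2 f : SmoothFn N) z := by
    intro p
    exact (hf p.2).const_mul (PowerSeries.coeff p.1 r)
  have h2 : ∀ p : ℕ × ℕ, (∫ z : Fin N → ℝ,
      (PowerSeries.coeff p.1 r • PowerSeries.coeff p.2 f : SmoothFn N) z) =
        PowerSeries.coeff p.1 r * ∫ z : Fin N → ℝ, PowerSeries.coeff p.2 f z := by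
    intro p
    exact integral_const_mul (PowerSeries.coeff p.1 r) _
  ext1 n
  rw [coeff_formalIntegral, coeff_smul_formalFn, PowerSeries.coeff_mul]
  refine (integrable_finset_sum_apply (Finset.HasAntidiagonal.antidiagonal n)
    (f := fun p : ℕ × ℕ => PowerSeries.coeff p.1 r • PowerSeries.coeff p.2 f)
    fun p _ => h1 p).2.trans ?_
  simp only [h2, coeff_formalIntegral]

theorem formalIntegral_sum {ι : Type*} (s : Finset ι) {f : ι → FormalFn N}
    (hf : ∀ i ∈ s, FormalIntegrable (f i)) :
    formalIntegral (∑ i ∈ s, f i) = ∑ i ∈ s, formalIntegral (f i) := by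
  ext1 n
  rw [coeff_formalIntegral, map_sum, map_sum, (integrable_finset_sum_apply _ fun i hi => hf i hi n).2]
  exact Finset.sum_congr rfl fun i _ => (coeff_formalIntegral _ _).symm

theorem formalIntegral_constSeries (p : FormalZeta N) {f : FormalFn N}
    (hf : CoeffsIn (compactFn N) f) : formalIntegral (opHom N (constSeries p) f) =
      PowerSeries.map MvPolynomial.constantCoeff p * formalIntegral f := by
  ext1 n
  rw [coeff_formalIntegral, coeff_opHom, PowerSeries.coeff_mul]
  refine (integrable_finset_sum_apply (Finset.HasAntidiagonal.antidiagonal n)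
    (f := fun q : ℕ × ℕ => PowerSeries.coeff q.1 (constSeries p) (PowerSeries.coeff q.2 f))
    fun q _ => integrable_of_mem_compactFn (weyl_apply_mem_compactFn
      (coeff_constSeries_mem_weyl p q.1) (hf q.2))).2.trans ?_
  refine Finset.sum_congr rfl fun q _ => ?_
  rw [coeff_constSeries, integral_constOp _ (hf q.2), PowerSeries.coeff_map, coeff_formalIntegral]

end FormalIntegration
end

/-! ### Integrals of bilinear series. -/

noncomputable section

open SmoothFn MeasureTheory

section BilinearSeries

variable {N : ℕ}

theorem opHom_leftSeries_flip (β : ℕ → Bil N) (f g : FormalFn N) :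
    opHom N (leftSeries β f) g = opHom N (leftSeries (fun n => (β n).flip) g) f := by
  ext1 n
  rw [coeff_opHom, coeff_opHom]
  simp only [coeff_leftSeries, LinearMap.sum_apply, LinearMap.flip_apply]
  rw [sum_antidiagonal_triple n fun i j k =>
      β j (PowerSeries.coeff i f) (PowerSeries.coeff k g),
    sum_antidiagonal_triple n fun i j k =>
      β j (PowerSeries.coeff k f) (PowerSeries.coeff i g),
    sum_antidiagonal_triple_swap n fun i j k =>
      β j (PowerSeries.coeff i f) (PowerSeries.coeff k g),
    sum_antidiagonal_triple_swap n fun i j k =>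
      β j (PowerSeries.coeff k f) (PowerSeries.coeff i g)]
  refine Finset.sum_congr rfl fun p _ => ?_
  rw [← Finset.Nat.sum_antidiagonal_swap]
  rfl

theorem leftSeries_add (β : ℕ → Bil N) (f g : FormalFn N) :
    leftSeries β (f + g) = leftSeries β f + leftSeries β g := by
  ext1 n
  simp only [map_add, coeff_leftSeries, Finset.sum_add_distrib]

theorem leftSeries_sub_left (β γ : ℕ → Bil N) (f : FormalFn N) :
    leftSeries (fun n => β n - γ n) f = leftSeries β f - leftSeries γ f := by
  ext1 n
  simp only [map_sub, coeff_leftSeries, LinearMap.sub_apply, Finset.sum_sub_distrib]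

theorem opHom_leftSeries_smul (β : ℕ → Bil N) (r : ℝ⟦X⟧) (f g : FormalFn N) :
    opHom N (leftSeries β (r • f)) g = r • opHom N (leftSeries β f) g := by
  rw [opHom_leftSeries_flip, map_smul, ← opHom_leftSeries_flip]

/-- The bilinear series `(f, g) ↦ b(P g, f)`. -/
def flipSubst (b : ℕ → Bil N) (P : PowerSeries (Module.End ℝ (SmoothFn N))) (n : ℕ) : Bil N :=
  ∑ q ∈ Finset.HasAntidiagonal.antidiagonal n, rightSubst (PowerSeries.coeff q.2 P) (b q.1).flip

theorem flipSubst_mem_bidiff {b : ℕ → Bil N} (hb : ∀ n, b n ∈ bidiff N)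
    {P : PowerSeries (Module.End ℝ (SmoothFn N))} (hP : ∀ n, PowerSeries.coeff n P ∈ weyl N)
    (n : ℕ) : flipSubst b P n ∈ bidiff N :=
  sum_mem fun _ _ => rightSubst_mem_bidiff (hP _) (flip_mem_bidiff (hb _))

/-- This puts `(P g) ⋆ f` in the form of a bidifferential series in `(f, g)`, so that both sides of
the trace identity can be subtracted as one series. -/
theorem opHom_leftSeries_opHom (b : ℕ → Bil N) (P : PowerSeries (Module.End ℝ (SmoothFn N)))
    (f g : FormalFn N) :
    opHom N (leftSeries b (opHom N P g)) f = opHom N (leftSeries (flipSubst b P) f) g := by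
  rw [opHom_leftSeries_flip, ← Module.End.mul_apply, ← map_mul]
  congr 2
  ext1 n
  simp only [PowerSeries.coeff_mul, coeff_leftSeries, Finset.sum_mul]
  rw [sum_antidiagonal_triple n fun i j k =>
    (b j).flip (PowerSeries.coeff i f) * PowerSeries.coeff k P]
  refine Finset.sum_congr rfl fun p _ => ?_
  ext1 h
  simp [flipSubst, LinearMap.sum_apply]

end BilinearSeries

section Pairing

variable {N : ℕ} {β : ℕ → Bil N}

theorem IntegrablePair.integrable_coeff (hβ : ∀ n, β n ∈ bidiff N) {f g : FormalFn N}
    (h : IntegrablePair f g) (n : ℕ) :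
    (Integrable fun z : Fin N → ℝ => PowerSeries.coeff n (opHom N (leftSeries β f) g) z) ∧
      ∫ z : Fin N → ℝ, PowerSeries.coeff n (opHom N (leftSeries β f) g) z =
        ∑ p ∈ Finset.HasAntidiagonal.antidiagonal n,
          ∑ q ∈ Finset.HasAntidiagonal.antidiagonal p.1, ∫ z : Fin N → ℝ,
            β q.2 (PowerSeries.coeff q.1 f) (PowerSeries.coeff p.2 g) z := by
  have h1 : ∀ p : ℕ × ℕ, _ := fun p => integrable_finset_sum_apply
    (Finset.HasAntidiagonal.antidiagonal p.1)
    (f := fun q : ℕ × ℕ => β q.2 (PowerSeries.coeff q.1 f) (PowerSeries.coeff p.2 g))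
    fun q _ => IntegrableProducts.integrable_bidiff
      (fun v w r => h q.1 p.2 v w r) (hβ q.2)
  have h2 := integrable_finset_sum_apply (Finset.HasAntidiagonal.antidiagonal n)
    (f := fun p : ℕ × ℕ => ∑ q ∈ Finset.HasAntidiagonal.antidiagonal p.1,
      β q.2 (PowerSeries.coeff q.1 f) (PowerSeries.coeff p.2 g)) fun p _ => (h1 p).1
  have h3 : PowerSeries.coeff n (opHom N (leftSeries β f) g) =
      ∑ p ∈ Finset.HasAntidiagonal.antidiagonal n,
        ∑ q ∈ Finset.HasAntidiagonal.antidiagonal p.1,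
          β q.2 (PowerSeries.coeff q.1 f) (PowerSeries.coeff p.2 g) := by
    rw [coeff_opHom]
    simp only [coeff_leftSeries, LinearMap.sum_apply]
  rw [h3]
  exact ⟨h2.1, h2.2.trans (Finset.sum_congr rfl fun p _ => (h1 p).2)⟩

theorem IntegrablePair.formalIntegrable (hβ : ∀ n, β n ∈ bidiff N) {f g : FormalFn N}
    (h : IntegrablePair f g) : FormalIntegrable (opHom N (leftSeries β f) g) :=
  fun n => (h.integrable_coeff hβ n).1

theorem integrablePair_of_mem_compactFn {f : FormalFn N} (hf : CoeffsIn (compactFn N) f)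
    (g : FormalFn N) : IntegrablePair f g :=
  fun m n v w p => integrableProducts_of_mem_compactFn (hf m) (PowerSeries.coeff n g) v w p

variable {ψ : Matrix (Fin N) (Fin N) (FormalZeta N)} {𝔤 : Type*} [LieRing 𝔤]
  [LieAlgebra ℝ 𝔤] {bs : Module.Basis (Fin N) ℝ 𝔤}

/-- If the integral of a bidifferential series vanishes for compactly supported first arguments and
second arguments in the image of the algebra generated by the `Z_A`, it vanishes whenever the
required products are integrable. -/
theorem IsLeftInvariantFrame.formalIntegral_eq_zero (hψ : IsLeftInvariantFrame bs ψ)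
    (hβ : ∀ n, β n ∈ bidiff N)
    (h0 : ∀ T ∈ frameAlg ψ, ∀ f ∈ compactFn N,
      formalIntegral (opHom N (leftSeries β (PowerSeries.C f)) (RightOp.act 1 T)) = 0)
    {f g : FormalFn N} (hfg : IntegrablePair f g) :
    formalIntegral (opHom N (leftSeries β f) g) = 0 := by
  choose D hD hβD using fun n => exists_transpose (hβ n)
  -- By the hypothesis every coefficient of `D Ω(T)` is orthogonal to all test functions, so `D`
  -- kills `Ω(T)` for all `T` in the generated algebra, and faithfulness applies.
  have hzero : PowerSeries.mk D = 0 := by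
    refine hψ.series_eq_zero (fun n => by rw [PowerSeries.coeff_mk]; exact hD n) fun T hT => ?_
    ext1 n
    rw [map_zero]
    refine eq_zero_of_integral_compactFn fun φ hφ => ?_
    have h1 := congrArg (PowerSeries.coeff n) (h0 T hT φ hφ)
    have hC : ∀ k, PowerSeries.coeff k (leftSeries β (PowerSeries.C φ)) = β k φ := by
      intro k
      rw [coeff_leftSeries, Finset.sum_eq_single (0, k)]
      · simp
      · rintro ⟨i, j⟩ hij hne
        rw [PowerSeries.coeff_C, if_neg, map_zero]
        rintro rfl
        rw [Finset.HasAntidiagonal.mem_antidiagonal] at hij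
        exact hne (by simpa using hij)
      · simp
    rw [coeff_formalIntegral, coeff_opHom, map_zero] at h1
    simp only [hC] at h1
    have h2 := (integrable_finset_sum_apply (Finset.HasAntidiagonal.antidiagonal n)
      (f := fun p : ℕ × ℕ => β p.1 φ (PowerSeries.coeff p.2 (RightOp.act 1 T : FormalFn N)))
      fun p _ => (integrableProducts_of_mem_compactFn hφ _).integrable_bidiff (hβ p.1)).2
    have h3 := (integrable_finset_sum_apply (Finset.HasAntidiagonal.antidiagonal n)
      (f := fun p : ℕ × ℕ => φ * D p.1 (PowerSeries.coeff p.2 (RightOp.act 1 T : FormalFn N)))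
      fun p _ => ((integrableProducts_of_mem_compactFn hφ _).right (hD p.1)).integrable_mul).2
    rw [coeff_opHom]
    simp only [PowerSeries.coeff_mk, Finset.mul_sum]
    rw [h3, ← h1, h2]
    exact Finset.sum_congr rfl fun p _ =>
      (hβD p.1 φ _ (integrableProducts_of_mem_compactFn hφ _)).symm
  have hD0 : ∀ n, D n = 0 := fun n => by
    rw [← PowerSeries.coeff_mk n D, hzero, map_zero]
  ext1 n
  rw [coeff_formalIntegral, (hfg.integrable_coeff hβ n).2, map_zero]
  refine Finset.sum_eq_zero fun p _ => Finset.sum_eq_zero fun q _ => ?_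
  rw [hβD q.2 _ _ fun v w r => hfg q.1 p.2 v w r, hD0, LinearMap.zero_apply, mul_zero]
  exact integral_zero _ _

end Pairing

/-! ### The twisted trace property. -/

section TwistedTrace

variable {N : ℕ} {ψ : Matrix (Fin N) (Fin N) (FormalZeta N)} {𝔤 : Type*} [LieRing 𝔤]
  [LieAlgebra ℝ 𝔤] {bs : Module.Basis (Fin N) ℝ 𝔤} {b : ℕ → Bil N}

namespace IsStarProduct

theorem leftSeries_one (hb : IsStarProduct ψ b) (hψ : IsLeftInvariantFrame bs ψ) :
    leftSeries b 1 = 1 := by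
  refine hψ.series_eq (hb.coeff_leftSeries_mem_weyl hasPolyCoeffs_one) (fun n => ?_)
    (hb.leftSeries_commute 1) (fun A => by rw [one_mul, mul_one]) ?_
  · rw [PowerSeries.coeff_one]
    split_ifs
    · exact one_mem _
    · exact zero_mem _
  · rw [hb.opHom_leftSeries_one, map_one (opHom N), Module.End.one_apply]

/-- Associativity of the star product on polynomials, from uniqueness: both sides commute with the
`Z_A` and send `1` to `f ⋆ g`. Polynomial coefficients keep the series in the Weyl algebra, as
`series_eq` requires. -/
theorem leftSeries_mul (hb : IsStarProduct ψ b) (hψ : IsLeftInvariantFrame bs ψ) {f g : FormalFn N}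
    (hf : HasPolyCoeffs f) (hg : HasPolyCoeffs g) :
    leftSeries b (opHom N (leftSeries b f) g) = leftSeries b f * leftSeries b g := by
  refine hψ.series_eq (hb.coeff_leftSeries_mem_weyl
      (hg.opHom (fun P hP f hf => weyl_apply_mem_polyFn hP hf) (hb.coeff_leftSeries_mem_weyl hf)))
    (coeff_mul_mem_weyl (hb.coeff_leftSeries_mem_weyl hf) (hb.coeff_leftSeries_mem_weyl hg))
    (hb.leftSeries_commute _) (fun A => ?_) ?_
  · rw [mul_assoc, hb.leftSeries_commute, ← mul_assoc, hb.leftSeries_commute, mul_assoc]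
  · rw [hb.opHom_leftSeries_one, map_mul, Module.End.mul_apply, hb.opHom_leftSeries_one]

/-- In the right-invariant field `∑ Z_B r_B(∂)` the series `r_B(∂)` is moved to the left, where the
integral replaces it by `r_B(0) = δ_{AB}`. The commutators `(Z_B r_B)(∂)` contribute their values at
`0`, whose sum is a trace of structure constants. -/
theorem formalIntegral_leftSeries_coord (hb : IsStarProduct ψ b) (hψ : IsLeftInvariantFrame bs ψ)
    (A : Fin N) {h : FormalFn N} (hh : CoeffsIn (compactFn N) h) :
    formalIntegral (opHom N (leftSeries b (PowerSeries.C (coord A))) h) =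
      formalIntegral (opHom N (frameSeries ψ A) h) -
        PowerSeries.X * PowerSeries.C (traceConst bs A) * formalIntegral h := by
  obtain ⟨r, hr0, hr1, hr⟩ := hψ.exists_rightInvariant A
  have hcpt : ∀ P ∈ weyl N, ∀ f ∈ compactFn N, P f ∈ compactFn N := fun P hP f hf =>
    weyl_apply_mem_compactFn hP hf
  have hfr : ∀ B, CoeffsIn (compactFn N) (opHom N (frameSeries ψ B) h) := fun B =>
    hh.opHom hcpt (coeff_frameSeries_mem_weyl ψ B)
  have hcs : ∀ (p : FormalZeta N) {f : FormalFn N}, CoeffsIn (compactFn N) f →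
      CoeffsIn (compactFn N) (opHom N (constSeries p) f) := fun p f hf =>
    hf.opHom hcpt (coeff_constSeries_mem_weyl p)
  have hterm : ∀ B, opHom N (frameSeries ψ B * constSeries (r B)) h =
      opHom N (constSeries (r B)) (opHom N (frameSeries ψ B) h) -
        opHom N (constSeries (∑ C, ψ B C * zetaDeriv C (r B))) h := by
    intro B
    rw [← Module.End.mul_apply, ← map_mul, constSeries_mul_frameSeries, map_add,
      LinearMap.add_apply, add_sub_cancel_right]
  have hint : ∀ B, FormalIntegrable (opHom N (frameSeries ψ B * constSeries (r B)) h) := fun B =>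
    (hh.opHom hcpt (coeff_mul_mem_weyl (coeff_frameSeries_mem_weyl ψ B)
      (coeff_constSeries_mem_weyl _))).formalIntegrable
  have hval : ∀ B, formalIntegral (opHom N (frameSeries ψ B * constSeries (r B)) h) =
      (if B = A then formalIntegral (opHom N (frameSeries ψ B) h) else 0) +
        PowerSeries.X * PowerSeries.C (structConst bs B A B) * formalIntegral h := by
    intro B
    rw [hterm, FormalIntegrable.formalIntegral_sub (hcs _ (hfr B)).formalIntegrable
      (hcs _ hh).formalIntegrable, formalIntegral_constSeries _ (hfr B),
      formalIntegral_constSeries _ hh, hr0, map_sum]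
    simp only [map_mul, hψ.counit, hr1, ite_mul, one_mul, zero_mul, Finset.sum_ite_eq,
      Finset.mem_univ, if_true, neg_mul, sub_neg_eq_add]
  -- Antisymmetry of the bracket in the first two indices fixes the sign of the shift.
  have htr : ∑ B, structConst bs B A B = -traceConst bs A := by
    rw [traceConst, ← Finset.sum_neg_distrib]
    refine Finset.sum_congr rfl fun B _ => ?_
    rw [structConst, structConst, ← lie_skew, map_neg, Finsupp.neg_apply]
  rw [hb.leftSeries_coord hψ hr0 hr, map_sum, LinearMap.sum_apply,
    formalIntegral_sum _ fun B _ => hint B]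
  simp only [hval, Finset.sum_add_distrib, Finset.sum_ite_eq', Finset.mem_univ, if_true]
  rw [← Finset.sum_mul, ← Finset.mul_sum, ← map_sum, htr, map_neg]
  ring

/-- The operator `s(∂)` is multiplicative for the star product because it is the translation, an
algebra homomorphism, seen through `Ω`. -/
theorem opHom_constSeries_mul (hb : IsStarProduct ψ b) {s t : FormalZeta N} (hst : s * t = 1)
    (hs1 : PowerSeries.map MvPolynomial.constantCoeff s = 1)
    (hs : ∀ A, ∑ B, ψ A B * zetaDeriv B s = PowerSeries.X * (traceConst bs A • s))
    {S T : RightOp N} (hS : S ∈ QuantumFn ψ) (hT : T ∈ QuantumFn ψ) :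
    opHom N (constSeries s) (RightOp.act 1 (S * T)) =
      opHom N (leftSeries b (opHom N (constSeries s) (RightOp.act 1 S)))
        (opHom N (constSeries s) (RightOp.act 1 T)) := by
  obtain ⟨K, -, hK⟩ := exists_translation hst hs1 hs
  have h1 := hK (⟨S, hS⟩ * ⟨T, hT⟩)
  have h2 := hK ⟨S, hS⟩
  have h3 := hK ⟨T, hT⟩
  rw [map_mul] at h1
  change RightOp.act 1 (_ * _) = opHom N (constSeries s) (RightOp.act 1 (S * T)) at h1
  rw [← h1, RightOp.act_mul, hb.act_eq (K ⟨T, hT⟩).2]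
  exact congrArg₂ (fun x y => opHom N (leftSeries b x) y) h2 h3

/-- Induction on `T`. For a generator, `s(∂) z_A = z_A + λ c_A`, and the shift cancels the trace
term of `formalIntegral_leftSeries_coord`. -/
theorem formalIntegral_act (hb : IsStarProduct ψ b) (hψ : IsLeftInvariantFrame bs ψ)
    {s t : FormalZeta N} (hst : s * t = 1)
    (hs1 : PowerSeries.map MvPolynomial.constantCoeff s = 1)
    (hs : ∀ A, ∑ B, ψ A B * zetaDeriv B s = PowerSeries.X * (traceConst bs A • s))
    {T : RightOp N} (hT : T ∈ frameAlg ψ) {f : FormalFn N} (hf : CoeffsIn (compactFn N) f) :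
    formalIntegral (RightOp.act f T) =
      formalIntegral (opHom N (leftSeries b (opHom N (constSeries s) (RightOp.act 1 T))) f) := by
  have hcpt : ∀ P ∈ weyl N, ∀ f ∈ compactFn N, P f ∈ compactFn N := fun P hP f hf =>
    weyl_apply_mem_compactFn hP hf
  have hpol : ∀ P ∈ weyl N, ∀ f ∈ (polyFn N).toSubmodule, P f ∈ (polyFn N).toSubmodule :=
    fun P hP f hf => weyl_apply_mem_polyFn hP hf
  have hS1 : ∀ p : FormalZeta N, PowerSeries.map MvPolynomial.constantCoeff p = 1 →
      opHom N (constSeries p) 1 = 1 := fun p hp => by rw [opHom_constSeries_one, hp, one_smul]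
  have hpoly : ∀ T ∈ frameAlg ψ,
      HasPolyCoeffs (opHom N (constSeries s) (RightOp.act 1 T)) := fun T hT =>
    (hasPolyCoeffs_one.act hpol hT).opHom hpol (coeff_constSeries_mem_weyl s)
  have hcoeffs : ∀ T ∈ frameAlg ψ, ∀ f : FormalFn N, CoeffsIn (compactFn N) f →
      CoeffsIn (compactFn N)
        (opHom N (leftSeries b (opHom N (constSeries s) (RightOp.act 1 T))) f) := fun T hT f hf =>
    hf.opHom hcpt (hb.coeff_leftSeries_mem_weyl (hpoly T hT))
  induction hT using Algebra.adjoin_induction generalizing f with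
  | mem x hx =>
    obtain ⟨A, rfl⟩ := hx
    have ht1 : PowerSeries.map MvPolynomial.constantCoeff t = (1 : ℝ⟦X⟧) := by
      have := congrArg (PowerSeries.map MvPolynomial.constantCoeff) hst
      rwa [map_mul, hs1, one_mul, map_one] at this
    have h1 := conj_frameOp (ψ := ψ) hst hs A 1
    rw [hS1 t ht1, hψ.opHom_frameSeries_one] at h1
    rw [act_frameOp, act_frameOp, hψ.opHom_frameSeries_one, h1, leftSeries_add, map_add,
      LinearMap.add_apply, opHom_leftSeries_smul, hb.leftSeries_one hψ, map_one,
      Module.End.one_apply, FormalIntegrable.formalIntegral_add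
        (hf.opHom hcpt (hb.coeff_leftSeries_mem_weyl
          (CoeffsIn.C (coord_mem_polyFn A)))).formalIntegrable (hf.smul _).formalIntegrable,
      hf.formalIntegrable.formalIntegral_smul, hb.formalIntegral_leftSeries_coord hψ A hf,
      sub_add_cancel]
  | algebraMap r =>
    rw [RightOp.act_algebraMap, RightOp.act_algebraMap, map_smul, hS1 s hs1,
      opHom_leftSeries_smul, hb.leftSeries_one hψ, map_one, Module.End.one_apply]
  | add x y hx hy h1 h2 =>
    rw [RightOp.act_add, RightOp.act_add, map_add, leftSeries_add, map_add, LinearMap.add_apply,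
      FormalIntegrable.formalIntegral_add (hf.act hcpt hx).formalIntegrable
        (hf.act hcpt hy).formalIntegrable,
      FormalIntegrable.formalIntegral_add (hcoeffs x hx f hf).formalIntegrable
        (hcoeffs y hy f hf).formalIntegrable, h1 hf, h2 hf]
  -- Writing `x'` and `y'` for `s(∂) Ω(x)` and `s(∂) Ω(y)`: `∫ (f·x)·y = ∫ y' ⋆ (f·x) = ∫ (y' ⋆ f)·x
  -- = ∫ x' ⋆ (y' ⋆ f)`, where the middle step is that left multiplication commutes with the right
  -- action.
  | mul x y hx hy h1 h2 =>
    rw [hb.opHom_constSeries_mul hst hs1 hs (subset_closure hx) (subset_closure hy),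
      hb.leftSeries_mul hψ (hpoly x hx) (hpoly y hy), map_mul, Module.End.mul_apply,
      ← h1 (hcoeffs y hy f hf), RightOp.act_mul, h2 (hf.act hcpt hx),
      opHom_act_of_mem_frameAlg (hb.leftSeries_commute _) hx]

/-- The difference of the two sides is the integral of one bidifferential series. It vanishes on
test functions paired with `Ω(T)` by `formalIntegral_act`, since `f · T = f ⋆ Ω(T)`, and so vanishes
on every integrable pair by `formalIntegral_eq_zero`. -/
theorem formalIntegral_flip (hb : IsStarProduct ψ b) (hψ : IsLeftInvariantFrame bs ψ)
    {s t : FormalZeta N} (hst : s * t = 1)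
    (hs1 : PowerSeries.map MvPolynomial.constantCoeff s = 1)
    (hs : ∀ A, ∑ B, ψ A B * zetaDeriv B s = PowerSeries.X * (traceConst bs A • s))
    {f g : FormalFn N} (hfg : IntegrablePair f g) :
    formalIntegral (opHom N (leftSeries b f) g) =
      formalIntegral (opHom N (leftSeries b (opHom N (constSeries s) g)) f) := by
  have hE := flipSubst_mem_bidiff hb.mem_bidiff (coeff_constSeries_mem_weyl s)
  have hdiff : ∀ f g : FormalFn N, IntegrablePair f g →
      formalIntegral (opHom N (leftSeries (fun n => b n - flipSubst b (constSeries s) n) f) g) =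
        formalIntegral (opHom N (leftSeries b f) g) -
          formalIntegral (opHom N (leftSeries b (opHom N (constSeries s) g)) f) := by
    intro f g hfg
    rw [leftSeries_sub_left, map_sub, LinearMap.sub_apply,
      FormalIntegrable.formalIntegral_sub (hfg.formalIntegrable hb.mem_bidiff)
        (hfg.formalIntegrable hE), opHom_leftSeries_opHom]
  rw [← sub_eq_zero, ← hdiff f g hfg]
  refine hψ.formalIntegral_eq_zero (fun n => sub_mem (hb.mem_bidiff n) (hE n))
    (fun T hT φ hφ => ?_) hfg
  have hC : CoeffsIn (compactFn N) (PowerSeries.C φ : FormalFn N) := CoeffsIn.C hφ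
  rw [hdiff _ _ (integrablePair_of_mem_compactFn hC _), ← hb.act_eq (subset_closure hT),
    hb.formalIntegral_act hψ hst hs1 hs hT hC, sub_self]

end IsStarProduct

end TwistedTrace
end

theorem mainTheorem2 {N : ℕ} {𝔤 : Type*} [LieRing 𝔤] [LieAlgebra ℝ 𝔤]
    (b : Module.Basis (Fin N) ℝ 𝔤) (ψ : Matrix (Fin N) (Fin N) (FormalZeta N))
    (hψ : IsLeftInvariantFrame b ψ) :
    (∃! K : QuantumFn ψ →ₐ[ℝ⟦X⟧] QuantumFn ψ,
      IsTranslation (fun A => PowerSeries.X * PowerSeries.C (traceConst b A)) K) ∧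
    ∀ K : QuantumFn ψ →ₐ[ℝ⟦X⟧] QuantumFn ψ,
      IsTranslation (fun A => PowerSeries.X * PowerSeries.C (traceConst b A)) K →
      ∀ f g : QuantumFn ψ, IntegrablePair (Omega f) (Omega g) →
        FormalIntegrable (Omega (f * g)) ∧ FormalIntegrable (Omega (K g * f)) ∧
        quantumIntegral (f * g) = quantumIntegral (K g * f) := by
  obtain ⟨s, t, hst, hs1, hs⟩ := hψ.exists_modular
  obtain ⟨β, hβ⟩ := hψ.exists_starProduct
  obtain ⟨K₀, hK₀, hΩ⟩ := exists_translation hst hs1 hs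
  refine ⟨⟨K₀, hK₀, fun K hK => hK.unique hK₀⟩, fun K hK f g hfg => ?_⟩
  obtain rfl := hK.unique hK₀
  have h1 : Omega (f * g) = opHom N (leftSeries β (Omega f)) (Omega g) := hβ.act_eq g.2 _
  have h2 : Omega (K g * f) =
      opHom N (leftSeries β (opHom N (constSeries s) (Omega g))) (Omega f) := by
    rw [← hΩ]
    exact hβ.act_eq f.2 _
  refine ⟨?_, ?_, ?_⟩
  · rw [h1]
    exact hfg.formalIntegrable hβ.mem_bidiff
  -- As a bidifferential series in the original pair, this product is covered by the given
  -- integrability hypothesis, although `s(∂)` may contain derivatives of arbitrarily high order as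
  -- the power of `λ` grows.
  · rw [h2, opHom_leftSeries_opHom]
    exact hfg.formalIntegrable
      (flipSubst_mem_bidiff hβ.mem_bidiff (coeff_constSeries_mem_weyl s))
  · rw [quantumIntegral, quantumIntegral, h1, h2]
    exact hβ.formalIntegral_flip hψ hst hs1 hs hfg
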